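/- Let $(x;q)_n=\prod_{i=0}^{n-1}(1-xq^i)$ and $(x_1,\dots,x_m;q)_n=\prod_{i}(x_i;q)_n$. Let $${}_{r+1}\phi_r\left[{a_1,\dots,a_{r+1}\atop b_1,\dots,b_r};q,z\right]=\sum_{j\ge 0}\frac{(a_1,\dots,a_{r+1};q)_j}{(q,b_1,\dots,b_r;q)_j}z^j,$$ $${}_{r+1}W_r(a_1;a_4,\dots,a_{r+1};q,z)=\sum_{j\ge0}\frac{1-a_1q^{2j}}{1-a_1}\,\frac{(a_1,a_4,\dots,a_{r+1};q)_j}{(q,qa_1/a_4,\dots,qa_1/a_{r+1};q)_j}z^j .$$ (The series $W$ is the ${}_{r+1}\phi_r$ series with numerator parameters $a_1,q\sqrt{a_1},-q\sqrt{a_1},a_4,\dots,a_{r+1}$ and denominator parameters $\sqrt{a_1},-\sqrt{a_1},qa_1/a_4,\dots,qa_1/a_{r+1}$.) Let $a,k,q$ (and $\rho_1,\rho_2$ in (1)) be nonzero complex numbers and let $n\ge0$ be an integer. Put $$P=\frac{(k/a,-q;q)_n}{(-k,aq;q)_n}\,\frac{(akq;q^2)_n}{(kq/a;q^2)_n},\qquad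 C_j=\frac{(kq^n,q^{-n};q)_j}{(aq^{1-n}/k,aq^{1+n};q)_j}.$$ All series below terminate. Each of the following identities holds whenever no denominator vanishes in $P$, in the terms of the finite sums, and in the terms $j\le N$ of the series, where $N$ is $\lfloor n/2\rfloor$ for the right-hand series in (4) and the left-hand series in (8), and $N=n$ otherwise. (1) $${}_{10}W_9\left(\tfrac{ak}{q};-a,-aq,\tfrac{k\rho_1}{aq},\tfrac{k\rho_2}{aq},\tfrac{a^2q^2}{\rho_1\rho_2},k^2q^{2n},q^{-2n};q^2,\tfrac{q^2a}{k}\right)=P\sum_{j=0}^nC_j\frac{\left(a^2,aq^2,\rho_1,\rho_2,\frac{a^3q^3}{k\rho_1\rho_2};q^2\right)_j}{\left(a,\frac{a^2q^2}{\rho_1},\frac{a^2q^2}{\rho_2},\frac{k\rho_1\rho_2}{aq},q^2;q^2\right)_j}q^j.$$ (2) For either square root $s$ of $ak/q$, $${}_7\phi_6\left[{q^2s,-q^2s,-a,-aq,\frac{k^2}{a^2q^4},k^2q^{2n},q^{-2n}\atop s,-s,-k,-kq,akq^{2n+1},\frac{aq^{1-2n}}{k}};q^2,\tfrac{q^2a}{k}\right]=P\sum_{j=0}^nC_j\frac{\left(a^2,aq^2,\frac{k}{aq^3};q^2\right)_j}{\left(a,\frac{a^3q^5}{k},q^2;q^2\right)_j}\frac{\left(\frac{q^3a^3}{k},\frac{q^5a^3}{k};q^4\right)_j}{\left(\frac{ak}{q},akq;q^4\right)_j}q^j.$$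 (3) For square roots $s$ of $ak/q$ and $t$ of $a^3q/k$ with $st=a^2$, $${}_6\phi_5\left[{-q^2s,-a,-aq,\frac{k^2}{a^2q^2},k^2q^{2n},q^{-2n}\atop -s,-k,-kq,akq^{2n+1},\frac{aq^{1-2n}}{k}};q^2,\tfrac{q^2a}{k}\right]=P\sum_{j=0}^nC_j\frac{\left(a^2,aq^2,\frac{k}{aq},t,-q^2t;q^2\right)_j}{\left(a,\frac{a^3q^3}{k},q^2s,-s,q^2;q^2\right)_j}\frac{\left(\frac{q^3a^3}{k};q^4\right)_j}{(akq;q^4)_j}q^j.$$ (4) $${}_8W_7\left(\tfrac{ak}{q};-a,k,\tfrac{aq}{k},k^2q^{2n},q^{-2n};q^2,-q\right)=P\;{}_{10}W_9\left(a;-a,\tfrac{aq}{k},-\tfrac{aq}{k},kq^n,kq^{1+n},q^{1-n},q^{-n};q^2,q^2\right).$$ (5) For either square root $r$ of $a$, $${}_8W_7\left(\tfrac{ak}{q};-a,-\tfrac kq,\tfrac{aq^3}{k},k^2q^{2n},q^{-2n};q^2,1\right)=P\;{}_8W_7\left(a;ir,-ir,\tfrac{aq^2}{k},kq^n,q^{-n};q,1\right).$$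 (6) $${}_6W_5\left(\tfrac{ak}{q};\tfrac{aq}{k},k^2q^{2n},q^{-2n};q^2,1\right)=P\;{}_6W_5\left(a;\tfrac{aq}{k},kq^n,q^{-n};q,1\right).$$ (7) $${}_{10}W_9\left(\tfrac{ak}{q};-a,k,\tfrac kq,-\tfrac kq,\tfrac{aq^3}{k},k^2q^{2n},q^{-2n};q^2,\tfrac{q^2a}{k}\right)=P\sum_{j=0}^n\frac{(1+a)\left(\frac{aq^2}{k},-\frac{aq^2}{k},kq^n,q^{-n};q\right)_j}{(1+aq^{2j})\left(\frac{aq^{1-n}}{k},aq^{1+n},-q,q;q\right)_j}q^j.$$ (8) $${}_{12}W_{11}\left(\tfrac{ak}{q};-a,-aq,-aq^2,-aq^3,\tfrac{k^2}{a^2q^2},k^2q^{2n},k^2q^{2+2n},q^{2-2n},q^{-2n};q^4,\tfrac{q^4a^2}{k^2}\right)=P\sum_{j=0}^nC_j\frac{\left(a^2,aq^2,\frac{k}{aq};q^2\right)_j}{\left(a,\frac{a^3q^3}{k},q^2;q^2\right)_j}\frac{\left(\frac{a^3q^3}{k};q^4\right)_j}{(akq;q^4)_j}\left(-\frac{q^2a}{k}\right)^j.$$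 -/

import Mathlib

open scoped BigOperators

/-- The `q`-shifted factorial `(x; q)_n = ∏_{i<n} (1 - x q^i)`. -/
noncomputable def qPoch (x q : ℂ) (n : ℕ) : ℂ :=
  ∏ i ∈ Finset.range n, (1 - x * q ^ i)

/-- The compact notation `(x₁, …, x_m; q)_n = (x₁; q)_n ⋯ (x_m; q)_n`. -/
noncomputable def qPochs (xs : List ℂ) (q : ℂ) (n : ℕ) : ℂ :=
  (xs.map fun x => qPoch x q n).prod

/-- The basic hypergeometric series `_{r+1}φ_r [as; bs; q, z]`, where `as` has one entry more
than `bs`: the sum over `j ≥ 0` of `(as; q)_j / (q, bs; q)_j * z ^ j`. -/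
noncomputable def phiSeries (as bs : List ℂ) (q z : ℂ) : ℂ :=
  ∑' j : ℕ, qPochs as q j / qPochs (q :: bs) q j * z ^ j

/-- The very-well-poised series `_{r+1}W_r (a₁; a₄, …, a_{r+1}; q, z)`, where `L` is the list
`[a₄, …, a_{r+1}]`.  The four parameters `q √a₁, -q √a₁` over `√a₁, -√a₁` are written through
their quotient `(1 - a₁ q^{2j}) / (1 - a₁)`, see `wSeries_eq_phiSeries`. -/
noncomputable def wSeries (a₁ : ℂ) (L : List ℂ) (q z : ℂ) : ℂ :=
  ∑' j : ℕ, (1 - a₁ * q ^ (2 * j)) / (1 - a₁) *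
    (qPochs (a₁ :: L) q j / qPochs (q :: L.map (fun x => q * a₁ / x)) q j) * z ^ j

/-- The denominators of the terms `j ≤ N` of `phiSeries as bs q z` do not vanish. -/
def PhiDenNeZero (bs : List ℂ) (q : ℂ) (N : ℕ) : Prop :=
  qPochs (q :: bs) q N ≠ 0

/-- The denominators of the terms `j ≤ N` of `wSeries a₁ L q z` do not vanish. -/
def WDenNeZero (a₁ : ℂ) (L : List ℂ) (q : ℂ) (N : ℕ) : Prop :=
  1 - a₁ ≠ 0 ∧ qPochs (q :: L.map (fun x => q * a₁ / x)) q N ≠ 0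

/-- The factor `(k/a, -q; q)_n / (-k, aq; q)_n * (akq; q²)_n / (kq/a; q²)_n`. -/
noncomputable def wpPrefactor (a k q : ℂ) (n : ℕ) : ℂ :=
  qPochs [k / a, -q] q n / qPochs [-k, a * q] q n *
    (qPoch (a * k * q) (q ^ 2) n / qPoch (k * q / a) (q ^ 2) n)

theorem qPoch_shift (s q : ℂ) (j : ℕ) :
    (1 - s) * qPoch (q * s) q j = qPoch s q j * (1 - s * q ^ j) := by
  have h1 : qPoch s q (j + 1) = qPoch s q j * (1 - s * q ^ j) := by
    simp [qPoch, Finset.prod_range_succ]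
  have h2 : qPoch s q (j + 1) = qPoch (q * s) q j * (1 - s) := by
    simp only [qPoch, Finset.prod_range_succ']
    simp only [pow_zero, mul_one]
    congr 1
    refine Finset.prod_congr rfl fun i _ => ?_
    ring
  rw [← h1, h2]; ring

/-- `wSeries` is the `φ`-series whose parameters are very-well-poised. -/
theorem wSeries_eq_phiSeries (a₁ s q z : ℂ) (L : List ℂ) (hs : s ^ 2 = a₁)
    (h : ∀ j, qPoch s q j ≠ 0 ∧ qPoch (-s) q j ≠ 0) :
    wSeries a₁ L q z =
      phiSeries (a₁ :: (q * s) :: (-(q * s)) :: L)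
        (s :: (-s) :: L.map (fun x => q * a₁ / x)) q z := by
  unfold wSeries phiSeries
  refine tsum_congr fun j => ?_
  congr 1
  have e1 := qPoch_shift s q j
  have e2 := qPoch_shift (-s) q j
  have n1 : 1 - s ≠ 0 := by simpa [qPoch] using (h 1).1
  have n2 : 1 - -s ≠ 0 := by simpa [qPoch] using (h 1).2
  have m1 := (h j).1
  have m2 := (h j).2
  have f1 : qPoch (q * s) q j / qPoch s q j = (1 - s * q ^ j) / (1 - s) := by
    rw [div_eq_div_iff m1 n1]; linear_combination e1
  have f2 : qPoch (-(q * s)) q j / qPoch (-s) q j = (1 - -s * q ^ j) / (1 - -s) := by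
    rw [div_eq_div_iff m2 n2, ← mul_neg]; linear_combination e2
  have f3 : (1 - a₁ * q ^ (2 * j)) / (1 - a₁) =
      (qPoch (q * s) q j / qPoch s q j) * (qPoch (-(q * s)) q j / qPoch (-s) q j) := by
    rw [f1, f2, div_mul_div_comm]
    congr 1
    · rw [← hs]; ring
    · rw [← hs]; ring
  rw [f3]
  simp only [qPochs, List.map_cons, List.prod_cons]
  simp only [div_eq_mul_inv, mul_inv]
  ring

/-! ### Shifted factorials -/

/-! All eight identities are instances of one change of base for well-poised Bailey pairs. Let
$M_{A,K,p}(r,j)$ be the lower triangular matrix `wpMatrix`. The parameter $ak/q$ is the $K$ of the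
matrix relative to $(a^2, ak/q)$ and the $A$ of the matrix relative to $(ak/q, k^2)$, both in base
$q^2$. With the diagonal weights `baseChangeWeight` between them, their product is again a
well-poised Bailey matrix, now relative to $(a,k)$ in base $q$, up to the row factor $P$ and the
column factor `baseChangeFactor`. This is `sum_baseChange`. Applying both sides to a sequence
$\alpha$ whose transform $b_r=\sum_j M_{a^2,ak/q,q^2}(r,j)\alpha_j$ is known in closed form gives
$\sum_r M\,w_r b_r = P\sum_j M\,\gamma_j\alpha_j$ (`baseChange_transform`), and each identity comes
from one choice of $\alpha$.

The product formula reduces to its column $j=0$: replacing $a,k$ by $aq^{2j},kq^{2j}$ carries column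
$0$ to column $j$ (`baseChange_row_shift`), and the remaining product is compared with the
right-hand side by induction from the diagonal (`baseChange_diag`, `baseChange_column`). Column $0$
is the single sum `sum_baseChangeWeight`.

That sum and the closed forms $b_r$ are proved by creative telescoping. An explicit rational
certificate turns a recurrence in $r$ into an identity of rational functions in $x=p^r$ and $y=p^j$,
which is checked by clearing denominators. The closed forms are Jackson's sum, two quadratic
very-well-poised sums, a sum vanishing in odd rows, a sum over even columns, two mixed-base sums and
the Saalschütz sum.

The certificates need many nonvanishing factors, including that $q$ is not a root of unity, which
the theorem does not assume. So each identity is first proved for multiplicatively independent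
parameters. Arbitrary nonzero parameters are a limit of such ones along a curve
(`exists_path_mulIndep`). Both sides are finite sums, continuous wherever the denominators in the
statement do not vanish, so the identity passes to the limit. -/

theorem qPoch_zero (x q : ℂ) : qPoch x q 0 = 1 := by simp [qPoch]

theorem qPoch_succ (x q : ℂ) (n : ℕ) : qPoch x q (n + 1) = qPoch x q n * (1 - x * q ^ n) := by
  simp [qPoch, Finset.prod_range_succ]

theorem qPoch_ne_zero_of_le {x q : ℂ} {m n : ℕ} (hmn : m ≤ n) (h : qPoch x q n ≠ 0) :
    qPoch x q m ≠ 0 := by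
  simp only [qPoch, Finset.prod_ne_zero_iff, Finset.mem_range] at h ⊢
  exact fun i hi => h i (by omega)

theorem qPoch_eq_zero {x q : ℂ} {m n : ℕ} (hmn : m < n) (h : x * q ^ m = 1) :
    qPoch x q n = 0 :=
  Finset.prod_eq_zero (Finset.mem_range.2 hmn) (by rw [h, sub_self])

theorem qPoch_eq_mul_div {s q : ℂ} {j : ℕ} (h : 1 - s * q ^ j ≠ 0) :
    qPoch s q j = qPoch (q * s) q j * ((1 - s) / (1 - s * q ^ j)) := by
  rw [mul_div_assoc', eq_div_iff h, ← qPoch_shift, mul_comm]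

theorem qPoch_mul_left_eq {s q : ℂ} {j : ℕ} (h : 1 - s ≠ 0) :
    qPoch (q * s) q j = qPoch s q j * ((1 - s * q ^ j) / (1 - s)) := by
  rw [mul_div_assoc', eq_div_iff h, ← qPoch_shift, mul_comm]

/-! ### Genericity: parameters that avoid the powers of the base -/

/-- No integral power shift of `c` equals one. -/
def QFree (c p : ℂ) : Prop := ∀ l : ℤ, c * p ^ l ≠ 1

theorem QFree.one_sub_ne {c p e : ℂ} (h : QFree c p) (n : ℕ) (he : e = c * p ^ n) :
    1 - e ≠ 0 := by
  intro h0
  apply h n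
  rw [zpow_natCast, ← he]
  exact (sub_eq_zero.1 h0).symm

theorem QFree.sub_ne {A K p : ℂ} (h : QFree (K / A) p) (hp : p ≠ 0) (hA : A ≠ 0) (m n : ℕ) :
    K * p ^ m - A * p ^ n ≠ 0 := by
  intro h0
  apply h (m - n)
  have h1 : K * p ^ m = A * p ^ n := sub_eq_zero.1 h0
  rw [zpow_sub₀ hp, zpow_natCast, zpow_natCast]
  have : p ^ n ≠ 0 := pow_ne_zero _ hp
  field_simp
  linear_combination h1

theorem QFree.qPoch_ne_zero {c p e : ℂ} (h : QFree c p) (l : ℤ) (hp : p ≠ 0) (he : e = c * p ^ l)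
    (n : ℕ) : qPoch e p n ≠ 0 := by
  simp only [qPoch, Finset.prod_ne_zero_iff, Finset.mem_range]
  intro i _ h0
  apply h (l + i)
  rw [zpow_add₀ hp, zpow_natCast, ← mul_assoc, ← he]
  exact (sub_eq_zero.1 h0).symm

/-- `p` is not a root of unity. -/
def NotRootOfUnity (p : ℂ) : Prop := ∀ l : ℕ, p ^ (l + 1) ≠ 1

theorem NotRootOfUnity.one_sub_ne {p : ℂ} (h : NotRootOfUnity p) (n : ℕ) {e : ℂ}
    (he : e = p ^ (n + 1)) : 1 - e ≠ 0 := by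
  intro h0
  apply h n
  rw [← he]
  exact (sub_eq_zero.1 h0).symm

/-! ### The well-poised Bailey matrix -/

/-- The matrix of a well-poised Bailey pair relative to `(A, K)` in base `p`, normalized to be
one in the column `j = 0`. -/
noncomputable def wpMatrix (A K p : ℂ) (r j : ℕ) : ℂ :=
  qPoch (K * p ^ r) p j * qPoch (p ^ r)⁻¹ p j /
    (qPoch (A * p / (K * p ^ r)) p j * qPoch (A * p * p ^ r) p j)

theorem wpMatrix_zero_right (A K p : ℂ) (r : ℕ) : wpMatrix A K p r 0 = 1 := by
  simp [wpMatrix, qPoch_zero]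

theorem wpMatrix_eq_zero {A K p : ℂ} (hp : p ≠ 0) {r j : ℕ} (h : r < j) :
    wpMatrix A K p r j = 0 := by
  rw [wpMatrix, qPoch_eq_zero h (x := (p ^ r)⁻¹)]
  · simp
  · exact inv_mul_cancel₀ (pow_ne_zero _ hp)

/-- Genericity of the parameters is not needed: the same new denominator factors are inverted on
both sides, whether or not they vanish. -/
theorem wpMatrix_succ_right {A K p : ℂ} (hp : p ≠ 0) (hK : K ≠ 0) (r j : ℕ) {x y : ℂ}
    (hx : p ^ r = x) (hy : p ^ j = y) :
    wpMatrix A K p r (j + 1) = wpMatrix A K p r j *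
      ((1 - K * x * y) * (x - y) * K / ((K * x - A * p * y) * (1 - A * p * x * y))) := by
  have hx0 : x ≠ 0 := hx ▸ pow_ne_zero _ hp
  have e1 : 1 - x⁻¹ * y = (x - y) * x⁻¹ := by field_simp
  have e2 : 1 - A * p / (K * x) * y = (K * x - A * p * y) * (K * x)⁻¹ := by field_simp
  simp only [wpMatrix, qPoch_succ, hx, hy, e1, e2]
  simp only [div_eq_mul_inv, mul_inv, inv_inv]
  field_simp

/-- The earlier row is written through the later one, not conversely. The quotient then has
$p^{r+1}-p^j$ in its numerator, so it stays valid at $j=r+1$, where row $r$ vanishes and row $r+1$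
does not. -/
theorem wpMatrix_succ_left {A K p : ℂ} (hp : p ≠ 0) (hA : A ≠ 0) (hK : K ≠ 0)
    (hAf : QFree A p) (hKf : QFree K p) (hKA : QFree (K / A) p) (hpn : NotRootOfUnity p)
    (r j : ℕ) {x y : ℂ} (hx : p ^ r = x) (hy : p ^ j = y) :
    wpMatrix A K p r j = wpMatrix A K p (r + 1) j *
      ((1 - K * x) * (p * x - y) * (K * x - A) * (1 - A * p * x * y) /
        ((1 - K * x * y) * (p * x - 1) * (K * x - A * y) * (1 - A * p * x))) := by
  have hx0 : x ≠ 0 := hx ▸ pow_ne_zero _ hp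
  have n1 : 1 - K * x * y ≠ 0 := hKf.one_sub_ne (r + j) (by rw [← hx, ← hy]; ring)
  have n2 : p * x - 1 ≠ 0 := by
    rw [← neg_sub, neg_ne_zero]; exact hpn.one_sub_ne r (by rw [← hx]; ring)
  have n3 : K * x - A * y ≠ 0 := by rw [← hx, ← hy]; exact hKA.sub_ne hp hA r j
  have n4 : 1 - A * p * x ≠ 0 := hAf.one_sub_ne (r + 1) (by rw [← hx]; ring)
  have n5 : K * x - A ≠ 0 := by
    have := hKA.sub_ne hp hA r 0
    rwa [pow_zero, mul_one, hx] at this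
  have n6 : 1 - A * p * x * y ≠ 0 := hAf.one_sub_ne (r + 1 + j) (by rw [← hx, ← hy]; ring)
  have t1 : qPoch (K * x) p j = qPoch (K * (p * x)) p j * ((1 - K * x) / (1 - K * x * y)) := by
    rw [show K * (p * x) = p * (K * x) by ring, ← hy]
    exact qPoch_eq_mul_div (by rwa [hy])
  have t2 : qPoch x⁻¹ p j = qPoch (p * x)⁻¹ p j * ((p * x - y) / (p * x - 1)) := by
    have h1 : 1 - (p * x)⁻¹ ≠ 0 := by
      rw [show 1 - (p * x)⁻¹ = (p * x - 1) * (p * x)⁻¹ by field_simp]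
      positivity
    rw [show x⁻¹ = p * (p * x)⁻¹ by field_simp, qPoch_mul_left_eq h1, hy]
    congr 1
    rw [div_eq_div_iff h1 n2]
    field_simp
  have t3 : qPoch (A * p / (K * x)) p j =
      qPoch (A / (K * x)) p j * ((K * x - A * y) / (K * x - A)) := by
    have h1 : 1 - A / (K * x) ≠ 0 := by
      rw [show 1 - A / (K * x) = (K * x - A) * (K * x)⁻¹ by field_simp]
      positivity
    rw [show A * p / (K * x) = p * (A / (K * x)) by ring, qPoch_mul_left_eq h1, hy]
    congr 1
    rw [div_eq_div_iff h1 n5]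
    field_simp
  have t4 : qPoch (A * p * x) p j =
      qPoch (A * p * (p * x)) p j * ((1 - A * p * x) / (1 - A * p * x * y)) := by
    rw [show A * p * (p * x) = p * (A * p * x) by ring, ← hy]
    exact qPoch_eq_mul_div (by rwa [hy])
  have hx' : p ^ (r + 1) = p * x := by rw [← hx]; ring
  rw [wpMatrix, wpMatrix, hx', hx, t1, t2, t3, t4,
    show A * p / (K * (p * x)) = A / (K * x) by field_simp]
  field_simp

/-! ### Telescoping recurrences -/

/-- The difference of row $r+1$ and $\beta_r$ times row $r$ sums to boundary values of `G`, which
vanish. The bound `N` is free, beyond $r$, so that consecutive rows can be summed over the same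
range. -/
theorem sum_eq_of_telescoping {f G : ℕ → ℕ → ℂ} {b β : ℕ → ℂ}
    (hf : ∀ r j, r < j → f r j = 0) (h0 : f 0 0 = b 0) (hb : ∀ r, b (r + 1) = b r * β r)
    (hG0 : ∀ r, G r 0 = 0) (hG : ∀ r j, r + 1 < j → G r j = 0)
    (hstep : ∀ r j, f (r + 1) j - f r j * β r = G r (j + 1) - G r j)
    (r N : ℕ) (hN : r < N) : ∑ j ∈ Finset.range N, f r j = b r := by
  induction r generalizing N with
  | zero =>
    rw [Finset.sum_eq_single_of_mem 0 (Finset.mem_range.2 hN), h0]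
    exact fun j _ hj => hf 0 j (by omega)
  | succ r ih =>
    have h1 : ∑ j ∈ Finset.range N, (f (r + 1) j - f r j * β r) = 0 := by
      rw [Finset.sum_congr rfl fun j _ => hstep r j, Finset.sum_range_sub, hG0, hG r N hN,
        sub_zero]
    rw [Finset.sum_sub_distrib, ← Finset.sum_mul, ih N (by omega), ← hb, sub_eq_zero] at h1
    exact h1

/-- The three-term version: rows $0$ and $1$ are initial values, and `hc` lets the recurrence be
solved for row $r+2$. -/
theorem sum_eq_of_telescoping_two {f G : ℕ → ℕ → ℂ} {b c₀ c₁ c₂ : ℕ → ℂ}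
    (hf : ∀ r j, r < j → f r j = 0) (h0 : f 0 0 = b 0) (h1 : f 1 0 + f 1 1 = b 1)
    (hc : ∀ r, c₂ r ≠ 0) (hb : ∀ r, c₂ r * b (r + 2) + c₁ r * b (r + 1) + c₀ r * b r = 0)
    (hG0 : ∀ r, G r 0 = 0) (hG : ∀ r j, r + 2 < j → G r j = 0)
    (hstep : ∀ r j, c₂ r * f (r + 2) j + c₁ r * f (r + 1) j + c₀ r * f r j =
      G r (j + 1) - G r j)
    (r N : ℕ) (hN : r < N) : ∑ j ∈ Finset.range N, f r j = b r := by
  induction r using Nat.strong_induction_on generalizing N with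
  | _ r ih =>
    match r, ih with
    | 0, _ =>
      rw [Finset.sum_eq_single_of_mem 0 (Finset.mem_range.2 hN), h0]
      exact fun j _ hj => hf 0 j (by omega)
    | 1, _ =>
      obtain ⟨M, rfl⟩ : ∃ M, N = M + 2 := ⟨N - 2, by omega⟩
      rw [Finset.sum_range_succ', Finset.sum_range_succ', Finset.sum_eq_zero, ← h1]
      · ring
      · exact fun j _ => hf 1 _ (by omega)
    | r + 2, ih =>
      have h2 : ∑ j ∈ Finset.range N,
          (c₂ r * f (r + 2) j + c₁ r * f (r + 1) j + c₀ r * f r j) = 0 := by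
        rw [Finset.sum_congr rfl fun j _ => hstep r j, Finset.sum_range_sub, hG0, hG r N hN,
          sub_zero]
      rw [Finset.sum_add_distrib, Finset.sum_add_distrib, ← Finset.mul_sum, ← Finset.mul_sum,
        ← Finset.mul_sum, ih r (by omega) N (by omega), ih (r + 1) (by omega) N (by omega),
        ← hb r] at h2
      exact mul_left_cancel₀ (hc r) (by linear_combination h2)

/-! ### Row sums of the Bailey matrix from rational certificates -/

/-- The parameters of a well-poised Bailey matrix are in general position. -/
structure WPGeneric (A K p : ℂ) : Prop where
  p_ne : p ≠ 0
  A_ne : A ≠ 0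
  K_ne : K ≠ 0
  A_free : QFree A p
  K_free : QFree K p
  KA_free : QFree (K / A) p
  p_free : NotRootOfUnity p

/-- The quotient `wpMatrix A K p r j / wpMatrix A K p (r + 1) j`, where `x = p ^ r` and
`y = p ^ j`. -/
noncomputable def wpLeft (A K p x y : ℂ) : ℂ :=
  (1 - K * x) * (p * x - y) * (K * x - A) * (1 - A * p * x * y) /
    ((1 - K * x * y) * (p * x - 1) * (K * x - A * y) * (1 - A * p * x))

/-- The quotient `wpMatrix A K p r (j + 1) / wpMatrix A K p r j`, where `x = p ^ r` and
`y = p ^ j`. -/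
noncomputable def wpRight (A K p x y : ℂ) : ℂ :=
  (1 - K * x * y) * (x - y) * K / ((K * x - A * p * y) * (1 - A * p * x * y))

namespace WPGeneric

variable {A K p : ℂ} (h : WPGeneric A K p)
include h

theorem succ_left (r j : ℕ) :
    wpMatrix A K p r j = wpMatrix A K p (r + 1) j * wpLeft A K p (p ^ r) (p ^ j) :=
  wpMatrix_succ_left h.p_ne h.A_ne h.K_ne h.A_free h.K_free h.KA_free h.p_free r j rfl rfl

theorem succ_right (r j : ℕ) :
    wpMatrix A K p r (j + 1) = wpMatrix A K p r j * wpRight A K p (p ^ r) (p ^ j) :=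
  wpMatrix_succ_right h.p_ne h.K_ne r j rfl rfl

/-- A first order recurrence in `r` for `∑ wpMatrix A K p r j * α j`, from a certificate `R`. -/
theorem sum_of_certificate {α b ρ β : ℕ → ℂ} {R : ℕ → ℕ → ℂ}
    (h0 : α 0 = b 0) (hα : ∀ j, α (j + 1) = α j * ρ j) (hb : ∀ r, b (r + 1) = b r * β r)
    (hR : ∀ r, R r 0 = 0)
    (key : ∀ r j, 1 - wpLeft A K p (p ^ r) (p ^ j) * β r =
      R r (j + 1) * (wpRight A K p (p ^ (r + 1)) (p ^ j) * ρ j) - R r j)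
    (r N : ℕ) (hN : r < N) : ∑ j ∈ Finset.range N, wpMatrix A K p r j * α j = b r := by
  refine sum_eq_of_telescoping (f := fun r j => wpMatrix A K p r j * α j) (β := β)
    (G := fun r j => R r j * (wpMatrix A K p (r + 1) j * α j)) ?_ ?_ hb ?_ ?_ ?_ r N hN
  · exact fun r j hj => by simp [wpMatrix_eq_zero h.p_ne hj]
  · simp [wpMatrix_zero_right, h0]
  · simp [hR]
  · exact fun r j hj => by simp [wpMatrix_eq_zero h.p_ne hj]
  · intro r j
    rw [h.succ_left r j, h.succ_right (r + 1) j, hα]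
    -- The hypothesis `key` is the telescoping relation divided by the summand of row $r+1$; here it
    -- is multiplied back, which is harmless where that summand is zero.
    linear_combination (wpMatrix A K p (r + 1) j * α j) * key r j

/-- A second order recurrence in `r` for `∑ wpMatrix A K p r j * α j`, from a certificate `R`. -/
theorem sum_of_certificate_two {α b ρ c₀ c₁ c₂ : ℕ → ℂ} {R : ℕ → ℕ → ℂ}
    (h0 : α 0 = b 0) (h1 : α 0 + α 0 * ρ 0 * wpRight A K p p 1 = b 1)
    (hα : ∀ j, α (j + 1) = α j * ρ j) (hc : ∀ r, c₂ r ≠ 0)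
    (hb : ∀ r, c₂ r * b (r + 2) + c₁ r * b (r + 1) + c₀ r * b r = 0)
    (hR : ∀ r, R r 0 = 0)
    (key : ∀ r j, c₂ r + c₁ r * wpLeft A K p (p ^ (r + 1)) (p ^ j) +
        c₀ r * (wpLeft A K p (p ^ (r + 1)) (p ^ j) * wpLeft A K p (p ^ r) (p ^ j)) =
      R r (j + 1) * (wpRight A K p (p ^ (r + 2)) (p ^ j) * ρ j) - R r j)
    (r N : ℕ) (hN : r < N) : ∑ j ∈ Finset.range N, wpMatrix A K p r j * α j = b r := by
  refine sum_eq_of_telescoping_two (f := fun r j => wpMatrix A K p r j * α j)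
    (c₀ := c₀) (c₁ := c₁) (c₂ := c₂)
    (G := fun r j => R r j * (wpMatrix A K p (r + 2) j * α j)) ?_ ?_ ?_ hc hb ?_ ?_ ?_ r N hN
  · exact fun r j hj => by simp [wpMatrix_eq_zero h.p_ne hj]
  · simp [wpMatrix_zero_right, h0]
  · have e := h.succ_right 1 0
    simp only [zero_add, pow_one, pow_zero, wpMatrix_zero_right, one_mul] at e
    simp only [wpMatrix_zero_right, e, hα 0, one_mul, ← h1]
    ring
  · simp [hR]
  · exact fun r j hj => by simp [wpMatrix_eq_zero h.p_ne hj]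
  · intro r j
    rw [h.succ_left r j, h.succ_left (r + 1) j, h.succ_right (r + 2) j, hα]
    linear_combination (wpMatrix A K p (r + 2) j * α j) * key r j

theorem one_sub_K_ne (r j : ℕ) {x y e : ℂ} (hx : p ^ r = x) (hy : p ^ j = y) (n : ℕ)
    (he : e = K * p ^ n * x * y) : 1 - e ≠ 0 :=
  h.K_free.one_sub_ne (n + r + j) (by rw [he, ← hx, ← hy]; ring)

theorem one_sub_A_ne (r j : ℕ) {x y e : ℂ} (hx : p ^ r = x) (hy : p ^ j = y) (n : ℕ)
    (he : e = A * p ^ n * x * y) : 1 - e ≠ 0 :=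
  h.A_free.one_sub_ne (n + r + j) (by rw [he, ← hx, ← hy]; ring)

theorem sub_ne (r j : ℕ) {x y e : ℂ} (hx : p ^ r = x) (hy : p ^ j = y) (n : ℕ)
    (he : e = K * (p ^ n * x) - A * y) : e ≠ 0 := by
  rw [he, ← hx, ← hy, ← pow_add]
  exact h.KA_free.sub_ne h.p_ne h.A_ne _ _

end WPGeneric

theorem vwp_succ {A p : ℂ} (h : QFree A p) (j : ℕ) :
    (1 - A * p ^ (2 * (j + 1))) / (1 - A) = (1 - A * p ^ (2 * j)) / (1 - A) *
      ((1 - A * p ^ 2 * (p ^ j) ^ 2) / (1 - A * (p ^ j) ^ 2)) := by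
  have h1 : 1 - A ≠ 0 := h.one_sub_ne 0 (by simp)
  have h2 : 1 - A * (p ^ j) ^ 2 ≠ 0 := h.one_sub_ne (2 * j) (by ring)
  rw [show A * p ^ (2 * j) = A * (p ^ j) ^ 2 by ring]
  field_simp
  ring

/-! ### Jackson's sum -/

/-- The quotient of consecutive right hand sides of Jackson's sum, with `x = p ^ r`. -/
noncomputable def jacksonSumRatio (A K p r₁ r₂ x : ℂ) : ℂ :=
  (1 - K * r₁ / A * x) * (1 - K * r₂ / A * x) * (1 - A * p / (r₁ * r₂) * x) * (1 - A * p * x) /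
    ((1 - A * p / r₁ * x) * (1 - A * p / r₂ * x) * (1 - K * r₁ * r₂ / A * x) * (1 - K / A * x))

/-- The quotient of consecutive weights in Jackson's sum, with `y = p ^ j`. -/
noncomputable def jacksonTermRatio (A K p r₁ r₂ y : ℂ) : ℂ :=
  (1 - A * p ^ 2 * y ^ 2) / (1 - A * y ^ 2) *
    ((1 - A * y) * (1 - r₁ * y) * (1 - r₂ * y) * (1 - A ^ 2 * p / (K * r₁ * r₂) * y) /
    ((1 - p * y) * (1 - A * p / r₁ * y) * (1 - A * p / r₂ * y) *
    (1 - K * r₁ * r₂ / A * y))) * p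

/-- The telescoping certificate of Jackson's sum. -/
noncomputable def jacksonCert (A K p r₁ r₂ x y : ℂ) : ℂ :=
  -(p * x * (1 - K * p * x ^ 2) / ((1 - p * x) * (1 - A * p / r₁ * x) *
    (1 - A * p / r₂ * x) * (1 - K * r₁ * r₂ / A * x)) * ((1 - y) * (1 - A * p * x * y) *
    (1 - A / r₁ * y) * (1 - A / r₂ * y) * (1 - K * r₁ * r₂ / (A * p) * y) /
    (y * (1 - A * y ^ 2) * (1 - K * x * y))))

-- Here $x=p^r$ and $y=p^j$ are independent variables: what remains of the telescoping relation
-- after division by the summand is an identity of rational functions.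
set_option maxRecDepth 10000 in
theorem jackson_certificate {A K p x y r₁ r₂ : ℂ} (hA : A ≠ 0) (hK : K ≠ 0) (hp : p ≠ 0)
    (hy : y ≠ 0) (h1 : r₁ ≠ 0) (h2 : r₂ ≠ 0)
    (n1 : 1 - A * p / r₁ * x ≠ 0) (n2 : 1 - A * p / r₂ * x ≠ 0) (n3 : 1 - K * r₁ * r₂ / A * x ≠ 0)
    (n4 : K * x - A ≠ 0) (n5 : 1 - A * p ^ 2 * y ^ 2 ≠ 0) (n6 : 1 - A * y ^ 2 ≠ 0)
    (n7 : 1 - p * y ≠ 0) (n8 : 1 - A * p / r₁ * y ≠ 0) (n9 : 1 - A * p / r₂ * y ≠ 0)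
    (n10 : 1 - K * r₁ * r₂ / A * y ≠ 0) (n11 : 1 - K * x * y ≠ 0) (n12 : 1 - p * x ≠ 0)
    (n13 : K * x - A * y ≠ 0) (n14 : 1 - A * p * x ≠ 0) (n15 : 1 - A * p ^ 2 * x * y ≠ 0)
    (n16 : 1 - K * p * x * y ≠ 0) :
    1 - wpLeft A K p x y * jacksonSumRatio A K p r₁ r₂ x =
      jacksonCert A K p r₁ r₂ x (p * y) *
        (wpRight A K p (p * x) y * jacksonTermRatio A K p r₁ r₂ y) -
      jacksonCert A K p r₁ r₂ x y := by
  rw [jacksonSumRatio, jacksonTermRatio, jacksonCert, jacksonCert, wpLeft, wpRight, show 1 - K / A * x = (K * x - A) / -A by field_simp; ring,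
    show p * x - 1 = -(1 - p * x) by ring, show 1 - A * p * x * (p * y) = 1 - A * p ^ 2 * x * y by ring,
    show 1 - A / r₁ * (p * y) = 1 - A * p / r₁ * y by ring,
    show 1 - A / r₂ * (p * y) = 1 - A * p / r₂ * y by ring,
    show 1 - K * r₁ * r₂ / (A * p) * (p * y) = 1 - K * r₁ * r₂ / A * y by field_simp,
    show A * (p * y) ^ 2 = A * p ^ 2 * y ^ 2 by ring, show K * x * (p * y) = K * p * x * y by ring,
    show K * (p * x) * y = K * p * x * y by ring,
    show K * (p * x) - A * p * y = p * (K * x - A * y) by ring,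
    show A * p * (p * x) * y = A * p ^ 2 * x * y by ring]
  -- Every denominator becomes an atom, so that clearing fractions cancels it as a whole. Only the
  -- factors that survive are expanded afterwards, which keeps the final polynomial identity within
  -- reach.
  generalize e1 : 1 - A * p / r₁ * x = d1 at *
  generalize e2 : 1 - A * p / r₂ * x = d2 at *
  generalize e3 : 1 - K * r₁ * r₂ / A * x = d3 at *
  generalize e4 : K * x - A = d4 at *
  generalize e5 : 1 - A * p ^ 2 * y ^ 2 = d5 at *
  generalize e6 : 1 - A * y ^ 2 = d6 at *
  generalize e7 : 1 - p * y = d7 at *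
  generalize e8 : 1 - A * p / r₁ * y = d8 at *
  generalize e9 : 1 - A * p / r₂ * y = d9 at *
  generalize e10 : 1 - K * r₁ * r₂ / A * y = d10 at *
  generalize e11 : 1 - K * x * y = d11 at *
  generalize e12 : 1 - p * x = d12 at *
  generalize e13 : K * x - A * y = d13 at *
  generalize e14 : 1 - A * p * x = d14 at *
  generalize e15 : 1 - A * p ^ 2 * x * y = d15 at *
  generalize e16 : 1 - K * p * x * y = d16 at *
  field_simp
  rw [← e1, ← e2, ← e3, ← e6, ← e11, ← e12, ← e13]
  field_simp
  ring

/-- Jackson's terminating sum, as a well-poised Bailey pair. -/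
theorem wpMatrix_sum_jackson {A K p : ℂ} (h : WPGeneric A K p) {r₁ r₂ : ℂ} (h1 : r₁ ≠ 0)
    (h2 : r₂ ≠ 0) (f1 : QFree (A / r₁) p) (f2 : QFree (A / r₂) p) (f3 : QFree (K * r₁ * r₂ / A) p)
    (r N : ℕ) (hN : r < N) :
    ∑ j ∈ Finset.range N, wpMatrix A K p r j * ((1 - A * p ^ (2 * j)) / (1 - A) *
        (qPoch A p j * qPoch r₁ p j * qPoch r₂ p j * qPoch (A ^ 2 * p / (K * r₁ * r₂)) p j /
        (qPoch p p j * qPoch (A * p / r₁) p j * qPoch (A * p / r₂) p j *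
        qPoch (K * r₁ * r₂ / A) p j)) * p ^ j) =
      qPoch (K * r₁ / A) p r * qPoch (K * r₂ / A) p r * qPoch (A * p / (r₁ * r₂)) p r *
        qPoch (A * p) p r / (qPoch (A * p / r₁) p r * qPoch (A * p / r₂) p r *
        qPoch (K * r₁ * r₂ / A) p r * qPoch (K / A) p r) := by
  have hA := h.A_free.one_sub_ne 0 (e := A) (by simp)
  refine h.sum_of_certificate
    (b := fun r => qPoch (K * r₁ / A) p r * qPoch (K * r₂ / A) p r * qPoch (A * p / (r₁ * r₂)) p r *
        qPoch (A * p) p r / (qPoch (A * p / r₁) p r * qPoch (A * p / r₂) p r *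
        qPoch (K * r₁ * r₂ / A) p r * qPoch (K / A) p r))
    (β := fun r => jacksonSumRatio A K p r₁ r₂ (p ^ r))
    (ρ := fun j => jacksonTermRatio A K p r₁ r₂ (p ^ j))
    (R := fun r j => jacksonCert A K p r₁ r₂ (p ^ r) (p ^ j))
    (by simp [qPoch_zero, div_self hA]) (fun j => ?_) (fun r => ?_)
    (fun r => by simp [jacksonCert]) (fun r j => ?_) r N hN
  · rw [vwp_succ h.A_free]
    simp only [jacksonTermRatio, qPoch_succ, pow_succ, div_eq_mul_inv, mul_inv]
    ring
  · simp only [jacksonSumRatio, qPoch_succ, div_eq_mul_inv, mul_inv]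
    ring
  · simp only [pow_succ' p r, pow_succ' p j]
    generalize hx : p ^ r = x
    generalize hy : p ^ j = y
    exact jackson_certificate (x := x) (y := y) (r₁ := r₁) (r₂ := r₂) h.A_ne h.K_ne h.p_ne
      (hy ▸ pow_ne_zero _ h.p_ne) h1 h2
      (f1.one_sub_ne (r + 1) (by rw [← hx]; ring)) (f2.one_sub_ne (r + 1) (by rw [← hx]; ring))
      (f3.one_sub_ne r (by rw [← hx]))
      (h.sub_ne r 0 hx (pow_zero p) 0 (by ring))
      (h.one_sub_A_ne j j hy hy 2 (by ring)) (h.one_sub_A_ne j j hy hy 0 (by ring))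
      (h.p_free.one_sub_ne j (by rw [← hy]; ring))
      (f1.one_sub_ne (j + 1) (by rw [← hy]; ring)) (f2.one_sub_ne (j + 1) (by rw [← hy]; ring))
      (f3.one_sub_ne j (by rw [← hy]))
      (h.one_sub_K_ne r j hx hy 0 (by ring)) (h.p_free.one_sub_ne r (by rw [← hx]; ring))
      (h.sub_ne r j hx hy 0 (by ring)) (h.one_sub_A_ne r 0 hx (pow_zero p) 1 (by ring))
      (h.one_sub_A_ne r j hx hy 2 (by ring)) (h.one_sub_K_ne r j hx hy 1 (by ring))

/-- A second-order recurrence for a sequence that satisfies a first-order one: with $E$ the shift in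
$r$, the operator is $c_2(r)(E-\beta_{r+1})E-c_0(r)\beta_{r+1}(E-\beta_r)$. It therefore annihilates
`b` automatically, and `h1` supplies the second initial value. -/
theorem WPGeneric.sum_of_certificate_split {A K p : ℂ} (h : WPGeneric A K p)
    {α b ρ β c₀ c₂ : ℕ → ℂ} {R : ℕ → ℕ → ℂ}
    (h0 : α 0 = b 0) (h1 : 1 + ρ 0 * wpRight A K p p 1 = β 0)
    (hα : ∀ j, α (j + 1) = α j * ρ j) (hb : ∀ r, b (r + 1) = b r * β r) (hc : ∀ r, c₂ r ≠ 0)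
    (hR : ∀ r, R r 0 = 0)
    (key : ∀ r j, c₂ r * (1 - wpLeft A K p (p ^ (r + 1)) (p ^ j) * β (r + 1)) -
        c₀ r * (wpLeft A K p (p ^ (r + 1)) (p ^ j) * β (r + 1)) *
          (1 - wpLeft A K p (p ^ r) (p ^ j) * β r) =
      R r (j + 1) * (wpRight A K p (p ^ (r + 2)) (p ^ j) * ρ j) - R r j)
    (r N : ℕ) (hN : r < N) : ∑ j ∈ Finset.range N, wpMatrix A K p r j * α j = b r := by
  refine h.sum_of_certificate_two (c₂ := c₂) (c₁ := fun r => -((c₂ r + c₀ r) * β (r + 1)))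
    (c₀ := fun r => c₀ r * (β r * β (r + 1))) (ρ := ρ) (R := R) h0 ?_ hα hc (fun r => ?_) hR
    (fun r j => ?_) r N hN
  · rw [hb 0, ← h1, h0]
    ring
  · rw [hb (r + 1), hb r]
    ring
  · rw [← key r j]
    ring

/-! ### Two quadratic sums -/

noncomputable def quadSumRatio (A K p x : ℂ) : ℂ :=
  (1 - K ^ 2 / (A ^ 2 * p) * x) * (1 - A * p * x) / ((1 - K * x) * (1 - K / A * x))

noncomputable def quadTermRatio (A K p y : ℂ) : ℂ :=
  (1 - A * p ^ 2 * y ^ 2) / (1 - A * y ^ 2) *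
    ((1 - A * y) * (1 - K / (A * p) * y) * (1 - A ^ 2 * p / K * y ^ 2) *
      (1 - A ^ 2 * p ^ 2 / K * y ^ 2) /
    ((1 - p * y) * (1 - A ^ 2 * p ^ 2 / K * y) * (1 - K * y ^ 2) * (1 - K * p * y ^ 2))) * p

/-- The certificate is relative to the summand of row $r+2$; its factor $1-y$ kills the boundary
term at $j=0$. -/
noncomputable def quadCert (A K p x y : ℂ) : ℂ :=
  -((1 - K ^ 2 / A ^ 2 * x) * p ^ 3 * x ^ 2 * (K - A * p) / (1 - p ^ 2 * x)) *
    ((1 - y) * (1 - A * p ^ 2 * x * y) * (1 - A ^ 2 * p / K * y) * (1 - K / p * y ^ 2) *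
      (1 - K / p ^ 2 * y ^ 2) /
    (y * (1 - A * y ^ 2) * (1 - K * x * y) * (1 - K * p * x * y) * (K * p * x - A * y)))

set_option maxRecDepth 10000 in
set_option maxHeartbeats 1000000 in
theorem quad_certificate {A K p x y : ℂ} (hA : A ≠ 0) (hK : K ≠ 0) (hp : p ≠ 0)
    (hy : y ≠ 0)
    (n1 : 1 - K * x ≠ 0) (n2 : 1 - K * p * x ≠ 0) (n3 : K * x - A ≠ 0) (n4 : K * p * x - A ≠ 0)
    (n5 : 1 - A * p ^ 2 * y ^ 2 ≠ 0) (n6 : 1 - A * y ^ 2 ≠ 0)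
    (n7 : 1 - p * y ≠ 0) (n8 : 1 - A ^ 2 * p ^ 2 / K * y ≠ 0) (n9 : 1 - K * y ^ 2 ≠ 0)
    (n10 : 1 - K * p * y ^ 2 ≠ 0) (n11 : 1 - K * x * y ≠ 0) (n12 : 1 - p * x ≠ 0)
    (n13 : K * x - A * y ≠ 0) (n14 : 1 - A * p * x ≠ 0) (n15 : 1 - A * p ^ 3 * x * y ≠ 0)
    (n16 : 1 - K * p * x * y ≠ 0) (n17 : 1 - K * p ^ 2 * x * y ≠ 0) (n18 : 1 - p ^ 2 * x ≠ 0)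
    (n19 : K * p * x - A * y ≠ 0) (n20 : 1 - A * p ^ 2 * x ≠ 0) :
    (1 - K ^ 2 / A ^ 2 * x) * (1 - A ^ 2 * p ^ 3 / K * x) *
        (1 - wpLeft A K p (p * x) y * quadSumRatio A K p (p * x)) -
      p * (1 - p * x) * (1 - K * x) * (wpLeft A K p (p * x) y * quadSumRatio A K p (p * x)) *
        (1 - wpLeft A K p x y * quadSumRatio A K p x) =
      quadCert A K p x (p * y) * (wpRight A K p (p * (p * x)) y * quadTermRatio A K p y) -
      quadCert A K p x y := by
  -- The two row quotients and the shifted certificate cancel heavily. Each is reduced on its own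
  -- before a common denominator is formed.
  have hL1 : wpLeft A K p (p * x) y * quadSumRatio A K p (p * x) =
      A * (p ^ 2 * x - y) * (1 - A * p ^ 2 * x * y) * (1 - K ^ 2 / A ^ 2 * x) /
        ((1 - K * p * x * y) * (1 - p ^ 2 * x) * (K * p * x - A * y)) := by
    rw [wpLeft, quadSumRatio, show 1 - K / A * (p * x) = (K * p * x - A) / -A by field_simp; ring,
      show K * (p * x) = K * p * x by ring, show A * p * (p * x) = A * p ^ 2 * x by ring,
      show p * (p * x) - 1 = -(1 - p ^ 2 * x) by ring,
      show K ^ 2 / (A ^ 2 * p) * (p * x) = K ^ 2 / A ^ 2 * x by field_simp]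
    generalize K * p * x - A = d4 at *
    generalize 1 - K * p * x = d2 at *
    generalize 1 - K * p * x * y = d16 at *
    generalize 1 - p ^ 2 * x = d18 at *
    generalize K * p * x - A * y = d19 at *
    generalize 1 - A * p ^ 2 * x = d20 at *
    field_simp
  have hL0 : wpLeft A K p x y * quadSumRatio A K p x =
      A * (p * x - y) * (1 - A * p * x * y) * (1 - K ^ 2 / (A ^ 2 * p) * x) /
        ((1 - K * x * y) * (1 - p * x) * (K * x - A * y)) := by
    rw [wpLeft, quadSumRatio, show 1 - K / A * x = (K * x - A) / -A by field_simp; ring,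
      show p * x - 1 = -(1 - p * x) by ring]
    generalize K * x - A = d4 at *
    generalize 1 - K * x = d2 at *
    generalize 1 - K * x * y = d16 at *
    generalize 1 - p * x = d18 at *
    generalize K * x - A * y = d19 at *
    generalize 1 - A * p * x = d20 at *
    field_simp
  have hR1 : quadCert A K p x (p * y) * (wpRight A K p (p * (p * x)) y * quadTermRatio A K p y) =
      -((1 - K ^ 2 / A ^ 2 * x) * x ^ 2 * (K - A * p) / (1 - p ^ 2 * x)) *
        ((p ^ 2 * x - y) * K * (1 - A * y) * (1 - K / (A * p) * y) * (1 - A ^ 2 * p / K * y ^ 2) *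
          (1 - A ^ 2 * p ^ 2 / K * y ^ 2) * p /
          (y * (1 - A * y ^ 2) * (1 - K * p * x * y) * (K * x - A * y) * (K * p * x - A * y))) := by
    rw [quadCert, wpRight, quadTermRatio, show K * x * (p * y) = K * p * x * y by ring,
      show K * p * x * (p * y) = K * p ^ 2 * x * y by ring,
      show K * p * x - A * (p * y) = p * (K * x - A * y) by ring,
      show A * (p * y) ^ 2 = A * p ^ 2 * y ^ 2 by ring,
      show A * p ^ 2 * x * (p * y) = A * p ^ 3 * x * y by ring,
      show K / p * (p * y) ^ 2 = K * p * y ^ 2 by field_simp,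
      show K / p ^ 2 * (p * y) ^ 2 = K * y ^ 2 by field_simp,
      show A ^ 2 * p / K * (p * y) = A ^ 2 * p ^ 2 / K * y by ring,
      show K * (p * (p * x)) * y = K * p ^ 2 * x * y by ring,
      show K * (p * (p * x)) - A * p * y = p * (K * p * x - A * y) by ring,
      show A * p * (p * (p * x)) * y = A * p ^ 3 * x * y by ring,
      show p * (p * x) - y = p ^ 2 * x - y by ring]
    generalize K * x - A * y = d1 at *
    generalize K * p * x - A * y = d2 at *
    generalize 1 - K * p * x * y = d3 at *
    generalize 1 - K * p ^ 2 * x * y = d4 at *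
    generalize 1 - A * p ^ 2 * y ^ 2 = d5 at *
    generalize 1 - A * p ^ 3 * x * y = d6 at *
    generalize 1 - K * p * y ^ 2 = d7 at *
    generalize 1 - K * y ^ 2 = d8 at *
    generalize 1 - A ^ 2 * p ^ 2 / K * y = d9 at *
    generalize 1 - p * y = d10 at *
    generalize 1 - A * y ^ 2 = d11 at *
    generalize 1 - p ^ 2 * x = d12 at *
    field_simp
  rw [hL1, hL0, hR1, quadCert]
  generalize e1 : K * x - A * y = d1 at *
  generalize e2 : K * p * x - A * y = d2 at *
  generalize e3 : 1 - K * p * x * y = d3 at *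
  generalize e4 : 1 - K * x * y = d4 at *
  generalize e5 : 1 - A * y ^ 2 = d5 at *
  generalize e6 : 1 - p ^ 2 * x = d6 at *
  generalize e7 : 1 - p * x = d7 at *
  field_simp
  rw [← e1, ← e2, ← e3, ← e4, ← e5, ← e6, ← e7]
  ring

/-- The base $p^2$ factors combine to $(A^2p/K;p)_{2j}/(K;p)_{2j}$, so the sum is a very-well-poised
${}_{10}W_9$ with numerator parameters $\pm A\sqrt{p/K}$ and $\pm Ap/\sqrt K$. It supplies the
$\alpha$ of the ${}_7\phi_6$ transformation. -/
theorem wpMatrix_sum_quad {A K p : ℂ} (h : WPGeneric A K p)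
    (f2 : QFree (A ^ 2 / K) p) (f3 : QFree (K ^ 2 / A ^ 2) p) (r N : ℕ) (hN : r < N) :
    ∑ j ∈ Finset.range N, wpMatrix A K p r j * ((1 - A * p ^ (2 * j)) / (1 - A) *
        (qPoch A p j * qPoch (K / (A * p)) p j * qPoch (A ^ 2 * p / K) (p ^ 2) j *
          qPoch (A ^ 2 * p ^ 2 / K) (p ^ 2) j /
        (qPoch p p j * qPoch (A ^ 2 * p ^ 2 / K) p j * qPoch K (p ^ 2) j *
          qPoch (K * p) (p ^ 2) j)) * p ^ j) =
      qPoch (K ^ 2 / (A ^ 2 * p)) p r * qPoch (A * p) p r / (qPoch K p r * qPoch (K / A) p r) := by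
  have hA := h.A_free.one_sub_ne 0 (e := A) (by simp)
  refine h.sum_of_certificate_split
    (b := fun r => qPoch (K ^ 2 / (A ^ 2 * p)) p r * qPoch (A * p) p r /
      (qPoch K p r * qPoch (K / A) p r))
    (β := fun r => quadSumRatio A K p (p ^ r))
    (ρ := fun j => quadTermRatio A K p (p ^ j))
    (c₂ := fun r => (1 - K ^ 2 / A ^ 2 * p ^ r) * (1 - A ^ 2 * p ^ 3 / K * p ^ r))
    (c₀ := fun r => p * (1 - p * p ^ r) * (1 - K * p ^ r))
    (R := fun r j => quadCert A K p (p ^ r) (p ^ j))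
    (by simp [qPoch_zero, div_self hA]) ?_ (fun j => ?_) (fun r => ?_) (fun r => ?_)
    (fun r => by simp [quadCert]) (fun r j => ?_) r N hN
  -- Row one, the second initial value of the recurrence.
  · have m1 := h.sub_ne 0 0 (pow_zero p) (pow_zero p) 0 (e := K - A) (by ring)
    have m2 := h.one_sub_K_ne 0 0 (pow_zero p) (pow_zero p) 0 (e := K) (by ring)
    have m3 := h.one_sub_K_ne 0 0 (pow_zero p) (pow_zero p) 1 (e := K * p) (by ring)
    have m4 := h.one_sub_A_ne 0 0 (pow_zero p) (pow_zero p) 2 (e := A * p ^ 2) (by ring)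
    have m5 := h.p_free.one_sub_ne 0 (e := p) (by ring)
    have m6 : K - A ^ 2 * p ^ 2 ≠ 0 := by
      have := f2.one_sub_ne 2 rfl
      intro h0
      apply this
      rw [sub_eq_zero.1 h0]
      field_simp [h.A_ne, h.p_ne]
      simp
    have := h.A_ne
    have := h.K_ne
    have := h.p_ne
    simp only [quadTermRatio, quadSumRatio, wpRight, pow_zero, one_pow, mul_one]
    rw [show K * p - A * p = p * (K - A) by ring, show 1 - K / A = (K - A) / -A by field_simp; ring,
      show A * p * p = A * p ^ 2 by ring,
      show 1 - A ^ 2 * p ^ 2 / K = (K - A ^ 2 * p ^ 2) / K by field_simp]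
    generalize e1 : 1 - K = d1 at *
    generalize e2 : 1 - K * p = d2 at *
    generalize e3 : K - A = d3 at *
    generalize e4 : 1 - A * p ^ 2 = d4 at *
    generalize e5 : 1 - p = d5 at *
    generalize e6 : K - A ^ 2 * p ^ 2 = d6 at *
    generalize e7 : 1 - A = d7 at *
    field_simp
    rw [← e1, ← e3, ← e5]
    ring
  · rw [vwp_succ h.A_free]
    simp only [quadTermRatio, qPoch_succ, pow_succ, mul_pow, div_eq_mul_inv, mul_inv]
    ring
  · simp only [quadSumRatio, qPoch_succ, div_eq_mul_inv, mul_inv]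
    ring
  -- The leading coefficient does not vanish; this is the purpose of `f3`.
  · exact mul_ne_zero (f3.one_sub_ne r rfl) (f2.one_sub_ne (r + 3) (by ring))
  · simp only [pow_succ' p r, pow_succ' p (r + 1), pow_succ' p j]
    generalize hx : p ^ r = x
    generalize hy : p ^ j = y
    exact quad_certificate (x := x) (y := y) h.A_ne h.K_ne h.p_ne
      (hy ▸ pow_ne_zero _ h.p_ne)
      (h.one_sub_K_ne r 0 hx (pow_zero p) 0 (by ring))
      (h.one_sub_K_ne r 0 hx (pow_zero p) 1 (by ring))
      (h.sub_ne r 0 hx (pow_zero p) 0 (by ring)) (h.sub_ne r 0 hx (pow_zero p) 1 (by ring))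
      (h.one_sub_A_ne j j hy hy 2 (by ring)) (h.one_sub_A_ne j j hy hy 0 (by ring))
      (h.p_free.one_sub_ne j (by rw [← hy]; ring))
      (f2.one_sub_ne (j + 2) (by rw [← hy]; ring))
      (h.one_sub_K_ne j j hy hy 0 (by ring)) (h.one_sub_K_ne j j hy hy 1 (by ring))
      (h.one_sub_K_ne r j hx hy 0 (by ring)) (h.p_free.one_sub_ne r (by rw [← hx]; ring))
      (h.sub_ne r j hx hy 0 (by ring)) (h.one_sub_A_ne r 0 hx (pow_zero p) 1 (by ring))
      (h.one_sub_A_ne r j hx hy 3 (by ring)) (h.one_sub_K_ne r j hx hy 1 (by ring))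
      (h.one_sub_K_ne r j hx hy 2 (by ring)) (h.p_free.one_sub_ne (r + 1) (by rw [← hx]; ring))
      (h.sub_ne r j hx hy 1 (by ring)) (h.one_sub_A_ne r 0 hx (pow_zero p) 2 (by ring))

/-! ### The quadratic sum with a square root of `K` -/

noncomputable def sqrtSumRatio (A s p x : ℂ) : ℂ :=
  (1 - s ^ 4 / A ^ 2 * x) * (1 - A * p * x) * (1 - s * x) /
    ((1 - s ^ 2 * x) * (1 - s ^ 2 / A * x) * (1 - p * s * x))

noncomputable def sqrtTermRatio (A s p y : ℂ) : ℂ :=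
  (1 - A * p ^ 2 * y ^ 2) / (1 - A * y ^ 2) *
    ((1 - A * y) * (1 - s ^ 2 / A * y) * (1 - A / s * y) * (1 + p * (A / s) * y) *
      (1 - A ^ 2 * p / s ^ 2 * y ^ 2) /
    ((1 - p * y) * (1 - A ^ 2 * p / s ^ 2 * y) * (1 - p * s * y) * (1 + s * y) *
      (1 - s ^ 2 * p * y ^ 2))) * p

/-- As for `quadCert`, relative to the summand of row $r+2$, with $K=s^2$. -/
noncomputable def sqrtCert (A s p x y : ℂ) : ℂ :=
  -((1 - s ^ 4 * p / A ^ 2 * x) * (1 - s * p * x) * p ^ 3 * x ^ 2 * (s ^ 2 - A * p) /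
      ((1 - p ^ 2 * x) * (1 - s * p ^ 2 * x))) *
    ((1 - y) * (1 - A * p ^ 2 * x * y) * (1 - A ^ 2 / s ^ 2 * y) * (1 - s ^ 2 / p * y ^ 2) *
      (1 - s * y) * (1 + s / p * y) /
    (y * (1 - A * y ^ 2) * (1 - s ^ 2 * x * y) * (1 - s ^ 2 * p * x * y) *
      (s ^ 2 * p * x - A * y)))

set_option maxRecDepth 10000 in
set_option maxHeartbeats 1000000 in
theorem sqrt_certificate {A s p x y : ℂ} (hA : A ≠ 0) (hs : s ≠ 0) (hp : p ≠ 0)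
    (hy : y ≠ 0)
    (n1 : 1 - s ^ 2 * x ≠ 0) (n2 : 1 - s ^ 2 * p * x ≠ 0) (n3 : s ^ 2 * x - A ≠ 0)
    (n4 : s ^ 2 * p * x - A ≠ 0)
    (n5 : 1 - A * p ^ 2 * y ^ 2 ≠ 0) (n6 : 1 - A * y ^ 2 ≠ 0)
    (n7 : 1 - p * y ≠ 0) (n8 : 1 - A ^ 2 * p / s ^ 2 * y ≠ 0) (n9 : 1 + s * y ≠ 0)
    (n10 : 1 - s ^ 2 * p * y ^ 2 ≠ 0) (n11 : 1 - s ^ 2 * x * y ≠ 0) (n12 : 1 - p * x ≠ 0)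
    (n13 : s ^ 2 * x - A * y ≠ 0) (n14 : 1 - A * p * x ≠ 0) (n15 : 1 - A * p ^ 3 * x * y ≠ 0)
    (n16 : 1 - s ^ 2 * p * x * y ≠ 0) (n17 : 1 - s ^ 2 * p ^ 2 * x * y ≠ 0)
    (n18 : 1 - p ^ 2 * x ≠ 0) (n19 : s ^ 2 * p * x - A * y ≠ 0) (n20 : 1 - A * p ^ 2 * x ≠ 0)
    (n21 : 1 - s * p * x ≠ 0) (n22 : 1 - s * p ^ 2 * x ≠ 0) (n23 : 1 - s * p * y ≠ 0) :
    (1 - s ^ 4 * p / A ^ 2 * x) * (1 - A ^ 2 * p ^ 2 / s ^ 2 * x) *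
        (1 - wpLeft A (s ^ 2) p (p * x) y * sqrtSumRatio A s p (p * x)) -
      p * (1 - p * x) * (1 - s ^ 2 * x) *
          (wpLeft A (s ^ 2) p (p * x) y * sqrtSumRatio A s p (p * x)) *
        (1 - wpLeft A (s ^ 2) p x y * sqrtSumRatio A s p x) =
      sqrtCert A s p x (p * y) * (wpRight A (s ^ 2) p (p * (p * x)) y * sqrtTermRatio A s p y) -
      sqrtCert A s p x y := by
  -- Again the row quotients and the shifted certificate are reduced separately first.
  have hL1 : wpLeft A (s ^ 2) p (p * x) y * sqrtSumRatio A s p (p * x) =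
      A * (p ^ 2 * x - y) * (1 - A * p ^ 2 * x * y) * (1 - s ^ 4 * p / A ^ 2 * x) *
        (1 - s * p * x) /
        ((1 - s ^ 2 * p * x * y) * (1 - p ^ 2 * x) * (s ^ 2 * p * x - A * y) *
        (1 - s * p ^ 2 * x)) := by
    rw [wpLeft, sqrtSumRatio,
      show 1 - s ^ 2 / A * (p * x) = (s ^ 2 * p * x - A) / -A by field_simp; ring,
      show s ^ 2 * (p * x) = s ^ 2 * p * x by ring, show A * p * (p * x) = A * p ^ 2 * x by ring,
      show p * (p * x) - 1 = -(1 - p ^ 2 * x) by ring,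
      show p * s * (p * x) = s * p ^ 2 * x by ring,
      show s * (p * x) = s * p * x by ring,
      show s ^ 4 / A ^ 2 * (p * x) = s ^ 4 * p / A ^ 2 * x by ring]
    generalize s ^ 2 * p * x - A = d4 at *
    generalize 1 - s ^ 2 * p * x = d2 at *
    generalize 1 - s ^ 2 * p * x * y = d16 at *
    generalize 1 - p ^ 2 * x = d18 at *
    generalize s ^ 2 * p * x - A * y = d19 at *
    generalize 1 - A * p ^ 2 * x = d20 at *
    generalize 1 - s * p ^ 2 * x = d21 at *
    field_simp
  have hL0 : wpLeft A (s ^ 2) p x y * sqrtSumRatio A s p x =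
      A * (p * x - y) * (1 - A * p * x * y) * (1 - s ^ 4 / A ^ 2 * x) * (1 - s * x) /
        ((1 - s ^ 2 * x * y) * (1 - p * x) * (s ^ 2 * x - A * y) * (1 - s * p * x)) := by
    rw [wpLeft, sqrtSumRatio, show 1 - s ^ 2 / A * x = (s ^ 2 * x - A) / -A by field_simp; ring,
      show p * x - 1 = -(1 - p * x) by ring, mul_comm p s]
    generalize s ^ 2 * x - A = d4 at *
    generalize 1 - s ^ 2 * x = d2 at *
    generalize 1 - s ^ 2 * x * y = d16 at *
    generalize 1 - p * x = d18 at *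
    generalize s ^ 2 * x - A * y = d19 at *
    generalize 1 - A * p * x = d20 at *
    generalize 1 - s * p * x = d21 at *
    field_simp
  have hR1 : sqrtCert A s p x (p * y) *
        (wpRight A (s ^ 2) p (p * (p * x)) y * sqrtTermRatio A s p y) =
      -((1 - s ^ 4 * p / A ^ 2 * x) * (1 - s * p * x) * x ^ 2 * (s ^ 2 - A * p) /
          ((1 - p ^ 2 * x) * (1 - s * p ^ 2 * x))) *
        ((p ^ 2 * x - y) * s ^ 2 * (1 - A * y) * (1 - s ^ 2 / A * y) * (1 - A / s * y) *
          (1 + p * (A / s) * y) * (1 - A ^ 2 * p / s ^ 2 * y ^ 2) * p /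
          (y * (1 - A * y ^ 2) * (1 - s ^ 2 * p * x * y) * (s ^ 2 * x - A * y) *
          (s ^ 2 * p * x - A * y))) := by
    rw [sqrtCert, wpRight, sqrtTermRatio, show s ^ 2 * x * (p * y) = s ^ 2 * p * x * y by ring,
      show s ^ 2 * p * x * (p * y) = s ^ 2 * p ^ 2 * x * y by ring,
      show s ^ 2 * p * x - A * (p * y) = p * (s ^ 2 * x - A * y) by ring,
      show A * (p * y) ^ 2 = A * p ^ 2 * y ^ 2 by ring,
      show A * p ^ 2 * x * (p * y) = A * p ^ 3 * x * y by ring,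
      show s ^ 2 / p * (p * y) ^ 2 = s ^ 2 * p * y ^ 2 by field_simp,
      show s / p * (p * y) = s * y by field_simp,
      show A ^ 2 / s ^ 2 * (p * y) = A ^ 2 * p / s ^ 2 * y by ring,
      show s ^ 2 * (p * (p * x)) * y = s ^ 2 * p ^ 2 * x * y by ring,
      show s ^ 2 * (p * (p * x)) - A * p * y = p * (s ^ 2 * p * x - A * y) by ring,
      show A * p * (p * (p * x)) * y = A * p ^ 3 * x * y by ring,
      show p * (p * x) - y = p ^ 2 * x - y by ring,
      show s * (p * y) = s * p * y by ring, mul_comm p s]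
    generalize s ^ 2 * x - A * y = d1 at *
    generalize s ^ 2 * p * x - A * y = d2 at *
    generalize 1 - s ^ 2 * p * x * y = d3 at *
    generalize 1 - s ^ 2 * p ^ 2 * x * y = d4 at *
    generalize 1 - A * p ^ 2 * y ^ 2 = d5 at *
    generalize 1 - A * p ^ 3 * x * y = d6 at *
    generalize 1 - s ^ 2 * p * y ^ 2 = d7 at *
    generalize 1 - s * p * y = d8 at *
    generalize 1 - A ^ 2 * p / s ^ 2 * y = d9 at *
    generalize 1 - p * y = d10 at *
    generalize 1 - A * y ^ 2 = d11 at *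
    generalize 1 - p ^ 2 * x = d12 at *
    generalize 1 - s * p ^ 2 * x = d13 at *
    generalize 1 + s * y = d14 at *
    field_simp
  rw [hL1, hL0, hR1, sqrtCert]
  generalize e1 : s ^ 2 * x - A * y = d1 at *
  generalize e2 : s ^ 2 * p * x - A * y = d2 at *
  generalize e3 : 1 - s ^ 2 * p * x * y = d3 at *
  generalize e4 : 1 - s ^ 2 * x * y = d4 at *
  generalize e5 : 1 - A * y ^ 2 = d5 at *
  generalize e6 : 1 - p ^ 2 * x = d6 at *
  generalize e7 : 1 - p * x = d7 at *
  generalize e8 : 1 - s * p * x = d8 at *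
  generalize e9 : 1 - s * p ^ 2 * x = d9 at *
  field_simp
  rw [← e1, ← e2, ← e3, ← e4, ← e5, ← e6, ← e7, ← e8, ← e9]
  ring

/-- Writing $K=s^2$ makes $A/s$ and $-pA/s$ admissible parameters, with well-poised partners $ps$
and $-s$. The closed form contains $(s;p)_r/(ps;p)_r$, which later removes half of the
very-well-poised factor and turns a ${}_7\phi_6$ into a ${}_6\phi_5$. -/
theorem wpMatrix_sum_sqrt {A s p : ℂ} (h : WPGeneric A (s ^ 2) p) (hs : s ≠ 0) (f1 : QFree s p)
    (f2 : QFree (A ^ 2 / s ^ 2) p) (f3 : QFree (s ^ 4 / A ^ 2) p) (f4 : QFree (-s) p)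
    (r N : ℕ) (hN : r < N) :
    ∑ j ∈ Finset.range N, wpMatrix A (s ^ 2) p r j * ((1 - A * p ^ (2 * j)) / (1 - A) *
        (qPoch A p j * qPoch (s ^ 2 / A) p j * qPoch (A / s) p j * qPoch (-(p * (A / s))) p j *
          qPoch (A ^ 2 * p / s ^ 2) (p ^ 2) j /
        (qPoch p p j * qPoch (A ^ 2 * p / s ^ 2) p j * qPoch (p * s) p j * qPoch (-s) p j *
          qPoch (s ^ 2 * p) (p ^ 2) j)) * p ^ j) =
      qPoch (s ^ 4 / A ^ 2) p r * qPoch (A * p) p r * qPoch s p r /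
        (qPoch (s ^ 2) p r * qPoch (s ^ 2 / A) p r * qPoch (p * s) p r) := by
  have hA := h.A_free.one_sub_ne 0 (e := A) (by simp)
  refine h.sum_of_certificate_split
    (b := fun r => qPoch (s ^ 4 / A ^ 2) p r * qPoch (A * p) p r * qPoch s p r /
        (qPoch (s ^ 2) p r * qPoch (s ^ 2 / A) p r * qPoch (p * s) p r))
    (β := fun r => sqrtSumRatio A s p (p ^ r))
    (ρ := fun j => sqrtTermRatio A s p (p ^ j))
    (c₂ := fun r => (1 - s ^ 4 * p / A ^ 2 * p ^ r) * (1 - A ^ 2 * p ^ 2 / s ^ 2 * p ^ r))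
    (c₀ := fun r => p * (1 - p * p ^ r) * (1 - s ^ 2 * p ^ r))
    (R := fun r j => sqrtCert A s p (p ^ r) (p ^ j))
    (by simp [qPoch_zero, div_self hA]) ?_ (fun j => ?_) (fun r => ?_) (fun r => ?_)
    (fun r => by simp [sqrtCert]) (fun r j => ?_) r N hN
  · have m1 := h.sub_ne 0 0 (pow_zero p) (pow_zero p) 0 (e := s ^ 2 - A) (by ring)
    have m3 := h.one_sub_K_ne 0 0 (pow_zero p) (pow_zero p) 1 (e := s ^ 2 * p) (by ring)
    have m4 := h.one_sub_A_ne 0 0 (pow_zero p) (pow_zero p) 2 (e := A * p ^ 2) (by ring)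
    have m5 := h.p_free.one_sub_ne 0 (e := p) (by ring)
    have m6 := f2.one_sub_ne 1 (e := A ^ 2 * p / s ^ 2) (by ring)
    have m7 := f1.one_sub_ne 0 (e := s) (by ring)
    have m8 := f1.one_sub_ne 1 (e := p * s) (by ring)
    have m9 := f4.one_sub_ne 0 (e := -s) (by ring)
    rw [sub_neg_eq_add] at m9
    have := h.A_ne
    have := h.p_ne
    simp only [sqrtTermRatio, sqrtSumRatio, wpRight, pow_zero, one_pow, mul_one]
    rw [show s ^ 2 * p - A * p = p * (s ^ 2 - A) by ring,
      show 1 - s ^ 2 / A = (s ^ 2 - A) / -A by field_simp; ring,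
      show A * p * p = A * p ^ 2 by ring, show 1 - s ^ 2 = (1 - s) * (1 + s) by ring]
    generalize e2 : 1 - s ^ 2 * p = d2 at *
    generalize e3 : s ^ 2 - A = d3 at *
    generalize e4 : 1 - A * p ^ 2 = d4 at *
    generalize e5 : 1 - p = d5 at *
    generalize e6 : 1 - A ^ 2 * p / s ^ 2 = d6 at *
    generalize e7 : 1 - A = d7 at *
    generalize e8 : 1 - s = d8 at *
    generalize e9 : 1 + s = d9 at *
    generalize e10 : 1 - p * s = d10 at *
    field_simp
    rw [← e3, ← e5, ← e9, ← e10]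
    ring
  · rw [vwp_succ h.A_free]
    simp only [sqrtTermRatio, qPoch_succ, pow_succ, mul_pow, div_eq_mul_inv, mul_inv, neg_mul,
      sub_neg_eq_add]
    ring
  · simp only [sqrtSumRatio, qPoch_succ, div_eq_mul_inv, mul_inv]
    ring
  · exact mul_ne_zero (f3.one_sub_ne (r + 1) (by ring)) (f2.one_sub_ne (r + 2) (by ring))
  · have n9 := f4.one_sub_ne j rfl
    rw [neg_mul, sub_neg_eq_add] at n9
    simp only [pow_succ' p r, pow_succ' p (r + 1), pow_succ' p j]
    generalize hx : p ^ r = x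
    generalize hy : p ^ j = y at *
    exact sqrt_certificate (x := x) (y := y) h.A_ne hs h.p_ne
      (hy ▸ pow_ne_zero _ h.p_ne)
      (h.one_sub_K_ne r 0 hx (pow_zero p) 0 (by ring))
      (h.one_sub_K_ne r 0 hx (pow_zero p) 1 (by ring))
      (h.sub_ne r 0 hx (pow_zero p) 0 (by ring)) (h.sub_ne r 0 hx (pow_zero p) 1 (by ring))
      (h.one_sub_A_ne j j hy hy 2 (by ring)) (h.one_sub_A_ne j j hy hy 0 (by ring))
      (h.p_free.one_sub_ne j (by rw [← hy]; ring))
      (f2.one_sub_ne (j + 1) (by rw [← hy]; ring))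
      n9 (h.one_sub_K_ne j j hy hy 1 (by ring))
      (h.one_sub_K_ne r j hx hy 0 (by ring)) (h.p_free.one_sub_ne r (by rw [← hx]; ring))
      (h.sub_ne r j hx hy 0 (by ring)) (h.one_sub_A_ne r 0 hx (pow_zero p) 1 (by ring))
      (h.one_sub_A_ne r j hx hy 3 (by ring)) (h.one_sub_K_ne r j hx hy 1 (by ring))
      (h.one_sub_K_ne r j hx hy 2 (by ring)) (h.p_free.one_sub_ne (r + 1) (by rw [← hx]; ring))
      (h.sub_ne r j hx hy 1 (by ring)) (h.one_sub_A_ne r 0 hx (pow_zero p) 2 (by ring))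
      (f1.one_sub_ne (r + 1) (by rw [← hx]; ring)) (f1.one_sub_ne (r + 2) (by rw [← hx]; ring))
      (f1.one_sub_ne (j + 1) (by rw [← hy]; ring))

/-! ### A sum that vanishes for odd index -/

/-- Extension by zero of a sequence on the even numbers. -/
def evenExtend (g : ℕ → ℂ) (r : ℕ) : ℂ := if Even r then g (r / 2) else 0

theorem evenExtend_two_mul (g : ℕ → ℂ) (i : ℕ) : evenExtend g (2 * i) = g i := by
  simp [evenExtend]

theorem sum_range_evenExtend (g : ℕ → ℂ) (w : ℕ → ℂ) (N : ℕ) :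
    ∑ j ∈ Finset.range (2 * N), w j * evenExtend g j =
      ∑ i ∈ Finset.range N, w (2 * i) * g i := by
  induction N with
  | zero => simp
  | succ N ih =>
    rw [show 2 * (N + 1) = 2 * N + 1 + 1 by ring, Finset.sum_range_succ, Finset.sum_range_succ, ih,
      Finset.sum_range_succ, evenExtend_two_mul]
    simp [evenExtend]

noncomputable def evenSumRatio (A K p x : ℂ) : ℂ :=
  (1 - p * x) * (1 - K ^ 2 / A ^ 2 * x) * (1 - A * p * x) * (1 - A * p ^ 2 * x) /
    ((1 - K * p * x) * (1 - A ^ 2 * p ^ 2 / K * x) * (1 - K / A * x) * (1 - K * p / A * x))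

noncomputable def evenTermRatio (A K p y : ℂ) : ℂ :=
  (1 - A * p ^ 2 * y ^ 2) / (1 - A * y ^ 2) *
    ((1 - A * y) * (1 - K / A * y) * (1 - A ^ 2 * p / K * y ^ 2) /
    ((1 - p * y) * (1 - A ^ 2 * p / K * y) * (1 - K * p * y ^ 2))) * -(p * A / K)

/-- The certificate of a relation between rows $r$ and $r+2$ only, relative to row $r+2$. -/
noncomputable def evenCert (A K p x y : ℂ) : ℂ :=
  -((1 - K * p ^ 2 * x ^ 2) * p * x * (K - A * p) /
      ((1 - p ^ 2 * x) * (1 - A ^ 2 * p ^ 2 / K * x))) *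
    ((1 - y) * (1 - A * p ^ 2 * x * y) * (1 - A ^ 2 / K * y) * (1 - K / p * y ^ 2) /
    ((1 - A * y ^ 2) * (1 - K * x * y) * (1 - K * p * x * y) * (K * p * x - A * y)))

set_option maxRecDepth 10000 in
set_option maxHeartbeats 1000000 in
theorem even_certificate {A K p x y : ℂ} (hA : A ≠ 0) (hK : K ≠ 0) (hp : p ≠ 0)
    (n1 : 1 - K * p * x ≠ 0) (n2 : 1 - A ^ 2 * p ^ 2 / K * x ≠ 0) (n3 : K * x - A ≠ 0)
    (n4 : K * p * x - A ≠ 0)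
    (n5 : 1 - A * p ^ 2 * y ^ 2 ≠ 0) (n6 : 1 - A * y ^ 2 ≠ 0)
    (n7 : 1 - p * y ≠ 0) (n8 : 1 - A ^ 2 * p / K * y ≠ 0)
    (n10 : 1 - K * p * y ^ 2 ≠ 0) (n11 : 1 - K * x * y ≠ 0) (n12 : 1 - p * x ≠ 0)
    (n13 : K * x - A * y ≠ 0) (n14 : 1 - A * p * x ≠ 0) (n15 : 1 - A * p ^ 3 * x * y ≠ 0)
    (n16 : 1 - K * p * x * y ≠ 0) (n17 : 1 - K * p ^ 2 * x * y ≠ 0) (n18 : 1 - p ^ 2 * x ≠ 0)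
    (n19 : K * p * x - A * y ≠ 0) (n20 : 1 - A * p ^ 2 * x ≠ 0) :
    1 - evenSumRatio A K p x * (wpLeft A K p (p * x) y * wpLeft A K p x y) =
      evenCert A K p x (p * y) * (wpRight A K p (p * (p * x)) y * evenTermRatio A K p y) -
      evenCert A K p x y := by
  have hL : evenSumRatio A K p x * (wpLeft A K p (p * x) y * wpLeft A K p x y) =
      A ^ 2 * (1 - K * x) * (1 - K ^ 2 / A ^ 2 * x) * (p ^ 2 * x - y) * (p * x - y) *
        (1 - A * p * x * y) * (1 - A * p ^ 2 * x * y) /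
        ((1 - A ^ 2 * p ^ 2 / K * x) * (1 - K * p * x * y) * (1 - p ^ 2 * x) *
        (K * p * x - A * y) * (1 - K * x * y) * (K * x - A * y)) := by
    rw [wpLeft, wpLeft, evenSumRatio,
      show 1 - K * p / A * x = (K * p * x - A) / -A by field_simp; ring,
      show 1 - K / A * x = (K * x - A) / -A by field_simp; ring,
      show K * (p * x) = K * p * x by ring, show A * p * (p * x) = A * p ^ 2 * x by ring,
      show p * (p * x) - 1 = -(1 - p ^ 2 * x) by ring,
      show p * x - 1 = -(1 - p * x) by ring]
    generalize K * p * x - A = d1 at *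
    generalize K * x - A = d2 at *
    generalize 1 - K * p * x * y = d3 at *
    generalize 1 - K * x * y = d4 at *
    generalize 1 - p ^ 2 * x = d5 at *
    generalize 1 - p * x = d6 at *
    generalize K * p * x - A * y = d7 at *
    generalize K * x - A * y = d8 at *
    generalize 1 - A * p ^ 2 * x = d9 at *
    generalize 1 - A * p * x = d10 at *
    generalize 1 - K * p * x = d11 at *
    generalize 1 - A ^ 2 * p ^ 2 / K * x = d12 at *
    field_simp
  have hR1 : evenCert A K p x (p * y) * (wpRight A K p (p * (p * x)) y * evenTermRatio A K p y) =
      (1 - K * p ^ 2 * x ^ 2) * x * (K - A * p) * A /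
          ((1 - p ^ 2 * x) * (1 - A ^ 2 * p ^ 2 / K * x)) *
        ((p ^ 2 * x - y) * (1 - A * y) * (1 - K / A * y) * (1 - A ^ 2 * p / K * y ^ 2) /
          ((1 - A * y ^ 2) * (1 - K * p * x * y) * (K * x - A * y) * (K * p * x - A * y))) := by
    rw [evenCert, wpRight, evenTermRatio, show K * x * (p * y) = K * p * x * y by ring,
      show K * p * x * (p * y) = K * p ^ 2 * x * y by ring,
      show K * p * x - A * (p * y) = p * (K * x - A * y) by ring,
      show A * (p * y) ^ 2 = A * p ^ 2 * y ^ 2 by ring,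
      show A * p ^ 2 * x * (p * y) = A * p ^ 3 * x * y by ring,
      show K / p * (p * y) ^ 2 = K * p * y ^ 2 by field_simp,
      show A ^ 2 / K * (p * y) = A ^ 2 * p / K * y by ring,
      show K * (p * (p * x)) * y = K * p ^ 2 * x * y by ring,
      show K * (p * (p * x)) - A * p * y = p * (K * p * x - A * y) by ring,
      show A * p * (p * (p * x)) * y = A * p ^ 3 * x * y by ring,
      show p * (p * x) - y = p ^ 2 * x - y by ring]
    generalize K * x - A * y = d1 at *
    generalize K * p * x - A * y = d2 at *
    generalize 1 - K * p * x * y = d3 at *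
    generalize 1 - K * p ^ 2 * x * y = d4 at *
    generalize 1 - A * p ^ 2 * y ^ 2 = d5 at *
    generalize 1 - A * p ^ 3 * x * y = d6 at *
    generalize 1 - K * p * y ^ 2 = d7 at *
    generalize 1 - A ^ 2 * p / K * y = d9 at *
    generalize 1 - p * y = d10 at *
    generalize 1 - A * y ^ 2 = d11 at *
    generalize 1 - p ^ 2 * x = d12 at *
    generalize 1 - A ^ 2 * p ^ 2 / K * x = d13 at *
    field_simp
  rw [hL, hR1, evenCert]
  generalize e1 : K * x - A * y = d1 at *
  generalize e2 : K * p * x - A * y = d2 at *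
  generalize e3 : 1 - K * p * x * y = d3 at *
  generalize e4 : 1 - K * x * y = d4 at *
  generalize e5 : 1 - A * y ^ 2 = d5 at *
  generalize e6 : 1 - p ^ 2 * x = d6 at *
  generalize e7 : 1 - A ^ 2 * p ^ 2 / K * x = d7 at *
  field_simp
  rw [← e1, ← e2, ← e3, ← e4, ← e5, ← e6, ← e7]
  field_simp
  ring

/-- A very-well-poised ${}_8W_7$ with parameters $K/A$, $\pm A\sqrt{p/K}$ and argument $-pA/K$. The
middle term of its recurrence is absent, so rows of different parity decouple; as row one is zero,
every odd row is. -/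
theorem wpMatrix_sum_even {A K p : ℂ} (h : WPGeneric A K p) (f2 : QFree (A ^ 2 / K) p)
    (r N : ℕ) (hN : r < N) :
    ∑ j ∈ Finset.range N, wpMatrix A K p r j * ((1 - A * p ^ (2 * j)) / (1 - A) *
        (qPoch A p j * qPoch (K / A) p j * qPoch (A ^ 2 * p / K) (p ^ 2) j /
        (qPoch p p j * qPoch (A ^ 2 * p / K) p j * qPoch (K * p) (p ^ 2) j)) *
        (-(p * A / K)) ^ j) =
      evenExtend (fun i => qPoch p (p ^ 2) i * qPoch (K ^ 2 / A ^ 2) (p ^ 2) i *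
        qPoch (A * p) (p ^ 2) i * qPoch (A * p ^ 2) (p ^ 2) i /
        (qPoch (K * p) (p ^ 2) i * qPoch (A ^ 2 * p ^ 2 / K) (p ^ 2) i * qPoch (K / A) (p ^ 2) i *
          qPoch (K * p / A) (p ^ 2) i)) r := by
  have hA := h.A_free.one_sub_ne 0 (e := A) (by simp)
  refine h.sum_of_certificate_two
    (b := evenExtend (fun i => qPoch p (p ^ 2) i * qPoch (K ^ 2 / A ^ 2) (p ^ 2) i *
        qPoch (A * p) (p ^ 2) i * qPoch (A * p ^ 2) (p ^ 2) i /
        (qPoch (K * p) (p ^ 2) i * qPoch (A ^ 2 * p ^ 2 / K) (p ^ 2) i * qPoch (K / A) (p ^ 2) i *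
          qPoch (K * p / A) (p ^ 2) i)))
    (ρ := fun j => evenTermRatio A K p (p ^ j))
    (c₂ := fun _ => 1) (c₁ := fun _ => 0) (c₀ := fun r => -evenSumRatio A K p (p ^ r))
    (R := fun r j => evenCert A K p (p ^ r) (p ^ j))
    (by simp [qPoch_zero, div_self hA, evenExtend]) ?_ (fun j => ?_) (fun r => one_ne_zero)
    (fun r => ?_) (fun r => by simp [evenCert]) (fun r j => ?_) r N hN
  · have m1 := h.sub_ne 0 0 (pow_zero p) (pow_zero p) 0 (e := K - A) (by ring)
    have m3 := h.one_sub_K_ne 0 0 (pow_zero p) (pow_zero p) 1 (e := K * p) (by ring)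
    have m4 := h.one_sub_A_ne 0 0 (pow_zero p) (pow_zero p) 2 (e := A * p ^ 2) (by ring)
    have m5 := h.p_free.one_sub_ne 0 (e := p) (by ring)
    have m6 := f2.one_sub_ne 1 (e := A ^ 2 * p / K) (by ring)
    have := h.A_ne
    have := h.p_ne
    have := h.K_ne
    -- In row one the two terms must cancel, since the extension by zero gives $b_1=0$.
    simp only [qPoch_zero, evenExtend, evenTermRatio, wpRight, pow_zero, one_pow, mul_one, mul_zero,
      div_self hA]
    rw [show K * p - A * p = p * (K - A) by ring, if_neg (by decide),
      show A * p * p = A * p ^ 2 by ring, show 1 - K / A = (K - A) / -A by field_simp; ring]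
    generalize e2 : 1 - K * p = d2 at *
    generalize e3 : K - A = d3 at *
    generalize e4 : 1 - A * p ^ 2 = d4 at *
    generalize e5 : 1 - p = d5 at *
    generalize e6 : 1 - A ^ 2 * p / K = d6 at *
    generalize e7 : 1 - A = d7 at *
    field_simp
    rw [← e5]
    ring
  · rw [vwp_succ h.A_free]
    simp only [evenTermRatio, qPoch_succ, pow_succ, mul_pow, div_eq_mul_inv, mul_inv]
    ring
  · rw [zero_mul, add_zero, one_mul]
    simp only [evenExtend, Nat.even_add, even_two, iff_true]
    split_ifs with hr
    · obtain ⟨i, rfl⟩ := hr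
      rw [show (i + i + 2) / 2 = i + 1 by omega, show (i + i) / 2 = i by omega]
      simp only [evenSumRatio, qPoch_succ, pow_add, ← pow_mul, div_eq_mul_inv, mul_inv]
      ring
    · ring
  · simp only [pow_succ' p r, pow_succ' p (r + 1), pow_succ' p j]
    generalize hx : p ^ r = x
    generalize hy : p ^ j = y
    rw [← even_certificate (x := x) (y := y) h.A_ne h.K_ne h.p_ne
      (h.one_sub_K_ne r 0 hx (pow_zero p) 1 (by ring))
      (f2.one_sub_ne (r + 2) (by rw [← hx]; ring))
      (h.sub_ne r 0 hx (pow_zero p) 0 (by ring)) (h.sub_ne r 0 hx (pow_zero p) 1 (by ring))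
      (h.one_sub_A_ne j j hy hy 2 (by ring)) (h.one_sub_A_ne j j hy hy 0 (by ring))
      (h.p_free.one_sub_ne j (by rw [← hy]; ring))
      (f2.one_sub_ne (j + 1) (by rw [← hy]; ring))
      (h.one_sub_K_ne j j hy hy 1 (by ring))
      (h.one_sub_K_ne r j hx hy 0 (by ring)) (h.p_free.one_sub_ne r (by rw [← hx]; ring))
      (h.sub_ne r j hx hy 0 (by ring)) (h.one_sub_A_ne r 0 hx (pow_zero p) 1 (by ring))
      (h.one_sub_A_ne r j hx hy 3 (by ring)) (h.one_sub_K_ne r j hx hy 1 (by ring))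
      (h.one_sub_K_ne r j hx hy 2 (by ring)) (h.p_free.one_sub_ne (r + 1) (by rw [← hx]; ring))
      (h.sub_ne r j hx hy 1 (by ring)) (h.one_sub_A_ne r 0 hx (pow_zero p) 2 (by ring))]
    ring

/-! ### A sum over even columns -/

noncomputable def evenColSumRatio (A K p x : ℂ) : ℂ :=
  (1 - K ^ 2 * p / A * x ^ 2) * (1 - A / K * x) * (1 - A * p * x) /
    ((1 - A * p * x ^ 2) * (1 - K ^ 2 * p / A * x) * (1 - K / A * x)) * -(K / A)

noncomputable def evenColTermRatio (A K p y : ℂ) : ℂ :=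
  (1 - A * (p ^ 2) ^ 2 * y ^ 2) / (1 - A * y ^ 2) *
    ((1 - A * y) * (1 - A ^ 2 / K ^ 2 * y) /
    ((1 - p ^ 2 * y) * (1 - K ^ 2 * p ^ 2 / A * y))) * p ^ 2

/-- Here $y=p^{2i}$, so the certificate moves by two columns of the matrix at a time, while the rows
still move by one. -/
noncomputable def evenColCert (A K p x y : ℂ) : ℂ :=
  -(p * x * (1 - K * p * x ^ 2) * K /
      ((1 - p * x) * (1 - A * p * x ^ 2) * (1 - K ^ 2 * p / A * x) * (K - A))) *
    ((1 - y) * (1 - A * p * x * y) * (1 - A * x * y) * (1 - K ^ 2 / A * y) *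
      (K * p * x - A * y) / (K * p * x * y * (1 - A * y ^ 2) * (1 - K * x * y)))

set_option maxRecDepth 10000 in
set_option maxHeartbeats 1000000 in
theorem evenCol_certificate {A K p x y : ℂ} (hA : A ≠ 0) (hK : K ≠ 0) (hp : p ≠ 0)
    (hx : x ≠ 0) (hy : y ≠ 0)
    (n1 : 1 - A * p * x ^ 2 ≠ 0) (n2 : 1 - K ^ 2 * p / A * x ≠ 0) (n3 : K * x - A ≠ 0)
    (n4 : 1 - p * x ≠ 0) (n5 : K - A ≠ 0) (n6 : 1 - A * y ^ 2 ≠ 0)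
    (n7 : 1 - p ^ 2 * y ≠ 0) (n8 : 1 - K ^ 2 * p ^ 2 / A * y ≠ 0)
    (n9 : 1 - A * p ^ 4 * y ^ 2 ≠ 0) (n10 : 1 - K * x * y ≠ 0) (n11 : 1 - K * p ^ 2 * x * y ≠ 0)
    (n12 : K * x - A * y ≠ 0) (n13 : 1 - A * p ^ 2 * x * y ≠ 0) (n14 : K * x - A * p * y ≠ 0)
    (n15 : 1 - A * p ^ 3 * x * y ≠ 0) (n16 : 1 - A * p * x ≠ 0) :
    1 - wpLeft A K p x y * evenColSumRatio A K p x =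
      evenColCert A K p x (p ^ 2 * y) * (wpRight A K p (p * x) y * wpRight A K p (p * x) (p * y) *
        evenColTermRatio A K p y) - evenColCert A K p x y := by
  have hL : wpLeft A K p x y * evenColSumRatio A K p x =
      -((1 - K * x) * (p * x - y) * (1 - A * p * x * y) * (1 - K ^ 2 * p / A * x ^ 2) *
        (1 - A / K * x) * K /
        ((1 - K * x * y) * (1 - p * x) * (K * x - A * y) * (1 - A * p * x ^ 2) *
          (1 - K ^ 2 * p / A * x))) := by
    rw [wpLeft, evenColSumRatio,
      show 1 - K / A * x = (K * x - A) / -A by field_simp; ring,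
      show p * x - 1 = -(1 - p * x) by ring]
    generalize 1 - A * p * x ^ 2 = d1 at *
    generalize 1 - K ^ 2 * p / A * x = d2 at *
    generalize K * x - A = d3 at *
    generalize 1 - p * x = d4 at *
    generalize 1 - K * x * y = d5 at *
    generalize K * x - A * y = d6 at *
    generalize 1 - A * p * x = d7 at *
    field_simp
  have hR1 : evenColCert A K p x (p ^ 2 * y) *
        (wpRight A K p (p * x) y * wpRight A K p (p * x) (p * y) * evenColTermRatio A K p y) =
      -(p * x * (1 - K * p * x ^ 2) * K /
        ((1 - p * x) * (1 - A * p * x ^ 2) * (1 - K ^ 2 * p / A * x) * (K - A))) *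
        ((1 - K * p * x * y) * (p * x - y) * (x - y) * K * (1 - A * y) * (1 - A ^ 2 / K ^ 2 * y) /
          (x * p * (K * x - A * y) * y * (1 - A * y ^ 2))) := by
    rw [evenColCert, wpRight, wpRight, evenColTermRatio,
      show A * (p ^ 2) ^ 2 * y ^ 2 = A * p ^ 4 * y ^ 2 by ring,
      show A * (p ^ 2 * y) ^ 2 = A * p ^ 4 * y ^ 2 by ring,
      show K * x * (p ^ 2 * y) = K * p ^ 2 * x * y by ring,
      show K * (p * x) * (p * y) = K * p ^ 2 * x * y by ring,
      show K * (p * x) * y = K * p * x * y by ring,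
      show K * (p * x) - A * p * y = p * (K * x - A * y) by ring,
      show K * (p * x) - A * p * (p * y) = p * (K * x - A * p * y) by ring,
      show K * p * x - A * (p ^ 2 * y) = p * (K * x - A * p * y) by ring,
      show A * p * x * (p ^ 2 * y) = A * p ^ 3 * x * y by ring,
      show A * p * (p * x) * (p * y) = A * p ^ 3 * x * y by ring,
      show A * x * (p ^ 2 * y) = A * p ^ 2 * x * y by ring,
      show A * p * (p * x) * y = A * p ^ 2 * x * y by ring,
      show K ^ 2 / A * (p ^ 2 * y) = K ^ 2 * p ^ 2 / A * y by ring,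
      show p * x - p * y = p * (x - y) by ring]
    generalize 1 - A * p * x ^ 2 = d1 at *
    generalize 1 - K ^ 2 * p / A * x = d2 at *
    generalize 1 - p * x = d4 at *
    generalize K - A = d5 at *
    generalize 1 - A * y ^ 2 = d6 at *
    generalize 1 - p ^ 2 * y = d7 at *
    generalize 1 - K ^ 2 * p ^ 2 / A * y = d8 at *
    generalize 1 - A * p ^ 4 * y ^ 2 = d9 at *
    generalize 1 - K * p ^ 2 * x * y = d11 at *
    generalize K * x - A * y = d12 at *
    generalize 1 - A * p ^ 2 * x * y = d13 at *
    generalize K * x - A * p * y = d14 at *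
    generalize 1 - A * p ^ 3 * x * y = d15 at *
    field_simp
  rw [hL, hR1, evenColCert]
  generalize e1 : 1 - A * p * x ^ 2 = d1 at *
  generalize e2 : 1 - K ^ 2 * p / A * x = d2 at *
  generalize e3 : 1 - p * x = d4 at *
  generalize e4 : K - A = d5 at *
  generalize e5 : 1 - A * y ^ 2 = d6 at *
  generalize e6 : K * x - A * y = d7 at *
  generalize e7 : 1 - K * x * y = d8 at *
  field_simp
  rw [← e1, ← e2, ← e3, ← e4, ← e5, ← e6, ← e7]
  field_simp
  ring

/-- Splitting the matrix entry in column $2i$ into base $p^2$ factors gives a ${}_8W_7$ with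
parameters $A^2/K^2, Kp^r, Kp^{r+1}, p^{-r}, p^{1-r}$, whose product is $A^2p^2$: this is Jackson's
sum in base $p^2$. The induction on $r$ treats both parities of $r$ at once, and it is written out
because one step of the sum is two columns of the matrix. -/
theorem wpMatrix_sum_evenCol {A K p : ℂ} (h : WPGeneric A K p) (f2 : QFree (K ^ 2 / A) p)
    (r N : ℕ) (hN : r < 2 * N) :
    ∑ i ∈ Finset.range N, wpMatrix A K p r (2 * i) * ((1 - A * (p ^ 2) ^ (2 * i)) / (1 - A) *
        (qPoch A (p ^ 2) i * qPoch (A ^ 2 / K ^ 2) (p ^ 2) i /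
        (qPoch (p ^ 2) (p ^ 2) i * qPoch (K ^ 2 * p ^ 2 / A) (p ^ 2) i)) * (p ^ 2) ^ i) =
      qPoch (K ^ 2 * p / A) (p ^ 2) r * qPoch (A / K) p r * qPoch (A * p) p r /
        (qPoch (A * p) (p ^ 2) r * qPoch (K ^ 2 * p / A) p r * qPoch (K / A) p r) *
        (-(K / A)) ^ r := by
  have hA := h.A_free.one_sub_ne 0 (e := A) (by simp)
  have hA2 : QFree A (p ^ 2) := fun l => by
    rw [← zpow_natCast p, ← zpow_mul]; exact h.A_free _
  have hmul : ∀ i : ℕ, p ^ (2 * i) = (p ^ 2) ^ i := fun i => pow_mul p 2 i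
  induction r generalizing N with
  | zero =>
    rw [Finset.sum_eq_single_of_mem 0 (Finset.mem_range.2 (by omega))]
    · simp [qPoch_zero, wpMatrix_zero_right, div_self hA]
    · exact fun j _ hj => by rw [wpMatrix_eq_zero h.p_ne (by omega), zero_mul]
  | succ r ih =>
    set α : ℕ → ℂ := fun i => (1 - A * (p ^ 2) ^ (2 * i)) / (1 - A) *
        (qPoch A (p ^ 2) i * qPoch (A ^ 2 / K ^ 2) (p ^ 2) i /
        (qPoch (p ^ 2) (p ^ 2) i * qPoch (K ^ 2 * p ^ 2 / A) (p ^ 2) i)) * (p ^ 2) ^ i with hα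
    have hαs : ∀ i, α (i + 1) = α i * evenColTermRatio A K p ((p ^ 2) ^ i) := fun i => by
      simp only [hα]
      rw [vwp_succ hA2]
      simp only [evenColTermRatio, qPoch_succ, pow_succ, div_eq_mul_inv, mul_inv]
      ring
    have hstep : ∀ i, wpMatrix A K p (r + 1) (2 * i) * α i -
        wpMatrix A K p r (2 * i) * α i * evenColSumRatio A K p (p ^ r) =
        evenColCert A K p (p ^ r) ((p ^ 2) ^ (i + 1)) *
          (wpMatrix A K p (r + 1) (2 * (i + 1)) * α (i + 1)) -
        evenColCert A K p (p ^ r) ((p ^ 2) ^ i) * (wpMatrix A K p (r + 1) (2 * i) * α i) := by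
      intro i
      have key : 1 - wpLeft A K p (p ^ r) ((p ^ 2) ^ i) * evenColSumRatio A K p (p ^ r) =
          evenColCert A K p (p ^ r) (p ^ 2 * (p ^ 2) ^ i) *
          (wpRight A K p (p * p ^ r) ((p ^ 2) ^ i) * wpRight A K p (p * p ^ r) (p * (p ^ 2) ^ i) *
            evenColTermRatio A K p ((p ^ 2) ^ i)) -
            evenColCert A K p (p ^ r) ((p ^ 2) ^ i) := by
        generalize hx : p ^ r = x
        have hy : p ^ (2 * i) = (p ^ 2) ^ i := hmul i
        generalize (p ^ 2) ^ i = y at hy ⊢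
        exact evenCol_certificate h.A_ne h.K_ne h.p_ne (hx ▸ pow_ne_zero _ h.p_ne)
          (hy ▸ pow_ne_zero _ h.p_ne) (h.one_sub_A_ne r r hx hx 1 (by ring))
          (f2.one_sub_ne (r + 1) (by rw [← hx]; ring))
          (h.sub_ne r 0 hx (pow_zero p) 0 (by ring)) (h.p_free.one_sub_ne r (by rw [← hx]; ring))
          (h.sub_ne 0 0 (pow_zero p) (pow_zero p) 0 (by ring))
          (h.one_sub_A_ne _ _ hy hy 0 (by ring))
          (h.p_free.one_sub_ne (2 * i + 1) (by rw [← hy]; ring))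
          (f2.one_sub_ne (2 * i + 2) (by rw [← hy]; ring))
          (h.one_sub_A_ne _ _ hy hy 4 (by ring)) (h.one_sub_K_ne _ _ hx hy 0 (by ring))
          (h.one_sub_K_ne _ _ hx hy 2 (by ring)) (h.sub_ne _ _ hx hy 0 (by ring))
          (h.one_sub_A_ne _ _ hx hy 2 (by ring))
          (h.sub_ne r (2 * i + 1) hx (pow_succ p (2 * i)) 0 (by rw [← hy]; ring))
          (h.one_sub_A_ne _ _ hx hy 3 (by ring))
          (h.one_sub_A_ne r 0 hx (pow_zero p) 1 (by ring))
      rw [show 2 * (i + 1) = 2 * i + 1 + 1 by ring, h.succ_left r, h.succ_right (r + 1) (2 * i + 1),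
        h.succ_right (r + 1) (2 * i), hαs, pow_succ' p (2 * i), hmul, pow_succ' (p ^ 2) i,
        pow_succ' p r]
      linear_combination (wpMatrix A K p (r + 1) (2 * i) * α i) * key
    have h1 : ∑ i ∈ Finset.range (N + 1), (wpMatrix A K p (r + 1) (2 * i) * α i -
        wpMatrix A K p r (2 * i) * α i * evenColSumRatio A K p (p ^ r)) = 0 := by
      rw [Finset.sum_congr rfl fun i _ => hstep i,
        Finset.sum_range_sub (fun i => evenColCert A K p (p ^ r) ((p ^ 2) ^ i) *
          (wpMatrix A K p (r + 1) (2 * i) * α i)),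
        wpMatrix_eq_zero h.p_ne (show r + 1 < 2 * (N + 1) by omega)]
      simp [evenColCert]
    -- The sums were taken up to $N+1$; in row $r+1$ the last column $2N$ lies beyond the diagonal
    -- and drops out.
    rw [Finset.sum_sub_distrib, ← Finset.sum_mul, ih (N + 1) (by omega), sub_eq_zero,
      Finset.sum_range_succ, wpMatrix_eq_zero h.p_ne hN, zero_mul, add_zero] at h1
    rw [h1]
    simp only [evenColSumRatio, qPoch_succ, pow_succ, mul_pow, ← pow_mul, div_eq_mul_inv, mul_inv]
    ring

/-! ### A base change with linear square root factors -/

noncomputable def linSumRatio (a k q x : ℂ) : ℂ :=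
  (1 + k / q * x) * (1 + k * x) * (1 - a * q ^ 3 / k * x) * (1 - a ^ 2 * q ^ 2 * x) /
    ((1 + a * q * x) * (1 + a * q ^ 2 * x) * (1 - k ^ 2 / q ^ 2 * x) * (1 - k / (a * q) * x)) *
    (k / (q ^ 2 * a))

noncomputable def linTermRatio (a k q y : ℂ) : ℂ :=
  (1 - a * q ^ 2 * y ^ 2) / (1 - a * y ^ 2) * ((1 - a * y) * (1 - a * q ^ 2 / k * y) /
    ((1 - q * y) * (1 - k / q * y))) * q

/-- The last numerator factor does not split into linear factors as written, but it is
self-reciprocal under $y\mapsto q/(ay)$. Here $y=q^j$ while $x=q^{2r}$, so the matrix in base $q^2$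
is evaluated at $y^2$. -/
noncomputable def linCert (a k q x y : ℂ) : ℂ :=
  -((1 - a * k * q * x ^ 2) /
      ((1 + a * q * x) * (1 + a * q ^ 2 * x) * (1 - q ^ 2 * x) * (1 - k ^ 2 / q ^ 2 * x))) *
    ((1 - y) * (1 - a ^ 2 * q ^ 2 * x * y ^ 2) * (1 - k / q ^ 2 * y) *
      (x * (q ^ 2 + k) * (1 + a / q * y ^ 2) + (1 + k * x) * (1 + a * q * x) * y) /
      (y * (1 - a * y ^ 2) * (1 - a * k / q * x * y ^ 2)))

set_option maxRecDepth 10000 in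
set_option maxHeartbeats 1000000 in
theorem lin_certificate {a k q x y : ℂ} (ha : a ≠ 0) (hk : k ≠ 0) (hq : q ≠ 0)
    (hy : y ≠ 0)
    (n1 : 1 + a * q * x ≠ 0) (n2 : 1 + a * q ^ 2 * x ≠ 0) (n3 : 1 - k ^ 2 / q ^ 2 * x ≠ 0)
    (n4 : 1 - q ^ 2 * x ≠ 0) (n5 : a * k / q * x - a ^ 2 ≠ 0) (n6 : 1 - a * y ^ 2 ≠ 0)
    (n7 : 1 - q * y ≠ 0) (n8 : 1 - k / q * y ≠ 0)
    (n9 : 1 - a * q ^ 2 * y ^ 2 ≠ 0) (n10 : 1 - a * k / q * x * y ^ 2 ≠ 0)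
    (n11 : 1 - a * k * q * x * y ^ 2 ≠ 0)
    (n12 : a * k / q * x - a ^ 2 * y ^ 2 ≠ 0) (n13 : 1 - a ^ 2 * q ^ 4 * x * y ^ 2 ≠ 0)
    (n14 : 1 - a ^ 2 * q ^ 2 * x ≠ 0) :
    1 - wpLeft (a ^ 2) (a * k / q) (q ^ 2) x (y ^ 2) * linSumRatio a k q x =
      linCert a k q x (q * y) * (wpRight (a ^ 2) (a * k / q) (q ^ 2) (q ^ 2 * x) (y ^ 2) *
        linTermRatio a k q y) - linCert a k q x y := by
  have hL : wpLeft (a ^ 2) (a * k / q) (q ^ 2) x (y ^ 2) * linSumRatio a k q x =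
      (1 - a * k / q * x) * (q ^ 2 * x - y ^ 2) * (1 - a ^ 2 * q ^ 2 * x * y ^ 2) * a *
        (1 + k / q * x) * (1 + k * x) * (1 - a * q ^ 3 / k * x) * k /
        (q ^ 2 * (1 - a * k / q * x * y ^ 2) * (1 - q ^ 2 * x) *
          (a * k / q * x - a ^ 2 * y ^ 2) * (1 + a * q * x) * (1 + a * q ^ 2 * x) *
          (1 - k ^ 2 / q ^ 2 * x)) := by
    rw [wpLeft, linSumRatio,
      show 1 - k / (a * q) * x = (a * k / q * x - a ^ 2) / -a ^ 2 by field_simp; ring,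
      show q ^ 2 * x - 1 = -(1 - q ^ 2 * x) by ring]
    generalize 1 + a * q * x = d1 at *
    generalize 1 + a * q ^ 2 * x = d2 at *
    generalize 1 - k ^ 2 / q ^ 2 * x = d3 at *
    generalize 1 - q ^ 2 * x = d4 at *
    generalize a * k / q * x - a ^ 2 = d5 at *
    generalize 1 - a * k / q * x * y ^ 2 = d10 at *
    generalize a * k / q * x - a ^ 2 * y ^ 2 = d12 at *
    generalize 1 - a ^ 2 * q ^ 2 * x = d14 at *
    generalize 1 - a * k / q * x = d15 at *
    generalize 1 - a * q ^ 3 / k * x = d16 at *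
    generalize 1 + k / q * x = d17 at *
    field_simp
  have hR1 : linCert a k q x (q * y) * (wpRight (a ^ 2) (a * k / q) (q ^ 2) (q ^ 2 * x) (y ^ 2) *
        linTermRatio a k q y) =
      -((1 - a * k * q * x ^ 2) /
      ((1 + a * q * x) * (1 + a * q ^ 2 * x) * (1 - q ^ 2 * x) * (1 - k ^ 2 / q ^ 2 * x))) *
      ((x * (q ^ 2 + k) * (1 + a * q * y ^ 2) + (1 + k * x) * (1 + a * q * x) * (q * y)) *
        (q ^ 2 * x - y ^ 2) * a * k * (1 - a * y) * (1 - a * q ^ 2 / k * y) /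
        (y * (1 - a * y ^ 2) * q ^ 3 * (a * k / q * x - a ^ 2 * y ^ 2))) := by
    rw [linCert, wpRight, linTermRatio,
      show a / q * (q * y) ^ 2 = a * q * y ^ 2 by field_simp,
      show a * (q * y) ^ 2 = a * q ^ 2 * y ^ 2 by ring,
      show a ^ 2 * q ^ 2 * x * (q * y) ^ 2 = a ^ 2 * q ^ 4 * x * y ^ 2 by ring,
      show a ^ 2 * q ^ 2 * (q ^ 2 * x) * y ^ 2 = a ^ 2 * q ^ 4 * x * y ^ 2 by ring,
      show a * k / q * x * (q * y) ^ 2 = a * k * q * x * y ^ 2 by field_simp,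
      show a * k / q * (q ^ 2 * x) * y ^ 2 = a * k * q * x * y ^ 2 by field_simp,
      show a * k / q * (q ^ 2 * x) - a ^ 2 * q ^ 2 * y ^ 2 =
        q ^ 2 * (a * k / q * x - a ^ 2 * y ^ 2) by ring,
      show k / q ^ 2 * (q * y) = k / q * y by field_simp]
    generalize 1 + a * q * x = d1 at *
    generalize 1 + a * q ^ 2 * x = d2 at *
    generalize 1 - k ^ 2 / q ^ 2 * x = d3 at *
    generalize 1 - q ^ 2 * x = d4 at *
    generalize 1 - a * y ^ 2 = d6 at *
    generalize 1 - q * y = d7 at *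
    generalize 1 - k / q * y = d8 at *
    generalize 1 - a * q ^ 2 * y ^ 2 = d9 at *
    generalize 1 - a * k * q * x * y ^ 2 = d11 at *
    generalize a * k / q * x - a ^ 2 * y ^ 2 = d12 at *
    generalize 1 - a ^ 2 * q ^ 4 * x * y ^ 2 = d13 at *
    generalize 1 - a * q ^ 2 / k * y = d14 at *
    field_simp
  rw [hL, hR1, linCert]
  generalize e1 : 1 + a * q * x = d1 at *
  generalize e2 : 1 + a * q ^ 2 * x = d2 at *
  generalize e3 : 1 - k ^ 2 / q ^ 2 * x = d3 at *
  generalize e4 : 1 - q ^ 2 * x = d4 at *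
  generalize e6 : 1 - a * y ^ 2 = d6 at *
  generalize e10 : 1 - a * k / q * x * y ^ 2 = d10 at *
  generalize e12 : a * k / q * x - a ^ 2 * y ^ 2 = d12 at *
  field_simp
  rw [← e1, ← e2, ← e3, ← e4, ← e6, ← e10, ← e12]
  field_simp
  ring

/-- A mixed-base sum: the matrix is in base $q^2$ and the weights are in base $q$. The
very-well-poised factor is that of $a$ in base $q$, not that of $a^2$ in base $q^2$. -/
theorem wpMatrix_sum_lin {a k q : ℂ} (ha : a ≠ 0) (hk : k ≠ 0) (hq : q ≠ 0)
    (h : WPGeneric (a ^ 2) (a * k / q) (q ^ 2)) (f1 : QFree (-a) q) (f2 : QFree a q)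
    (f3 : QFree (k ^ 2 / q ^ 2) (q ^ 2)) (f4 : QFree (k / q) q) (f5 : NotRootOfUnity q)
    (r N : ℕ) (hN : r < N) :
    ∑ j ∈ Finset.range N, wpMatrix (a ^ 2) (a * k / q) (q ^ 2) r j *
        ((1 - a * q ^ (2 * j)) / (1 - a) * (qPoch a q j * qPoch (a * q ^ 2 / k) q j /
        (qPoch q q j * qPoch (k / q) q j)) * q ^ j) =
      qPoch (-(k / q)) (q ^ 2) r * qPoch (-k) (q ^ 2) r * qPoch (a * q ^ 3 / k) (q ^ 2) r *
        qPoch (a ^ 2 * q ^ 2) (q ^ 2) r / (qPoch (-(a * q)) (q ^ 2) r *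
        qPoch (-(a * q ^ 2)) (q ^ 2) r * qPoch (k ^ 2 / q ^ 2) (q ^ 2) r *
        qPoch (k / (a * q)) (q ^ 2) r) * (k / (q ^ 2 * a)) ^ r := by
  have hA := f2.one_sub_ne 0 (e := a) (by simp)
  refine h.sum_of_certificate
    (b := fun r => qPoch (-(k / q)) (q ^ 2) r * qPoch (-k) (q ^ 2) r *
        qPoch (a * q ^ 3 / k) (q ^ 2) r *
        qPoch (a ^ 2 * q ^ 2) (q ^ 2) r / (qPoch (-(a * q)) (q ^ 2) r *
        qPoch (-(a * q ^ 2)) (q ^ 2) r * qPoch (k ^ 2 / q ^ 2) (q ^ 2) r *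
        qPoch (k / (a * q)) (q ^ 2) r) * (k / (q ^ 2 * a)) ^ r)
    (β := fun r => linSumRatio a k q ((q ^ 2) ^ r))
    (ρ := fun j => linTermRatio a k q (q ^ j))
    (R := fun r j => linCert a k q ((q ^ 2) ^ r) (q ^ j))
    (by simp [qPoch_zero, div_self hA]) (fun j => ?_) (fun r => ?_)
    (fun r => by simp [linCert]) (fun r j => ?_) r N hN
  · rw [vwp_succ f2]
    simp only [linTermRatio, qPoch_succ, pow_succ, div_eq_mul_inv, mul_inv]
    ring
  · simp only [linSumRatio, qPoch_succ, neg_mul, sub_neg_eq_add, pow_succ, mul_pow, div_eq_mul_inv,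
      mul_inv]
    ring
  · rw [show (q ^ 2) ^ j = (q ^ j) ^ 2 by ring]
    simp only [pow_succ' (q ^ 2) r, pow_succ' q j]
    have hy : (q ^ 2) ^ j = (q ^ j) ^ 2 := by ring
    generalize hx : (q ^ 2) ^ r = x
    generalize hz : q ^ j = y at hy ⊢
    exact lin_certificate (x := x) (y := y) ha hk hq (hz ▸ pow_ne_zero _ hq)
      (sub_neg_eq_add (1 : ℂ) _ ▸ f1.one_sub_ne (2 * r + 1) (e := -(a * q * x)) (by rw [← hx]; ring))
      (sub_neg_eq_add (1 : ℂ) _ ▸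
        f1.one_sub_ne (2 * r + 2) (e := -(a * q ^ 2 * x)) (by rw [← hx]; ring))
      (f3.one_sub_ne r (by rw [← hx]))
      (h.p_free.one_sub_ne r (by rw [← hx]; ring))
      (h.sub_ne r 0 hx (pow_zero _) 0 (by ring))
      (f2.one_sub_ne (2 * j) (by rw [← hz]; ring))
      (f5.one_sub_ne j (by rw [← hz]; ring))
      (f4.one_sub_ne j (by rw [← hz]))
      (f2.one_sub_ne (2 * j + 2) (by rw [← hz]; ring))
      (h.one_sub_K_ne r j hx hy 0 (by ring))
      (h.one_sub_K_ne r j hx hy 1 (by field_simp))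
      (h.sub_ne r j hx hy 0 (by ring))
      (h.one_sub_A_ne r j hx hy 2 (by ring))
      (h.one_sub_A_ne r 0 hx (pow_zero _) 1 (by ring))

/-! ### A base change with a quartic factor -/

noncomputable def quartSumRatio (a k q x : ℂ) : ℂ :=
  (1 + k * q * x) * (1 + k * x) * (1 - a * q / k * x) * (1 - a ^ 2 * q ^ 2 * x) /
    ((1 + a * q * x) * (1 + a * x) * (1 - k ^ 2 * x) * (1 - k / (a * q) * x)) *
    (k / (q ^ 2 * a))

noncomputable def quartTermRatio (a k q y : ℂ) : ℂ :=
  (1 - a ^ 2 * (q ^ 2) ^ 2 * (y ^ 2) ^ 2) / (1 - a ^ 2 * (y ^ 2) ^ 2) *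
    ((1 - a * y) * (1 - a * q / k * y) / ((1 - q * y) * (1 - k * y))) * q

/-- The unfactored part of the certificate, of degree four in $y$ and self-reciprocal under
$y\mapsto q/(ay)$. -/
noncomputable def quartPoly (a k q x y : ℂ) : ℂ :=
  q ^ 2 * x * (k - a) * (k + q) * (1 + a ^ 2 / q ^ 2 * y ^ 4) +
    q * (k - a * q) * (1 + q * k * x) * (1 + a * x) * (y + a / q * y ^ 3) +
    a * (k + q) * ((1 - q) * (1 + q * a * k * x ^ 2) + (k - a * q) * (1 + q) * x) * y ^ 2

noncomputable def quartCert (a k q x y : ℂ) : ℂ :=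
  -((1 - a * k * q * x ^ 2) /
      (q * (k - a * q) * (1 + a * x) * (1 + a * q * x) * (1 - q ^ 2 * x) * (1 - k ^ 2 * x))) *
    ((1 - y) * (1 - a ^ 2 * q ^ 2 * x * y ^ 2) * (1 - k / q * y) * quartPoly a k q x y /
      (y * (1 - a ^ 2 * (y ^ 2) ^ 2) * (1 - a * k / q * x * y ^ 2)))

set_option maxRecDepth 10000 in
set_option maxHeartbeats 1000000 in
theorem quart_certificate {a k q x y : ℂ} (ha : a ≠ 0) (hk : k ≠ 0) (hq : q ≠ 0)
    (hy : y ≠ 0)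
    (n1 : 1 + a * q * x ≠ 0) (n2 : 1 + a * x ≠ 0) (n3 : 1 - k ^ 2 * x ≠ 0)
    (n4 : 1 - q ^ 2 * x ≠ 0) (n5 : a * k / q * x - a ^ 2 ≠ 0) (n6 : 1 - a ^ 2 * (y ^ 2) ^ 2 ≠ 0)
    (n7 : 1 - q * y ≠ 0) (n8 : 1 - k * y ≠ 0)
    (n9 : 1 - a ^ 2 * (q ^ 2) ^ 2 * (y ^ 2) ^ 2 ≠ 0) (n10 : 1 - a * k / q * x * y ^ 2 ≠ 0)
    (n11 : 1 - a * k * q * x * y ^ 2 ≠ 0)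
    (n12 : a * k / q * x - a ^ 2 * y ^ 2 ≠ 0) (n13 : 1 - a ^ 2 * q ^ 4 * x * y ^ 2 ≠ 0)
    (n14 : 1 - a ^ 2 * q ^ 2 * x ≠ 0) (n15 : k - a * q ≠ 0) :
    1 - wpLeft (a ^ 2) (a * k / q) (q ^ 2) x (y ^ 2) * quartSumRatio a k q x =
      quartCert a k q x (q * y) * (wpRight (a ^ 2) (a * k / q) (q ^ 2) (q ^ 2 * x) (y ^ 2) *
        quartTermRatio a k q y) - quartCert a k q x y := by
  have hL : wpLeft (a ^ 2) (a * k / q) (q ^ 2) x (y ^ 2) * quartSumRatio a k q x =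
      (1 - a * k / q * x) * (q ^ 2 * x - y ^ 2) * (1 - a ^ 2 * q ^ 2 * x * y ^ 2) * a *
        (1 + k * q * x) * (1 + k * x) * (1 - a * q / k * x) * k /
        (q ^ 2 * (1 - a * k / q * x * y ^ 2) * (1 - q ^ 2 * x) *
          (a * k / q * x - a ^ 2 * y ^ 2) * (1 + a * q * x) * (1 + a * x) *
          (1 - k ^ 2 * x)) := by
    rw [wpLeft, quartSumRatio,
      show 1 - k / (a * q) * x = (a * k / q * x - a ^ 2) / -a ^ 2 by field_simp; ring,
      show q ^ 2 * x - 1 = -(1 - q ^ 2 * x) by ring]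
    generalize 1 + a * q * x = d1 at *
    generalize 1 + a * x = d2 at *
    generalize 1 - k ^ 2 * x = d3 at *
    generalize 1 - q ^ 2 * x = d4 at *
    generalize a * k / q * x - a ^ 2 = d5 at *
    generalize 1 - a * k / q * x * y ^ 2 = d10 at *
    generalize a * k / q * x - a ^ 2 * y ^ 2 = d12 at *
    generalize 1 - a ^ 2 * q ^ 2 * x = d14 at *
    generalize 1 - a * k / q * x = d15 at *
    generalize 1 - a * q / k * x = d16 at *
    field_simp
  have hR1 : quartCert a k q x (q * y) * (wpRight (a ^ 2) (a * k / q) (q ^ 2) (q ^ 2 * x) (y ^ 2) *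
        quartTermRatio a k q y) =
      -((1 - a * k * q * x ^ 2) /
      (q * (k - a * q) * (1 + a * x) * (1 + a * q * x) * (1 - q ^ 2 * x) * (1 - k ^ 2 * x))) *
      (quartPoly a k q x (q * y) *
        (q ^ 2 * x - y ^ 2) * a * k * (1 - a * y) * (1 - a * q / k * y) /
        (y * (1 - a ^ 2 * (y ^ 2) ^ 2) * q ^ 3 * (a * k / q * x - a ^ 2 * y ^ 2))) := by
    rw [quartCert, wpRight, quartTermRatio,
      show a ^ 2 * ((q * y) ^ 2) ^ 2 = a ^ 2 * (q ^ 2) ^ 2 * (y ^ 2) ^ 2 by ring,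
      show a ^ 2 * q ^ 2 * x * (q * y) ^ 2 = a ^ 2 * q ^ 4 * x * y ^ 2 by ring,
      show a ^ 2 * q ^ 2 * (q ^ 2 * x) * y ^ 2 = a ^ 2 * q ^ 4 * x * y ^ 2 by ring,
      show a * k / q * x * (q * y) ^ 2 = a * k * q * x * y ^ 2 by field_simp,
      show a * k / q * (q ^ 2 * x) * y ^ 2 = a * k * q * x * y ^ 2 by field_simp,
      show a * k / q * (q ^ 2 * x) - a ^ 2 * q ^ 2 * y ^ 2 =
        q ^ 2 * (a * k / q * x - a ^ 2 * y ^ 2) by ring,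
      show k / q * (q * y) = k * y by field_simp]
    generalize quartPoly a k q x (q * y) = S
    generalize 1 + a * q * x = d1 at *
    generalize 1 + a * x = d2 at *
    generalize 1 - k ^ 2 * x = d3 at *
    generalize 1 - q ^ 2 * x = d4 at *
    generalize 1 - a ^ 2 * (y ^ 2) ^ 2 = d6 at *
    generalize 1 - q * y = d7 at *
    generalize 1 - k * y = d8 at *
    generalize 1 - a ^ 2 * (q ^ 2) ^ 2 * (y ^ 2) ^ 2 = d9 at *
    generalize 1 - a * k * q * x * y ^ 2 = d11 at *
    generalize a * k / q * x - a ^ 2 * y ^ 2 = d12 at *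
    generalize 1 - a ^ 2 * q ^ 4 * x * y ^ 2 = d13 at *
    generalize 1 - a * q / k * y = d14 at *
    generalize k - a * q = d15 at *
    field_simp
  rw [hL, hR1, quartCert, quartPoly, quartPoly]
  generalize e1 : 1 + a * q * x = d1 at *
  generalize e2 : 1 + a * x = d2 at *
  generalize e3 : 1 - k ^ 2 * x = d3 at *
  generalize e4 : 1 - q ^ 2 * x = d4 at *
  generalize e6 : 1 - a ^ 2 * (y ^ 2) ^ 2 = d6 at *
  generalize e10 : 1 - a * k / q * x * y ^ 2 = d10 at *
  generalize e12 : a * k / q * x - a ^ 2 * y ^ 2 = d12 at *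
  generalize e13 : k - a * q = d13 at *
  field_simp
  rw [← e1, ← e2, ← e3, ← e4, ← e6, ← e10, ← e12, ← e13]
  field_simp
  ring

/-- The companion of `wpMatrix_sum_lin` with the very-well-poised factor of $a^2$ in base $q^2$,
which is quartic in $q^j$. -/
theorem wpMatrix_sum_quart {a k q : ℂ} (ha : a ≠ 0) (hk : k ≠ 0) (hq : q ≠ 0)
    (h : WPGeneric (a ^ 2) (a * k / q) (q ^ 2)) (f1 : QFree (-a) q) (f2 : QFree (k / a) q)
    (f3 : QFree (k ^ 2) (q ^ 2)) (f4 : QFree k q) (f5 : NotRootOfUnity q)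
    (r N : ℕ) (hN : r < N) :
    ∑ j ∈ Finset.range N, wpMatrix (a ^ 2) (a * k / q) (q ^ 2) r j *
        ((1 - a ^ 2 * (q ^ 2) ^ (2 * j)) / (1 - a ^ 2) * (qPoch a q j * qPoch (a * q / k) q j /
        (qPoch q q j * qPoch k q j)) * q ^ j) =
      qPoch (-(k * q)) (q ^ 2) r * qPoch (-k) (q ^ 2) r * qPoch (a * q / k) (q ^ 2) r *
        qPoch (a ^ 2 * q ^ 2) (q ^ 2) r / (qPoch (-(a * q)) (q ^ 2) r *
        qPoch (-a) (q ^ 2) r * qPoch (k ^ 2) (q ^ 2) r *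
        qPoch (k / (a * q)) (q ^ 2) r) * (k / (q ^ 2 * a)) ^ r := by
  have hA := h.A_free.one_sub_ne 0 (e := a ^ 2) (by simp)
  -- The certificate carries $k-aq$ in its denominator, independently of the row and the column.
  have n15 : k - a * q ≠ 0 := by
    have := f2.sub_ne hq ha 0 1
    rwa [pow_zero, mul_one, pow_one] at this
  refine h.sum_of_certificate
    (b := fun r => qPoch (-(k * q)) (q ^ 2) r * qPoch (-k) (q ^ 2) r *
        qPoch (a * q / k) (q ^ 2) r *
        qPoch (a ^ 2 * q ^ 2) (q ^ 2) r / (qPoch (-(a * q)) (q ^ 2) r *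
        qPoch (-a) (q ^ 2) r * qPoch (k ^ 2) (q ^ 2) r *
        qPoch (k / (a * q)) (q ^ 2) r) * (k / (q ^ 2 * a)) ^ r)
    (β := fun r => quartSumRatio a k q ((q ^ 2) ^ r))
    (ρ := fun j => quartTermRatio a k q (q ^ j))
    (R := fun r j => quartCert a k q ((q ^ 2) ^ r) (q ^ j))
    (by simp [qPoch_zero, div_self hA]) (fun j => ?_) (fun r => ?_)
    (fun r => by simp [quartCert]) (fun r j => ?_) r N hN
  · rw [vwp_succ h.A_free, show (q ^ 2) ^ j = (q ^ j) ^ 2 by ring]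
    simp only [quartTermRatio, qPoch_succ, pow_succ, div_eq_mul_inv, mul_inv]
    ring
  · simp only [quartSumRatio, qPoch_succ, neg_mul, sub_neg_eq_add, pow_succ, mul_pow,
      div_eq_mul_inv, mul_inv]
    ring
  · rw [show (q ^ 2) ^ j = (q ^ j) ^ 2 by ring]
    simp only [pow_succ' (q ^ 2) r, pow_succ' q j]
    have hy : (q ^ 2) ^ j = (q ^ j) ^ 2 := by ring
    generalize hx : (q ^ 2) ^ r = x
    generalize hz : q ^ j = y at hy ⊢
    exact quart_certificate (x := x) (y := y) ha hk hq (hz ▸ pow_ne_zero _ hq)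
      (sub_neg_eq_add (1 : ℂ) _ ▸
        f1.one_sub_ne (2 * r + 1) (e := -(a * q * x)) (by rw [← hx]; ring))
      (sub_neg_eq_add (1 : ℂ) _ ▸ f1.one_sub_ne (2 * r) (e := -(a * x)) (by rw [← hx]; ring))
      (f3.one_sub_ne r (by rw [← hx]))
      (h.p_free.one_sub_ne r (by rw [← hx]; ring))
      (h.sub_ne r 0 hx (pow_zero _) 0 (by ring))
      (h.one_sub_A_ne j j hy hy 0 (by ring))
      (f5.one_sub_ne j (by rw [← hz]; ring))
      (f4.one_sub_ne j (by rw [← hz]))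
      (h.one_sub_A_ne j j hy hy 2 (by ring))
      (h.one_sub_K_ne r j hx hy 0 (by ring))
      (h.one_sub_K_ne r j hx hy 1 (by field_simp))
      (h.sub_ne r j hx hy 0 (by ring))
      (h.one_sub_A_ne r j hx hy 2 (by ring))
      (h.one_sub_A_ne r 0 hx (pow_zero _) 1 (by ring)) n15

/-! ### The Saalschütz sum -/

theorem qPoch_add (z q : ℂ) (m n : ℕ) :
    qPoch z q (m + n) = qPoch z q m * qPoch (z * q ^ m) q n := by
  simp only [qPoch, Finset.prod_range_add, pow_add, mul_assoc]

theorem qPoch_two_mul (z q : ℂ) (n : ℕ) :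
    qPoch z q (2 * n) = qPoch z (q ^ 2) n * qPoch (z * q) (q ^ 2) n := by
  induction n with
  | zero => simp [qPoch_zero]
  | succ n ih =>
    rw [show 2 * (n + 1) = 2 * n + 1 + 1 by ring, qPoch_succ, qPoch_succ, ih, qPoch_succ,
      qPoch_succ, ← pow_mul]
    ring

theorem qPoch_sq (z q : ℂ) (n : ℕ) :
    qPoch (z ^ 2) (q ^ 2) n = qPoch z q n * qPoch (-z) q n := by
  rw [qPoch, qPoch, qPoch, ← Finset.prod_mul_distrib]
  exact Finset.prod_congr rfl fun i _ => by ring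

theorem saalschuetz_certificate {a b c p x y : ℂ} (ha : a ≠ 0) (hb : b ≠ 0)
    (hp : p ≠ 0) (hy : y ≠ 0) (n1 : 1 - p * x ≠ 0) (n2 : 1 - c * x ≠ 0)
    (n3 : c * x - a * b * y ≠ 0) (n4 : 1 - p * y ≠ 0) (n5 : 1 - c * y ≠ 0)
    (n6 : c * x - a * b ≠ 0) :
    1 - (p * x - y) * (c * x - a * b) / ((p * x - 1) * (c * x - a * b * y)) *
        ((1 - c / a * x) * (1 - c / b * x) / ((1 - c * x) * (1 - c / (a * b) * x))) =
      -(p * x / ((1 - p * x) * (1 - c * x))) * ((1 - p * y) * (1 - c / p * (p * y)) / (p * y)) *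
        ((1 - a * y) * (1 - b * y) * (p * x - y) * c / ((1 - p * y) * (1 - c * y) *
          (c * x - a * b * y))) -
      -(p * x / ((1 - p * x) * (1 - c * x))) * ((1 - y) * (1 - c / p * y) / y) := by
  rw [show c / p * (p * y) = c * y by field_simp,
    show 1 - c / (a * b) * x = (c * x - a * b) / -(a * b) by field_simp; ring,
    show p * x - 1 = -(1 - p * x) by ring]
  generalize e1 : 1 - p * x = d1 at *
  generalize e2 : 1 - c * x = d2 at *
  generalize e3 : c * x - a * b * y = d3 at *
  generalize e4 : 1 - p * y = d4 at *
  generalize e5 : 1 - c * y = d5 at *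
  generalize e6 : c * x - a * b = d6 at *
  field_simp
  rw [← e1, ← e2, ← e3]
  field_simp
  ring

/-- The terminating balanced `₃φ₂` sum. -/
theorem sum_saalschuetz {a b c p : ℂ} (ha : a ≠ 0) (hb : b ≠ 0) (hc : c ≠ 0) (hp : p ≠ 0)
    (f1 : NotRootOfUnity p) (f2 : QFree c p) (f3 : QFree (c / (a * b)) p)
    (n N : ℕ) (hN : n < N) :
    ∑ j ∈ Finset.range N, qPoch a p j * qPoch b p j * qPoch (p ^ n)⁻¹ p j /
        (qPoch p p j * qPoch c p j * qPoch (a * b * p / (c * p ^ n)) p j) * p ^ j =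
      qPoch (c / a) p n * qPoch (c / b) p n / (qPoch c p n * qPoch (c / (a * b)) p n) := by
  have hab : a * b ≠ 0 := mul_ne_zero ha hb
  set f : ℕ → ℕ → ℂ := fun n j => qPoch a p j * qPoch b p j * qPoch (p ^ n)⁻¹ p j /
        (qPoch p p j * qPoch c p j * qPoch (a * b * p / (c * p ^ n)) p j) * p ^ j with hf
  refine sum_eq_of_telescoping (f := f)
    (β := fun r => (1 - c / a * p ^ r) * (1 - c / b * p ^ r) /
      ((1 - c * p ^ r) * (1 - c / (a * b) * p ^ r)))
    (b := fun n => qPoch (c / a) p n * qPoch (c / b) p n / (qPoch c p n * qPoch (c / (a * b)) p n))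
    (G := fun r j => -(p * p ^ r / ((1 - p * p ^ r) * (1 - c * p ^ r))) *
      ((1 - p ^ j) * (1 - c / p * p ^ j) / p ^ j) * f (r + 1) j) ?_ ?_ ?_ ?_ ?_ ?_ n N hN
  · intro r j hj
    simp only [hf]
    rw [qPoch_eq_zero hj (inv_mul_cancel₀ (pow_ne_zero _ hp))]
    simp
  · simp [hf, qPoch_zero]
  · intro r
    simp only [qPoch_succ, div_eq_mul_inv, mul_inv]
    ring
  · intro r
    simp
  · intro r j hj
    simp only [hf]
    rw [qPoch_eq_zero hj (inv_mul_cancel₀ (pow_ne_zero _ hp))]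
    simp
  · intro r j
    have hx0 : p ^ r ≠ 0 := pow_ne_zero _ hp
    have hy0 : p ^ j ≠ 0 := pow_ne_zero _ hp
    have n1 : 1 - p * p ^ r ≠ 0 := f1.one_sub_ne r (by ring)
    have n2 : 1 - c * p ^ r ≠ 0 := f2.one_sub_ne r rfl
    have n3 : c * p ^ r - a * b * p ^ j ≠ 0 := f3.sub_ne hp hab r j
    have n4 : 1 - p * p ^ j ≠ 0 := f1.one_sub_ne j (by ring)
    have n5 : 1 - c * p ^ j ≠ 0 := f2.one_sub_ne j rfl
    have n6 : c * p ^ r - a * b ≠ 0 := by simpa using f3.sub_ne hp hab r 0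
    have n7 : p * p ^ r - 1 ≠ 0 := by rwa [← neg_sub, neg_ne_zero]
    have hl : f r j = f (r + 1) j * ((p * p ^ r - p ^ j) * (c * p ^ r - a * b) /
        ((p * p ^ r - 1) * (c * p ^ r - a * b * p ^ j))) := by
      have t2 : qPoch (p ^ r)⁻¹ p j =
          qPoch (p ^ (r + 1))⁻¹ p j * ((p * p ^ r - p ^ j) / (p * p ^ r - 1)) := by
        have h1 : 1 - (p ^ (r + 1))⁻¹ ≠ 0 := by
          rw [show 1 - (p ^ (r + 1))⁻¹ = (p * p ^ r - 1) * (p ^ (r + 1))⁻¹ by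
            rw [pow_succ']; field_simp]
          positivity
        rw [show (p ^ r)⁻¹ = p * (p ^ (r + 1))⁻¹ by rw [pow_succ']; field_simp,
          qPoch_mul_left_eq h1]
        congr 1
        rw [div_eq_div_iff h1 n7, pow_succ']
        field_simp
      have t3 : qPoch (a * b * p / (c * p ^ r)) p j =
          qPoch (a * b * p / (c * p ^ (r + 1))) p j *
            ((c * p ^ r - a * b * p ^ j) / (c * p ^ r - a * b)) := by
        have h1 : 1 - a * b * p / (c * p ^ (r + 1)) ≠ 0 := by
          rw [show 1 - a * b * p / (c * p ^ (r + 1)) = (c * p ^ r - a * b) * (c * p ^ r)⁻¹ by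
            rw [pow_succ']; field_simp]
          positivity
        rw [show a * b * p / (c * p ^ r) = p * (a * b * p / (c * p ^ (r + 1))) by
          rw [pow_succ']; field_simp, qPoch_mul_left_eq h1]
        congr 1
        rw [div_eq_div_iff h1 n6, pow_succ']
        field_simp
      simp only [hf]
      rw [t2, t3]
      generalize c * p ^ r - a * b * p ^ j = d3 at *
      generalize c * p ^ r - a * b = d6 at *
      field_simp
    have hr : f (r + 1) (j + 1) = f (r + 1) j * ((1 - a * p ^ j) * (1 - b * p ^ j) *
        (p * p ^ r - p ^ j) * c / ((1 - p * p ^ j) * (1 - c * p ^ j) *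
          (c * p ^ r - a * b * p ^ j))) := by
      simp only [hf, qPoch_succ]
      rw [show 1 - (p ^ (r + 1))⁻¹ * p ^ j = (p * p ^ r - p ^ j) * (p * p ^ r)⁻¹ by
          rw [pow_succ']; field_simp,
        show 1 - a * b * p / (c * p ^ (r + 1)) * p ^ j =
          (c * p ^ r - a * b * p ^ j) * (c * p ^ r)⁻¹ by rw [pow_succ']; field_simp, pow_succ p j]
      have e : (p * p ^ r)⁻¹ * (c * p ^ r) * p = c := by field_simp
      generalize (p * p ^ r)⁻¹ = u at *
      generalize c * p ^ r - a * b * p ^ j = d3 at *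
      generalize c * p ^ r = v at *
      rw [← e]
      simp only [div_eq_mul_inv, mul_inv, inv_inv]
      ring
    rw [hl, hr, pow_succ' p j]
    linear_combination f (r + 1) j *
      saalschuetz_certificate (c := c) ha hb hp hy0 n1 n2 n3 n4 n5 n6

/-- Without a very-well-poised factor the sum is a balanced ${}_3\phi_2$ with upper parameters
$Kp^r$, $A^2p/K^2$, $p^{-r}$ and lower parameter $c=Ap^{r+1}$. Two of these depend on $r$, so the
general sum is proved with them fixed and specialized afterwards. -/
theorem wpMatrix_sum_saalschuetz {A K p : ℂ} (h : WPGeneric A K p) (r N : ℕ) (hN : r < N) :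
    ∑ j ∈ Finset.range N, wpMatrix A K p r j *
        (qPoch (A ^ 2 * p / K ^ 2) p j / qPoch p p j * p ^ j) =
      qPoch (A * p / K) p r * qPoch (K ^ 2 / A * p ^ r) p r /
        (qPoch (A * p * p ^ r) p r * qPoch (K / A) p r) := by
  have hA := h.A_ne
  have hK := h.K_ne
  have hp := h.p_ne
  have hx : p ^ r ≠ 0 := pow_ne_zero _ hp
  have e : A * p * p ^ r / (K * p ^ r * (A ^ 2 * p / K ^ 2)) = K / A := by field_simp
  have key := sum_saalschuetz (a := K * p ^ r) (b := A ^ 2 * p / K ^ 2) (c := A * p * p ^ r)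
    (by positivity) (by positivity) (by positivity) hp h.p_free
    (fun l => by
      have := h.A_free (1 + r + l)
      rwa [zpow_add₀ hp, zpow_add₀ hp, zpow_one, zpow_natCast, ← mul_assoc, ← mul_assoc] at this)
    (by rw [e]; exact h.KA_free) r N hN
  rw [e, show A * p * p ^ r / (K * p ^ r) = A * p / K by field_simp,
    show A * p * p ^ r / (A ^ 2 * p / K ^ 2) = K ^ 2 / A * p ^ r by field_simp,
    show K * p ^ r * (A ^ 2 * p / K ^ 2) * p / (A * p * p ^ r * p ^ r) = A * p / (K * p ^ r) by
      field_simp] at key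
  rw [← key]
  refine Finset.sum_congr rfl fun j _ => ?_
  simp only [wpMatrix, div_eq_mul_inv, mul_inv]
  ring

/-! ### The quadratic base change: the first column -/

/-- The parameters of the quadratic base change are in general position. -/
structure BaseChangeGeneric (a k q : ℂ) : Prop where
  q_ne : q ≠ 0
  a_ne : a ≠ 0
  k_ne : k ≠ 0
  q_free : NotRootOfUnity q
  a_free : QFree a q
  neg_a_free : QFree (-a) q
  k_free : QFree k q
  neg_k_free : QFree (-k) q
  ak_free : QFree (a * k) q
  ka_free : QFree (k / a) q

theorem QFree.sq {c q : ℂ} (h : QFree c q) (h' : QFree (-c) q) : QFree (c ^ 2) (q ^ 2) := by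
  intro l hl
  have : (c * q ^ l) ^ 2 = 1 := by
    rw [mul_pow, ← hl, ← zpow_natCast, ← zpow_natCast, ← zpow_natCast, ← zpow_mul, ← zpow_mul,
      mul_comm l]
  rcases mul_self_eq_one_iff.1 ((pow_two _).symm.trans this) with h1 | h1
  · exact h l h1
  · exact h' l (by rw [neg_mul, h1, neg_neg])

theorem QFree.mul_zpow {c q : ℂ} (h : QFree c q) (hq : q ≠ 0) (m : ℤ) {e : ℂ}
    (he : e = c * q ^ m) : QFree e q := by
  intro l
  rw [he, mul_assoc, ← zpow_add₀ hq]
  exact h _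

theorem QFree.base_sq {c q : ℂ} (h : QFree c q) : QFree c (q ^ 2) := by
  intro l
  rw [← zpow_natCast, ← zpow_mul]
  exact h _

theorem NotRootOfUnity.sq {q : ℂ} (h : NotRootOfUnity q) : NotRootOfUnity (q ^ 2) := by
  intro l
  rw [← pow_mul, show 2 * (l + 1) = (2 * l + 1) + 1 by ring]
  exact h _

namespace BaseChangeGeneric

variable {a k q : ℂ} (h : BaseChangeGeneric a k q)
include h

theorem wpGeneric_source : WPGeneric (a ^ 2) (a * k / q) (q ^ 2) where
  p_ne := pow_ne_zero _ h.q_ne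
  A_ne := pow_ne_zero _ h.a_ne
  K_ne := div_ne_zero (mul_ne_zero h.a_ne h.k_ne) h.q_ne
  A_free := h.a_free.sq h.neg_a_free
  K_free := (h.ak_free.mul_zpow h.q_ne (-1) (by rw [zpow_neg_one]; rfl)).base_sq
  KA_free := (h.ka_free.mul_zpow h.q_ne (-1) (by
    have := h.a_ne
    rw [zpow_neg_one]; field_simp)).base_sq
  p_free := h.q_free.sq

theorem wpGeneric_target : WPGeneric (a * k / q) (k ^ 2) (q ^ 2) where
  p_ne := pow_ne_zero _ h.q_ne
  A_ne := div_ne_zero (mul_ne_zero h.a_ne h.k_ne) h.q_ne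
  K_ne := pow_ne_zero _ h.k_ne
  A_free := (h.ak_free.mul_zpow h.q_ne (-1) (by rw [zpow_neg_one]; rfl)).base_sq
  K_free := h.k_free.sq h.neg_k_free
  KA_free := (h.ka_free.mul_zpow h.q_ne 1 (by
    have := h.a_ne
    have := h.k_ne
    have := h.q_ne
    rw [zpow_one]; field_simp)).base_sq
  p_free := h.q_free.sq

end BaseChangeGeneric

theorem wpPrefactor_zero (a k q : ℂ) : wpPrefactor a k q 0 = 1 := by
  simp [wpPrefactor, qPochs, qPoch_zero]

theorem wpPrefactor_succ (a k q : ℂ) (n : ℕ) : wpPrefactor a k q (n + 1) =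
    wpPrefactor a k q n * ((1 - k / a * q ^ n) * (1 + q * q ^ n) *
      (1 - a * k * q * (q ^ n) ^ 2) / ((1 + k * q ^ n) * (1 - a * q * q ^ n) *
      (1 - k * q / a * (q ^ n) ^ 2))) := by
  simp only [wpPrefactor, qPochs, List.map_cons, List.map_nil, List.prod_cons, List.prod_nil,
    qPoch_succ, neg_mul, sub_neg_eq_add, ← pow_mul, mul_comm 2 n, div_eq_mul_inv, mul_inv]
  ring

/-- The weights of the quadratic base change. -/
noncomputable def baseChangeWeight (a k q : ℂ) (i : ℕ) : ℂ :=
  (1 - a * k / q * (q ^ 2) ^ (2 * i)) / (1 - a * k / q) *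
    (qPoch (a * k / q) (q ^ 2) i * qPoch (-a) (q ^ 2) i * qPoch (-(a * q)) (q ^ 2) i *
      qPoch (k / (a * q)) (q ^ 2) i / (qPoch (q ^ 2) (q ^ 2) i * qPoch (-(k * q)) (q ^ 2) i *
      qPoch (-k) (q ^ 2) i * qPoch (a ^ 2 * q ^ 2) (q ^ 2) i)) * (q ^ 2 * a / k) ^ i

noncomputable def baseChangeRatio (a k q y : ℂ) : ℂ :=
  (1 - a * k / q * (q ^ 2) ^ 2 * y ^ 2) / (1 - a * k / q * y ^ 2) *
    ((1 - a * k / q * y) * (1 + a * y) * (1 + a * q * y) * (1 - k / (a * q) * y) /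
    ((1 - q ^ 2 * y) * (1 + k * q * y) * (1 + k * y) * (1 - a ^ 2 * q ^ 2 * y))) *
    (q ^ 2 * a / k)

theorem baseChangeWeight_succ {a k q : ℂ} (h : QFree (a * k / q) (q ^ 2)) (i : ℕ) :
    baseChangeWeight a k q (i + 1) =
      baseChangeWeight a k q i * baseChangeRatio a k q ((q ^ 2) ^ i) := by
  rw [baseChangeWeight, baseChangeWeight, vwp_succ h]
  simp only [baseChangeRatio, qPoch_succ, neg_mul, sub_neg_eq_add, pow_succ _ i,
    div_eq_mul_inv, mul_inv]
  ring

/-- Coefficients of a three-term recurrence in $n$, with $x=q^{2n}$. The summand depends on $n$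
through $q^{2n}$ only, whereas the quotient of consecutive values of $P$ is a rational function of
$q^n$ that is not even. No first-order recurrence with coefficients rational in $q^{2n}$ can
therefore hold for generic parameters. -/
noncomputable def baseChangeCoeff₂ (a k q x : ℂ) : ℂ :=
  (1 - a ^ 2 * q ^ 4 * x) * (1 - k * q ^ 3 / a * x) * (1 - k ^ 2 * q ^ 2 * x) *
    (1 - k * q / a * x) * (1 - k * q * x)

noncomputable def baseChangeQuad (a k q x : ℂ) : ℂ :=
  1 - (k * q ^ 2 / a - k ^ 2 * q / a + k * q + k * q ^ 3 - a * q ^ 3 + a * k * q ^ 2) * x +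
    k ^ 2 * q ^ 4 * x ^ 2

noncomputable def baseChangeCoeff₁ (a k q x : ℂ) : ℂ :=
  -((1 + q) * (1 - a * k * q ^ 3 * x) * (1 - k * q / a * x) * (1 - k * q ^ 2 * x) *
    baseChangeQuad a k q x)

noncomputable def baseChangeCoeff₀ (a k q x : ℂ) : ℂ :=
  q * (1 - a * k * q ^ 3 * x) * (1 - k * q ^ 3 * x) * (1 - q ^ 2 * x) * (1 - a * k * q * x) *
    (1 - k ^ 2 / a ^ 2 * x)

noncomputable def baseChangeCert (a k q x y : ℂ) : ℂ :=
  -((1 - k * q ^ 3 / a * x) * (1 - k ^ 2 * q ^ 2 * x) * (1 - k * q / a * x) * (1 - k * q * x) *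
      (1 - k * q ^ 2 * x) * (1 - k * q ^ 3 * x) * (1 - a * q / k) / (1 - q ^ 4 * x)) *
    ((1 - y) * (1 - a ^ 2 * y) * (1 + k / q * y) * (1 + k / q ^ 2 * y) *
      (1 - a * k * q ^ 3 * x * y) * (k ^ 2 * q ^ 2 * x) /
      ((1 - a * k / q * y ^ 2) * (1 - k ^ 2 * x * y) * (1 - k ^ 2 * q ^ 2 * x * y) *
        (k ^ 2 * q ^ 2 * x - a * k / q * y)))

/-- The prefactor satisfies the same recurrence; the check is made in $X=q^n$, with $x=X^2$. -/
theorem wpPrefactor_recurrence {a k q X : ℂ} (ha : a ≠ 0)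
    (n1 : 1 + k * X ≠ 0) (n2 : 1 - a * q * X ≠ 0)
    (n3 : 1 - k * q / a * X ^ 2 ≠ 0) (n4 : 1 + k * (q * X) ≠ 0) (n5 : 1 - a * q * (q * X) ≠ 0)
    (n6 : 1 - k * q / a * (q * X) ^ 2 ≠ 0) :
    baseChangeCoeff₂ a k q (X ^ 2) * (((1 - k / a * X) * (1 + q * X) *
      (1 - a * k * q * X ^ 2) / ((1 + k * X) * (1 - a * q * X) * (1 - k * q / a * X ^ 2))) *
      ((1 - k / a * (q * X)) * (1 + q * (q * X)) *
      (1 - a * k * q * (q * X) ^ 2) / ((1 + k * (q * X)) * (1 - a * q * (q * X)) *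
        (1 - k * q / a * (q * X) ^ 2)))) +
    baseChangeCoeff₁ a k q (X ^ 2) * ((1 - k / a * X) * (1 + q * X) *
      (1 - a * k * q * X ^ 2) / ((1 + k * X) * (1 - a * q * X) * (1 - k * q / a * X ^ 2))) +
    baseChangeCoeff₀ a k q (X ^ 2) = 0 := by
  -- Factors even in $X$ split over $\pm X$, which exposes the denominators of the prefactor
  -- quotients.
  have h2 : baseChangeCoeff₂ a k q (X ^ 2) = (1 - a * q * (q * X)) * (1 + a * q ^ 2 * X) *
      (1 - k * q / a * (q * X) ^ 2) * ((1 - k * q * X) * (1 + k * (q * X))) *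
      (1 - k * q / a * X ^ 2) * (1 - k * q * X ^ 2) := by
    rw [baseChangeCoeff₂]
    ring
  rw [h2, baseChangeCoeff₁, baseChangeCoeff₀]
  generalize e4 : 1 + k * (q * X) = d4 at *
  generalize e5 : 1 - a * q * (q * X) = d5 at *
  generalize e6 : 1 - k * q / a * (q * X) ^ 2 = d6 at *
  generalize e1 : 1 + k * X = d1 at *
  generalize e2 : 1 - a * q * X = d2 at *
  generalize e3 : 1 - k * q / a * X ^ 2 = d3 at *
  rw [baseChangeQuad]
  field_simp
  rw [← e1, ← e2]
  field_simp
  ring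

set_option maxRecDepth 10000 in
set_option maxHeartbeats 4000000 in
theorem baseChange_certificate {a k q x y : ℂ} (ha : a ≠ 0) (hk : k ≠ 0) (hq : q ≠ 0) (hx : x ≠ 0)
    (n1 : 1 - k ^ 2 * x * y ≠ 0) (n2 : 1 - k ^ 2 * q ^ 2 * x * y ≠ 0)
    (n3 : 1 - q ^ 2 * x ≠ 0) (n4 : 1 - q ^ 4 * x ≠ 0)
    (n5 : k ^ 2 * x - a * k / q * y ≠ 0) (n6 : k ^ 2 * q ^ 2 * x - a * k / q * y ≠ 0)
    (n7 : 1 - a * k * q * x ≠ 0) (n8 : 1 - a * k * q ^ 3 * x ≠ 0)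
    (n9 : 1 - a * k / q * y ^ 2 ≠ 0) (n10 : 1 - a * k * q ^ 3 * y ^ 2 ≠ 0)
    (n11 : 1 - k ^ 2 * q ^ 4 * x * y ≠ 0) (n12 : 1 - a * k * q ^ 5 * x * y ≠ 0)
    (n13 : 1 - q ^ 2 * y ≠ 0) (n14 : 1 + k * q * y ≠ 0) (n15 : 1 + k * y ≠ 0)
    (n16 : 1 - a ^ 2 * q ^ 2 * y ≠ 0) :
    baseChangeCoeff₂ a k q x +
      baseChangeCoeff₁ a k q x * wpLeft (a * k / q) (k ^ 2) (q ^ 2) (q ^ 2 * x) y +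
      baseChangeCoeff₀ a k q x * (wpLeft (a * k / q) (k ^ 2) (q ^ 2) (q ^ 2 * x) y *
        wpLeft (a * k / q) (k ^ 2) (q ^ 2) x y) =
      baseChangeCert a k q x (q ^ 2 * y) *
        (wpRight (a * k / q) (k ^ 2) (q ^ 2) (q ^ 2 * (q ^ 2 * x)) y * baseChangeRatio a k q y) -
      baseChangeCert a k q x y := by
  -- All five terms share this factor: in the terms with row quotients it comes from the
  -- coefficients together with the numerators $1-Kx$ and $Kx-A$ of `wpLeft`. Dividing it out first
  -- leaves a much smaller identity.
  obtain ⟨U, hU⟩ : ∃ U, U = (1 - k * q ^ 3 / a * x) * (1 - k ^ 2 * q ^ 2 * x) *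
      (1 - k * q / a * x) := ⟨_, rfl⟩
  have h2 : baseChangeCoeff₂ a k q x = U * ((1 - a ^ 2 * q ^ 4 * x) * (1 - k * q * x)) := by
    rw [baseChangeCoeff₂, hU]; ring
  have h1 : baseChangeCoeff₁ a k q x * wpLeft (a * k / q) (k ^ 2) (q ^ 2) (q ^ 2 * x) y =
      U * -((1 + q) * (1 - k * q ^ 2 * x) * baseChangeQuad a k q x * (q ^ 4 * x - y) *
        (a * k / q) * (1 - a * k * q ^ 3 * x * y) /
        ((1 - k ^ 2 * q ^ 2 * x * y) * (1 - q ^ 4 * x) *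
          (k ^ 2 * q ^ 2 * x - a * k / q * y))) := by
    rw [baseChangeCoeff₁, wpLeft, hU,
      show k ^ 2 * (q ^ 2 * x) - a * k / q = -(a * k / q * (1 - k * q ^ 3 / a * x)) by
        field_simp; ring,
      show a * k / q * q ^ 2 * (q ^ 2 * x) = a * k * q ^ 3 * x by field_simp,
      show k ^ 2 * (q ^ 2 * x) = k ^ 2 * q ^ 2 * x by ring,
      show q ^ 2 * (q ^ 2 * x) - 1 = -(1 - q ^ 4 * x) by ring,
      show q ^ 2 * (q ^ 2 * x) = q ^ 4 * x by ring]
    generalize baseChangeQuad a k q x = Q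
    generalize 1 - k * q ^ 3 / a * x = u1
    generalize 1 - k * q / a * x = u2
    generalize 1 - k ^ 2 * q ^ 2 * x * y = d2 at *
    generalize 1 - q ^ 4 * x = d4 at *
    generalize k ^ 2 * q ^ 2 * x - a * k / q * y = d6 at *
    generalize 1 - a * k * q ^ 3 * x = d8 at *
    field_simp
  have h0 : baseChangeCoeff₀ a k q x * (wpLeft (a * k / q) (k ^ 2) (q ^ 2) (q ^ 2 * x) y *
        wpLeft (a * k / q) (k ^ 2) (q ^ 2) x y) =
      U * (q * (1 - k * q ^ 3 * x) * (1 - k ^ 2 / a ^ 2 * x) * (q ^ 4 * x - y) * (a * k / q) ^ 2 *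
        (1 - a * k * q ^ 3 * x * y) * (1 - k ^ 2 * x) * (q ^ 2 * x - y) *
        (1 - a * k * q * x * y) / ((1 - k ^ 2 * q ^ 2 * x * y) * (1 - q ^ 4 * x) *
          (k ^ 2 * q ^ 2 * x - a * k / q * y) * (1 - k ^ 2 * x * y) *
          (k ^ 2 * x - a * k / q * y))) := by
    clear h2 h1
    rw [baseChangeCoeff₀, wpLeft, wpLeft, hU,
      show k ^ 2 * (q ^ 2 * x) - a * k / q = -(a * k / q * (1 - k * q ^ 3 / a * x)) by
        field_simp; ring,
      show k ^ 2 * x - a * k / q = -(a * k / q * (1 - k * q / a * x)) by field_simp; ring,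
      show a * k / q * q ^ 2 * (q ^ 2 * x) = a * k * q ^ 3 * x by field_simp,
      show a * k / q * q ^ 2 * x = a * k * q * x by field_simp,
      show k ^ 2 * (q ^ 2 * x) = k ^ 2 * q ^ 2 * x by ring,
      show q ^ 2 * (q ^ 2 * x) - 1 = -(1 - q ^ 4 * x) by ring,
      show q ^ 2 * x - 1 = -(1 - q ^ 2 * x) by ring,
      show q ^ 2 * (q ^ 2 * x) = q ^ 4 * x by ring]
    clear hU
    generalize 1 - k * q ^ 3 / a * x = u1
    generalize 1 - k * q / a * x = u2
    generalize 1 - k ^ 2 / a ^ 2 * x = u3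
    generalize 1 - k * q ^ 3 * x = u4
    generalize 1 - k ^ 2 * q ^ 2 * x = u5
    generalize 1 - k ^ 2 * x = u6
    generalize 1 - a * k * q ^ 3 * x * y = u7
    generalize 1 - a * k * q * x * y = u8
    generalize q ^ 4 * x - y = u9
    generalize q ^ 2 * x - y = u10
    generalize 1 - k ^ 2 * x * y = d1 at *
    generalize 1 - k ^ 2 * q ^ 2 * x * y = d2 at *
    generalize 1 - q ^ 2 * x = d3 at *
    generalize 1 - q ^ 4 * x = d4 at *
    generalize k ^ 2 * x - a * k / q * y = d5 at *
    generalize k ^ 2 * q ^ 2 * x - a * k / q * y = d6 at *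
    generalize 1 - a * k * q * x = d7 at *
    generalize 1 - a * k * q ^ 3 * x = d8 at *
    field_simp
  have hR1 : baseChangeCert a k q x (q ^ 2 * y) *
        (wpRight (a * k / q) (k ^ 2) (q ^ 2) (q ^ 2 * (q ^ 2 * x)) y * baseChangeRatio a k q y) =
      U * -((1 - k * q * x) * (1 - k * q ^ 2 * x) * (1 - k * q ^ 3 * x) * (1 - a * q / k) /
        (1 - q ^ 4 * x) * (k ^ 3 * a * x * (q ^ 4 * x - y) * (1 - a * k / q * y) * (1 + a * y) *
        (1 + a * q * y) * (1 - k / (a * q) * y) / ((1 - k ^ 2 * q ^ 2 * x * y) *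
          (k ^ 2 * x - a * k / q * y) * (k ^ 2 * q ^ 2 * x - a * k / q * y) *
          (1 - a * k / q * y ^ 2)))) := by
    clear h2 h1 h0
    rw [baseChangeCert, wpRight, baseChangeRatio, hU,
      show k / q ^ 2 * (q ^ 2 * y) = k * y by field_simp,
      show k / q * (q ^ 2 * y) = k * q * y by field_simp,
      show a * k * q ^ 3 * x * (q ^ 2 * y) = a * k * q ^ 5 * x * y by ring,
      show a ^ 2 * (q ^ 2 * y) = a ^ 2 * q ^ 2 * y by ring,
      show a * k / q * (q ^ 2 * y) ^ 2 = a * k * q ^ 3 * y ^ 2 by field_simp,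
      show a * k / q * (q ^ 2) ^ 2 * y ^ 2 = a * k * q ^ 3 * y ^ 2 by field_simp,
      show k ^ 2 * x * (q ^ 2 * y) = k ^ 2 * q ^ 2 * x * y by ring,
      show k ^ 2 * q ^ 2 * x * (q ^ 2 * y) = k ^ 2 * q ^ 4 * x * y by ring,
      show k ^ 2 * (q ^ 2 * (q ^ 2 * x)) * y = k ^ 2 * q ^ 4 * x * y by ring,
      show a * k / q * q ^ 2 * (q ^ 2 * (q ^ 2 * x)) * y = a * k * q ^ 5 * x * y by field_simp,
      show k ^ 2 * (q ^ 2 * (q ^ 2 * x)) - a * k / q * q ^ 2 * y =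
        q ^ 2 * (k ^ 2 * q ^ 2 * x - a * k / q * y) by ring,
      show k ^ 2 * q ^ 2 * x - a * k / q * (q ^ 2 * y) =
        q ^ 2 * (k ^ 2 * x - a * k / q * y) by ring,
      show q ^ 2 * (q ^ 2 * x) = q ^ 4 * x by ring]
    clear hU
    generalize 1 - k * q ^ 3 / a * x = u1
    generalize 1 - k * q / a * x = u2
    generalize 1 - k / (a * q) * y = u3
    generalize 1 - a * q / k = u4
    generalize 1 - a * k / q * y = u5
    generalize 1 - k * q * x = u6
    generalize 1 - k * q ^ 2 * x = u7
    generalize 1 - k * q ^ 3 * x = u8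
    generalize 1 - k ^ 2 * q ^ 2 * x = u9
    generalize 1 + a * y = u10
    generalize 1 + a * q * y = u11
    generalize q ^ 4 * x - y = u12
    generalize 1 - k ^ 2 * q ^ 2 * x * y = d2 at *
    generalize 1 - q ^ 4 * x = d4 at *
    generalize k ^ 2 * x - a * k / q * y = d5 at *
    generalize k ^ 2 * q ^ 2 * x - a * k / q * y = d6 at *
    generalize 1 - a * k / q * y ^ 2 = d9 at *
    generalize 1 - a * k * q ^ 3 * y ^ 2 = d10 at *
    generalize 1 - k ^ 2 * q ^ 4 * x * y = d11 at *
    generalize 1 - a * k * q ^ 5 * x * y = d12 at *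
    generalize 1 - q ^ 2 * y = d13 at *
    generalize 1 + k * q * y = d14 at *
    generalize 1 + k * y = d15 at *
    generalize 1 - a ^ 2 * q ^ 2 * y = d16 at *
    field_simp
  have hR0 : baseChangeCert a k q x y = U * -((1 - k * q * x) * (1 - k * q ^ 2 * x) *
      (1 - k * q ^ 3 * x) * (1 - a * q / k) / (1 - q ^ 4 * x) *
      ((1 - y) * (1 - a ^ 2 * y) * (1 + k / q * y) * (1 + k / q ^ 2 * y) *
      (1 - a * k * q ^ 3 * x * y) * (k ^ 2 * q ^ 2 * x) /
      ((1 - a * k / q * y ^ 2) * (1 - k ^ 2 * x * y) * (1 - k ^ 2 * q ^ 2 * x * y) *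
        (k ^ 2 * q ^ 2 * x - a * k / q * y)))) := by
    rw [baseChangeCert, hU]
    generalize (1 - y) * (1 - a ^ 2 * y) * (1 + k / q * y) * (1 + k / q ^ 2 * y) *
      (1 - a * k * q ^ 3 * x * y) * (k ^ 2 * q ^ 2 * x) /
      ((1 - a * k / q * y ^ 2) * (1 - k ^ 2 * x * y) * (1 - k ^ 2 * q ^ 2 * x * y) *
        (k ^ 2 * q ^ 2 * x - a * k / q * y)) = V
    generalize 1 - k * q ^ 3 / a * x = u1
    generalize 1 - k * q / a * x = u2
    generalize 1 - a * q / k = u4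
    generalize 1 - k * q * x = u6
    generalize 1 - k * q ^ 2 * x = u7
    generalize 1 - k * q ^ 3 * x = u8
    generalize 1 - k ^ 2 * q ^ 2 * x = u9
    generalize 1 - q ^ 4 * x = d4
    ring
  rw [h2, h1, h0, hR1, hR0, ← mul_add, ← mul_add, ← mul_sub]
  congr 1
  rw [baseChangeQuad]
  generalize e1 : 1 - k ^ 2 * x * y = d1 at *
  generalize e2 : 1 - k ^ 2 * q ^ 2 * x * y = d2 at *
  generalize e4 : 1 - q ^ 4 * x = d4 at *
  generalize e5 : k ^ 2 * x - a * k / q * y = d5 at *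
  generalize e6 : k ^ 2 * q ^ 2 * x - a * k / q * y = d6 at *
  generalize e9 : 1 - a * k / q * y ^ 2 = d9 at *
  clear h2 h1 h0 hR1 hR0
  field_simp
  rw [← e1, ← e2, ← e4, ← e5, ← e6, ← e9]
  field_simp
  ring

/-- The column $j=0$ of the product formula, where the source matrix is identically one. It is an
${}_8W_7$ in base $q^2$ with argument $q^2a/k$. -/
theorem sum_baseChangeWeight {a k q : ℂ} (h : BaseChangeGeneric a k q) (n N : ℕ) (hN : n < N) :
    ∑ i ∈ Finset.range N, wpMatrix (a * k / q) (k ^ 2) (q ^ 2) n i * baseChangeWeight a k q i =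
      wpPrefactor a k q n := by
  have hq := h.q_ne
  have ha := h.a_ne
  have hk := h.k_ne
  have g := h.wpGeneric_target
  have hA := g.A_free.one_sub_ne 0 (e := a * k / q) (by simp)
  refine g.sum_of_certificate_two (b := wpPrefactor a k q)
    (ρ := fun j => baseChangeRatio a k q ((q ^ 2) ^ j))
    (c₂ := fun r => baseChangeCoeff₂ a k q ((q ^ 2) ^ r))
    (c₁ := fun r => baseChangeCoeff₁ a k q ((q ^ 2) ^ r))
    (c₀ := fun r => baseChangeCoeff₀ a k q ((q ^ 2) ^ r))
    (R := fun r j => baseChangeCert a k q ((q ^ 2) ^ r) ((q ^ 2) ^ j))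
    (by simp [baseChangeWeight, wpPrefactor_zero, qPoch_zero, div_self hA]) ?_
    (baseChangeWeight_succ g.A_free) (fun r => ?_) (fun r => ?_)
    (fun r => by simp [baseChangeCert]) (fun r j => ?_) n N hN
  · have e0 : baseChangeWeight a k q 0 = 1 := by
      simp [baseChangeWeight, qPoch_zero, div_self hA]
    rw [e0, wpPrefactor_succ, wpPrefactor_zero, baseChangeRatio, wpRight]
    have n1 := g.one_sub_A_ne 0 0 (pow_zero _) (pow_zero _) 2 (e := a * k / q * (q ^ 2) ^ 2)
      (by ring)
    have n2 := h.q_free.sq.one_sub_ne 0 (e := q ^ 2) (by ring)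
    have n3 := h.neg_k_free.one_sub_ne 0 (e := -k) (by ring)
    have n4 := h.neg_k_free.one_sub_ne 1 (e := -(k * q)) (by ring)
    have n5 := h.a_free.one_sub_ne 1 (e := a * q) (by ring)
    have n6 := h.neg_a_free.one_sub_ne 1 (e := -(a * q)) (by ring)
    have n7 := h.ka_free.one_sub_ne 1 (e := k * q / a) (by ring)
    rw [sub_neg_eq_add] at n3 n4 n6
    simp only [pow_zero, mul_one, one_mul, one_pow]
    rw [show 1 - a ^ 2 * q ^ 2 = (1 - a * q) * (1 + a * q) by ring,
      show k ^ 2 * q ^ 2 - a * k / q * q ^ 2 = -(a * k * q * (1 - k * q / a)) by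
        field_simp; ring,
      show a * k / q * q ^ 2 * q ^ 2 = a * k / q * (q ^ 2) ^ 2 by ring]
    generalize e1 : 1 - a * k / q * (q ^ 2) ^ 2 = d1 at *
    generalize e2 : 1 - q ^ 2 = d2 at *
    generalize e3 : 1 + k = d3 at *
    generalize e4 : 1 + k * q = d4 at *
    generalize e5 : 1 - a * q = d5 at *
    generalize e6 : 1 + a * q = d6 at *
    generalize e7 : 1 - k * q / a = d7 at *
    generalize e8 : 1 - a * k / q = d8 at *
    field_simp
    rw [← e2, ← e3, ← e4, ← e5, ← e7]
    field_simp
    ring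
  · have n1 := g.K_free.one_sub_ne (r + 1) (e := k ^ 2 * q ^ 2 * (q ^ 2) ^ r) (by ring)
    have n2 := h.wpGeneric_source.A_free.one_sub_ne (r + 2) (e := a ^ 2 * q ^ 4 * (q ^ 2) ^ r)
      (by ring)
    have n3 := h.ka_free.one_sub_ne (2 * r + 3) (e := k * q ^ 3 / a * (q ^ 2) ^ r) (by ring)
    have n4 := h.ka_free.one_sub_ne (2 * r + 1) (e := k * q / a * (q ^ 2) ^ r) (by ring)
    have n5 := h.k_free.one_sub_ne (2 * r + 1) (e := k * q * (q ^ 2) ^ r) (by ring)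
    rw [baseChangeCoeff₂]
    simp only [ne_eq, mul_eq_zero, not_or]
    exact ⟨⟨⟨⟨n2, n3⟩, n1⟩, n4⟩, n5⟩
  · rw [wpPrefactor_succ, wpPrefactor_succ, show (q ^ 2) ^ r = (q ^ r) ^ 2 by ring,
      pow_succ' q r]
    linear_combination wpPrefactor a k q r * wpPrefactor_recurrence (X := q ^ r) ha
      (sub_neg_eq_add (1 : ℂ) _ ▸ h.neg_k_free.one_sub_ne r (e := -(k * q ^ r)) (by ring))
      (h.a_free.one_sub_ne (r + 1) (by ring))
      (h.ka_free.one_sub_ne (2 * r + 1) (by ring))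
      (sub_neg_eq_add (1 : ℂ) _ ▸
        h.neg_k_free.one_sub_ne (r + 1) (e := -(k * (q * q ^ r))) (by ring))
      (h.a_free.one_sub_ne (r + 2) (by ring))
      (h.ka_free.one_sub_ne (2 * r + 3) (by ring))
  · simp only [pow_succ' (q ^ 2) r, pow_succ' (q ^ 2) (r + 1), pow_succ' (q ^ 2) j]
    generalize hx : (q ^ 2) ^ r = x
    generalize hy : (q ^ 2) ^ j = y
    exact baseChange_certificate ha hk hq (hx ▸ pow_ne_zero _ g.p_ne)
      (g.one_sub_K_ne r j hx hy 0 (by ring)) (g.one_sub_K_ne r j hx hy 1 (by ring))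
      (g.p_free.one_sub_ne r (by rw [← hx]; ring))
      (g.p_free.one_sub_ne (r + 1) (by rw [← hx]; ring))
      (g.sub_ne r j hx hy 0 (by ring)) (g.sub_ne r j hx hy 1 (by ring))
      (g.one_sub_A_ne r 0 hx (pow_zero _) 1 (by field_simp))
      (g.one_sub_A_ne r 0 hx (pow_zero _) 2 (by field_simp))
      (g.one_sub_A_ne j j hy hy 0 (by ring)) (g.one_sub_A_ne j j hy hy 2 (by field_simp))
      (g.one_sub_K_ne r j hx hy 2 (by ring)) (g.one_sub_A_ne r j hx hy 3 (by field_simp))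
      (g.p_free.one_sub_ne j (by rw [← hy]; ring))
      (sub_neg_eq_add (1 : ℂ) _ ▸
        h.neg_k_free.one_sub_ne (2 * j + 1) (e := -(k * q * y)) (by rw [← hy]; ring))
      (sub_neg_eq_add (1 : ℂ) _ ▸
        h.neg_k_free.one_sub_ne (2 * j) (e := -(k * y)) (by rw [← hy]; ring))
      (h.wpGeneric_source.one_sub_A_ne j 0 hy (pow_zero _) 1 (by ring))

/-! ### The quadratic base change: all columns -/

/-- The quotient `wpMatrix A K p (j + 1) (j + 1) / wpMatrix A K p j j`, where `x = p ^ j`. -/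
noncomputable def wpDiag (A K p x : ℂ) : ℂ :=
  (1 - K * p * x ^ 2) * (1 - K * x ^ 2) * (p * x - 1) * (1 - A * p * x) * K /
    (p * (1 - A * p ^ 2 * x ^ 2) * (1 - A * p * x ^ 2) * (1 - K * x) * (K * x - A))

namespace WPGeneric

variable {A K p : ℂ} (h : WPGeneric A K p)
include h

/-- Allows cancellation of the row quotient on and below the diagonal; above it the numerator
$p^{r+1}-p^j$ may vanish. -/
theorem wpLeft_ne_zero {r j : ℕ} (hj : j ≤ r) : wpLeft A K p (p ^ r) (p ^ j) ≠ 0 := by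
  have hp := h.p_ne
  have m1 := h.one_sub_K_ne r 0 rfl (pow_zero p) 0 (e := K * p ^ r) (by ring)
  have m2 : p * p ^ r - p ^ j ≠ 0 := by
    have := h.p_free.one_sub_ne (r - j) (e := p ^ (r - j + 1)) rfl
    rw [show p * p ^ r - p ^ j = -(p ^ j * (1 - p ^ (r - j + 1))) by
      rw [mul_sub, ← pow_add, ← pow_succ', show j + (r - j + 1) = r + 1 by omega]; ring]
    exact neg_ne_zero.2 (mul_ne_zero (pow_ne_zero _ hp) this)
  have m3 := h.sub_ne r 0 rfl (pow_zero p) 0 (e := K * p ^ r - A) (by ring)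
  have m4 := h.one_sub_A_ne r j rfl rfl 1 (e := A * p * p ^ r * p ^ j) (by ring)
  have m5 := h.one_sub_K_ne r j rfl rfl 0 (e := K * p ^ r * p ^ j) (by ring)
  have m6 : p * p ^ r - 1 ≠ 0 := by
    rw [← neg_sub, neg_ne_zero]; exact h.p_free.one_sub_ne r (by ring)
  have m7 := h.sub_ne r j rfl rfl 0 (e := K * p ^ r - A * p ^ j) (by ring)
  have m8 := h.one_sub_A_ne r 0 rfl (pow_zero p) 1 (e := A * p * p ^ r) (by ring)
  rw [wpLeft]
  positivity

theorem diag_succ (j : ℕ) :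
    wpMatrix A K p (j + 1) (j + 1) = wpMatrix A K p j j * wpDiag A K p (p ^ j) := by
  have hp := h.p_ne
  have hA := h.A_ne
  have hK := h.K_ne
  rw [h.succ_left j j, h.succ_right (j + 1) j, mul_assoc]
  congr 1
  rw [pow_succ' p j, wpLeft, wpRight, wpDiag]
  have m1 := h.one_sub_K_ne j 0 rfl (pow_zero p) 0 (e := K * p ^ j) (by ring)
  have m2 := h.p_free.one_sub_ne 0 (e := p) (by ring)
  have m3 := h.sub_ne j 0 rfl (pow_zero p) 0 (e := K * p ^ j - A) (by ring)
  have m4 := h.one_sub_A_ne j j rfl rfl 1 (e := A * p * (p ^ j) ^ 2) (by ring)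
  have m5 := h.one_sub_K_ne j j rfl rfl 0 (e := K * (p ^ j) ^ 2) (by ring)
  have m6 : p * p ^ j - 1 ≠ 0 := by
    rw [← neg_sub, neg_ne_zero]; exact h.p_free.one_sub_ne j (by ring)
  have m7 := h.sub_ne 0 0 (pow_zero p) (pow_zero p) 0 (e := K - A) (by ring)
  have m8 := h.one_sub_A_ne j 0 rfl (pow_zero p) 1 (e := A * p * p ^ j) (by ring)
  have m9 := h.one_sub_A_ne j j rfl rfl 2 (e := A * p ^ 2 * (p ^ j) ^ 2) (by ring)
  have hx : p ^ j ≠ 0 := pow_ne_zero _ hp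
  generalize p ^ j = x at *
  rw [show K * (p * x) - A * p * x = p * x * (K - A) by ring,
    show p * x - x = -(x * (1 - p)) by ring, show K * x - A * x = x * (K - A) by ring,
    show A * p * (p * x) * x = A * p ^ 2 * x ^ 2 by ring,
    show A * p * x * x = A * p * x ^ 2 by ring, show K * x * x = K * x ^ 2 by ring,
    show K * (p * x) * x = K * p * x ^ 2 by ring]
  generalize 1 - K * x = d1 at *
  generalize 1 - p = d2 at *
  generalize K * x - A = d3 at *
  generalize 1 - A * p * x ^ 2 = d4 at *
  generalize 1 - K * x ^ 2 = d5 at *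
  generalize p * x - 1 = d6 at *
  generalize K - A = d7 at *
  generalize 1 - A * p * x = d8 at *
  generalize 1 - A * p ^ 2 * x ^ 2 = d9 at *
  field_simp

end WPGeneric

namespace BaseChangeGeneric

variable {a k q : ℂ} (h : BaseChangeGeneric a k q)
include h

theorem wpGeneric_linear : WPGeneric a k q where
  p_ne := h.q_ne
  A_ne := h.a_ne
  K_ne := h.k_ne
  A_free := h.a_free
  K_free := h.k_free
  KA_free := h.ka_free
  p_free := h.q_free

theorem shift (j : ℕ) : BaseChangeGeneric (a * (q ^ 2) ^ j) (k * (q ^ 2) ^ j) q where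
  q_ne := h.q_ne
  a_ne := mul_ne_zero h.a_ne (pow_ne_zero _ (pow_ne_zero _ h.q_ne))
  k_ne := mul_ne_zero h.k_ne (pow_ne_zero _ (pow_ne_zero _ h.q_ne))
  q_free := h.q_free
  a_free := h.a_free.mul_zpow h.q_ne (2 * j : ℕ) (by rw [zpow_natCast]; ring)
  neg_a_free := h.neg_a_free.mul_zpow h.q_ne (2 * j : ℕ) (by rw [zpow_natCast]; ring)
  k_free := h.k_free.mul_zpow h.q_ne (2 * j : ℕ) (by rw [zpow_natCast]; ring)
  neg_k_free := h.neg_k_free.mul_zpow h.q_ne (2 * j : ℕ) (by rw [zpow_natCast]; ring)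
  ak_free := h.ak_free.mul_zpow h.q_ne (4 * j : ℕ) (by rw [zpow_natCast]; ring)
  ka_free := by
    rw [mul_div_mul_right _ _ (pow_ne_zero _ (pow_ne_zero _ h.q_ne))]
    exact h.ka_free

end BaseChangeGeneric

theorem wpRight_shift {a k q u x y : ℂ} (hu : u ≠ 0) :
    wpRight (a * k / q) (k ^ 2) (q ^ 2) (u * x) (u * y) =
      wpRight (a * u * (k * u) / q) ((k * u) ^ 2) (q ^ 2) x y := by
  rw [wpRight, wpRight,
    show k ^ 2 * (u * x) - a * k / q * q ^ 2 * (u * y) =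
      u * (k ^ 2 * x - a * k / q * q ^ 2 * y) by ring,
    show (k * u) ^ 2 * x - a * u * (k * u) / q * q ^ 2 * y =
      u ^ 2 * (k ^ 2 * x - a * k / q * q ^ 2 * y) by ring,
    show (1 - k ^ 2 * (u * x) * (u * y)) * (u * x - u * y) * k ^ 2 =
      u * ((1 - k ^ 2 * (u * x) * (u * y)) * (x - y) * k ^ 2) by ring,
    show (1 - (k * u) ^ 2 * x * y) * (x - y) * (k * u) ^ 2 =
      u ^ 2 * ((1 - k ^ 2 * (u * x) * (u * y)) * (x - y) * k ^ 2) by ring,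
    mul_assoc u, mul_assoc (u ^ 2), mul_div_mul_left _ _ hu,
    mul_div_mul_left _ _ (pow_ne_zero 2 hu)]
  congr 3
  ring

/-- With $u=q^{2j}$ and $y=q^{2i}$: the weight quotient at index $j+i$ is the one at index $i$ with
shifted parameters, up to the quotient of rows $j+i$ and $j+i+1$ of the source matrix in column $j$.
-/
theorem baseChangeRatio_shift {a k q u y : ℂ} (ha : a ≠ 0) (hk : k ≠ 0) (hq : q ≠ 0)
    (hu : u ≠ 0) (n1 : 1 - a * k / q * (u * y) ^ 2 ≠ 0) (n2 : 1 - q ^ 2 * (u * y) ≠ 0)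
    (n3 : 1 + k * q * (u * y) ≠ 0) (n4 : 1 + k * (u * y) ≠ 0)
    (n5 : 1 - a ^ 2 * q ^ 2 * (u * y) ≠ 0) (n6 : 1 - q ^ 2 * y ≠ 0)
    (n7 : 1 - a ^ 2 * q ^ 2 * (u * y) * u ≠ 0) (n8 : 1 - a * k / q * (u * y) * u ≠ 0)
    (n9 : a * k / q * (u * y) - a ^ 2 * u ≠ 0) :
    baseChangeRatio a k q (u * y) = baseChangeRatio (a * u) (k * u) q y *
      wpLeft (a ^ 2) (a * k / q) (q ^ 2) (u * y) u := by
  rw [baseChangeRatio, baseChangeRatio, wpLeft,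
    show a * u * (k * u) / q * (q ^ 2) ^ 2 * y ^ 2 = a * k / q * (q ^ 2) ^ 2 * (u * y) ^ 2 by ring,
    show a * u * (k * u) / q * y ^ 2 = a * k / q * (u * y) ^ 2 by ring,
    show a * u * (k * u) / q * y = a * k / q * (u * y) * u by ring,
    show a * u * y = a * (u * y) by ring, show a * u * q * y = a * q * (u * y) by ring,
    show k * u * q * y = k * q * (u * y) by ring, show k * u * y = k * (u * y) by ring,
    show (a * u) ^ 2 * q ^ 2 * y = a ^ 2 * q ^ 2 * (u * y) * u by ring,
    show q ^ 2 * (u * y) - u = -(u * (1 - q ^ 2 * y)) by ring,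
    show q ^ 2 * (u * y) - 1 = -(1 - q ^ 2 * (u * y)) by ring,
    show 1 - k * u / (a * u * q) * y = -(a * k / q * (u * y) - a ^ 2 * u) / (a ^ 2 * u) by
      field_simp; ring,
    show 1 - k / (a * q) * (u * y) = -(a * k / q * (u * y) - a ^ 2) / a ^ 2 by
      field_simp; ring]
  generalize 1 - a * k / q * (q ^ 2) ^ 2 * (u * y) ^ 2 = c1
  generalize 1 + a * (u * y) = c2
  generalize 1 + a * q * (u * y) = c3
  generalize a * k / q * (u * y) - a ^ 2 = c4
  generalize 1 - a * k / q * (u * y) ^ 2 = d1 at *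
  generalize 1 - q ^ 2 * (u * y) = d2 at *
  generalize 1 + k * q * (u * y) = d3 at *
  generalize 1 + k * (u * y) = d4 at *
  generalize 1 - a ^ 2 * q ^ 2 * (u * y) = d5 at *
  generalize 1 - q ^ 2 * y = d6 at *
  generalize 1 - a ^ 2 * q ^ 2 * (u * y) * u = d7 at *
  generalize 1 - a * k / q * (u * y) * u = d8 at *
  generalize a * k / q * (u * y) - a ^ 2 * u = d9 at *
  generalize 1 - a * k / q * (u * y) = c5
  field_simp

/-- The reduction to column zero. The part of column $j$ from the diagonal downwards is its first
term times the column-zero summand for $(aq^{2j},kq^{2j})$, because the quotients of consecutive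
terms agree. -/
theorem baseChange_row_shift {a k q : ℂ} (h : BaseChangeGeneric a k q) (j m i : ℕ) :
    wpMatrix (a * k / q) (k ^ 2) (q ^ 2) (j + m) (j + i) * baseChangeWeight a k q (j + i) *
        wpMatrix (a ^ 2) (a * k / q) (q ^ 2) (j + i) j =
      wpMatrix (a * k / q) (k ^ 2) (q ^ 2) (j + m) j * baseChangeWeight a k q j *
        wpMatrix (a ^ 2) (a * k / q) (q ^ 2) j j *
        (wpMatrix (a * (q ^ 2) ^ j * (k * (q ^ 2) ^ j) / q) ((k * (q ^ 2) ^ j) ^ 2) (q ^ 2) m i *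
          baseChangeWeight (a * (q ^ 2) ^ j) (k * (q ^ 2) ^ j) q i) := by
  have h' := h.shift j
  have g := h.wpGeneric_target
  have g' := h'.wpGeneric_target
  have gs := h.wpGeneric_source
  have hq := h.q_ne
  induction i with
  | zero =>
    have hA := g'.A_free.one_sub_ne 0 (by simp; rfl)
    simp [wpMatrix_zero_right, baseChangeWeight, qPoch_zero, div_self hA]
  | succ i ih =>
    have e1 : baseChangeRatio a k q ((q ^ 2) ^ (j + i)) =
        baseChangeRatio (a * (q ^ 2) ^ j) (k * (q ^ 2) ^ j) q ((q ^ 2) ^ i) *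
        wpLeft (a ^ 2) (a * k / q) (q ^ 2) ((q ^ 2) ^ (j + i)) ((q ^ 2) ^ j) := by
      rw [pow_add]
      exact baseChangeRatio_shift h.a_ne h.k_ne hq (pow_ne_zero _ g.p_ne)
        (g.one_sub_A_ne (j + i) (j + i) rfl rfl 0 (by ring))
        (g.p_free.one_sub_ne (j + i) (by ring))
        (sub_neg_eq_add (1 : ℂ) _ ▸ h.neg_k_free.one_sub_ne (2 * (j + i) + 1)
          (e := -(k * q * ((q ^ 2) ^ j * (q ^ 2) ^ i))) (by ring))
        (sub_neg_eq_add (1 : ℂ) _ ▸ h.neg_k_free.one_sub_ne (2 * (j + i))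
          (e := -(k * ((q ^ 2) ^ j * (q ^ 2) ^ i))) (by ring))
        (gs.one_sub_A_ne j i rfl rfl 1 (by ring))
        (g.p_free.one_sub_ne i (by ring))
        (gs.one_sub_A_ne (j + i) j rfl rfl 1 (by ring))
        (gs.one_sub_K_ne (j + i) j rfl rfl 0 (by ring))
        (gs.sub_ne (j + i) j rfl rfl 0 (by ring))
    have e2 : wpRight (a * k / q) (k ^ 2) (q ^ 2) ((q ^ 2) ^ (j + m)) ((q ^ 2) ^ (j + i)) =
        wpRight (a * (q ^ 2) ^ j * (k * (q ^ 2) ^ j) / q) ((k * (q ^ 2) ^ j) ^ 2) (q ^ 2)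
          ((q ^ 2) ^ m) ((q ^ 2) ^ i) := by
      rw [pow_add, pow_add]
      exact wpRight_shift (pow_ne_zero _ g.p_ne)
    rw [show j + (i + 1) = j + i + 1 by ring, g.succ_right, g'.succ_right,
      baseChangeWeight_succ g.A_free, baseChangeWeight_succ g'.A_free, e1, e2]
    -- This brings the induction hypothesis to source row $j+i+1$, the row occurring in the goal.
    rw [gs.succ_left] at ih
    linear_combination baseChangeRatio (a * (q ^ 2) ^ j) (k * (q ^ 2) ^ j) q ((q ^ 2) ^ i) *
      wpRight (a * (q ^ 2) ^ j * (k * (q ^ 2) ^ j) / q) ((k * (q ^ 2) ^ j) ^ 2) (q ^ 2)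
          ((q ^ 2) ^ m) ((q ^ 2) ^ i) * ih

/-- One step in $n$ of the comparison in `baseChange_column`, with $v=q^j$ and $X=q^m$: shifted and
unshifted prefactors differ exactly by the row quotients of the two matrices. -/
theorem wpPrefactor_shift_ratio {a k q v X : ℂ} (ha : a ≠ 0) (hk : k ≠ 0) (hq : q ≠ 0)
    (hv : v ≠ 0) (n1 : 1 + k * v ^ 2 * X ≠ 0) (n2 : 1 - a * v ^ 2 * q * X ≠ 0)
    (n3 : 1 - k * q / a * X ^ 2 ≠ 0) (n4 : 1 + k * (v * X) ≠ 0)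
    (n5 : 1 - a * q * (v * X) ≠ 0) (n6 : 1 - k * q / a * (v * X) ^ 2 ≠ 0)
    (n7 : 1 - k * (v * X) * v ≠ 0) (n8 : 1 - q * (v * X) ≠ 0) (n9 : 1 - k / a * X ≠ 0)
    (n10 : 1 + q * (v * X) ≠ 0) (n11 : 1 - a * k * q * (v * X) ^ 2 ≠ 0) :
    (1 - k * v ^ 2 / (a * v ^ 2) * X) * (1 + q * X) *
      (1 - a * v ^ 2 * (k * v ^ 2) * q * X ^ 2) / ((1 + k * v ^ 2 * X) *
      (1 - a * v ^ 2 * q * X) * (1 - k * v ^ 2 * q / (a * v ^ 2) * X ^ 2)) *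
      wpLeft a k q (v * X) v =
    (1 - k / a * (v * X)) * (1 + q * (v * X)) *
      (1 - a * k * q * (v * X) ^ 2) / ((1 + k * (v * X)) * (1 - a * q * (v * X)) *
      (1 - k * q / a * (v * X) ^ 2)) *
      wpLeft (a * k / q) (k ^ 2) (q ^ 2) ((v * X) ^ 2) (v ^ 2) := by
  rw [wpLeft, wpLeft,
    show k * v ^ 2 / (a * v ^ 2) * X = k / a * X by field_simp,
    show k * v ^ 2 * q / (a * v ^ 2) * X ^ 2 = k * q / a * X ^ 2 by field_simp,
    show k * (v * X) - a * v = -(a * v * (1 - k / a * X)) by field_simp; ring,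
    show k * (v * X) - a = -(a * (1 - k / a * (v * X))) by field_simp; ring,
    show k ^ 2 * (v * X) ^ 2 - a * k / q * v ^ 2 = -(a * k / q * v ^ 2 *
      (1 - k * q / a * X ^ 2)) by field_simp; ring,
    show k ^ 2 * (v * X) ^ 2 - a * k / q = -(a * k / q * (1 - k * q / a * (v * X) ^ 2)) by
      field_simp; ring,
    show q * (v * X) - v = -(v * (1 - q * X)) by ring,
    show q * (v * X) - 1 = -(1 - q * (v * X)) by ring,
    show q ^ 2 * (v * X) ^ 2 - v ^ 2 = -(v ^ 2 * (1 - q * X) * (1 + q * X)) by ring,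
    show q ^ 2 * (v * X) ^ 2 - 1 = -((1 - q * (v * X)) * (1 + q * (v * X))) by ring,
    show 1 - k ^ 2 * (v * X) ^ 2 = (1 - k * (v * X)) * (1 + k * (v * X)) by ring,
    show 1 - k ^ 2 * (v * X) ^ 2 * v ^ 2 =
      (1 - k * (v * X) * v) * (1 + k * v ^ 2 * X) by ring,
    show a * k / q * q ^ 2 * (v * X) ^ 2 = a * k * q * (v * X) ^ 2 by field_simp,
    show a * k * q * (v * X) ^ 2 * v ^ 2 = a * v ^ 2 * (k * v ^ 2) * q * X ^ 2 by ring,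
    show 1 - a * q * (v * X) * v = 1 - a * v ^ 2 * q * X by ring]
  generalize 1 + k * v ^ 2 * X = d1 at *
  generalize 1 - a * v ^ 2 * q * X = d2 at *
  generalize 1 - k * q / a * X ^ 2 = d3 at *
  generalize 1 + k * (v * X) = d4 at *
  generalize 1 - a * q * (v * X) = d5 at *
  generalize 1 - k * q / a * (v * X) ^ 2 = d6 at *
  generalize 1 - k * (v * X) * v = d7 at *
  generalize 1 - q * (v * X) = d8 at *
  generalize 1 - k / a * X = d9 at *
  generalize 1 + q * (v * X) = d10 at *
  generalize 1 - a * k * q * (v * X) ^ 2 = d11 at *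
  generalize 1 - k / a * (v * X) = c1
  generalize 1 - a * v ^ 2 * (k * v ^ 2) * q * X ^ 2 = c2
  generalize 1 + q * X = c3
  generalize 1 - q * X = c4
  generalize 1 - k * (v * X) = c5
  field_simp

theorem wpDiag_baseChange {a k q X : ℂ} (ha : a ≠ 0) (hk : k ≠ 0) (hq : q ≠ 0)
    (n1 : 1 - a * k / q * (X ^ 2) ^ 2 ≠ 0) (n2 : 1 + a * X ^ 2 ≠ 0) (n3 : 1 + a * q ^ 2 * X ^ 2 ≠ 0)
    (n4 : 1 - q * X ≠ 0) (n5 : 1 + q * X ≠ 0) (n6 : 1 + k * X ≠ 0) (n7 : 1 + k * q * X ^ 2 ≠ 0)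
    (n8 : 1 + k * X ^ 2 ≠ 0) (n9 : 1 - a * q * X ≠ 0) (n10 : 1 + a * q * X ≠ 0)
    (n11 : 1 - a * q ^ 2 * X ^ 2 ≠ 0) (n12 : 1 - a * q * X ^ 2 ≠ 0) (n13 : 1 + a * q * X ^ 2 ≠ 0)
    (n14 : 1 - a * k / q * X ^ 2 ≠ 0) (n15 : 1 - k * X ≠ 0) (n16 : 1 - k / a * X ≠ 0)
    (n17 : 1 - k * q / a * X ^ 2 ≠ 0) (n18 : 1 - a * k / q * (q ^ 2) ^ 2 * (X ^ 2) ^ 2 ≠ 0)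
    (n19 : 1 - a * k * q * X ^ 2 ≠ 0) (n20 : 1 - a * k * q * (X ^ 2) ^ 2 ≠ 0)
    (n21 : 1 - k / (a * q) * X ^ 2 ≠ 0) :
    wpDiag (a * k / q) (k ^ 2) (q ^ 2) (X ^ 2) * baseChangeRatio a k q (X ^ 2) *
      wpDiag (a ^ 2) (a * k / q) (q ^ 2) (X ^ 2) =
    (1 - k / a * X) * (1 + q * X) * (1 - a * k * q * X ^ 2) / ((1 + k * X) * (1 - a * q * X) *
      (1 - k * q / a * X ^ 2)) * wpDiag a k q X *
      ((1 + a * X ^ 2) / (1 + a * q ^ 2 * X ^ 2) * q⁻¹) := by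
  rw [wpDiag, wpDiag, wpDiag, baseChangeRatio,
    show k * X - a = -(a * (1 - k / a * X)) by field_simp; ring,
    show q * X - 1 = -(1 - q * X) by ring,
    show q ^ 2 * X ^ 2 - 1 = -((1 - q * X) * (1 + q * X)) by ring,
    show 1 - q ^ 2 * X ^ 2 = (1 - q * X) * (1 + q * X) by ring,
    show k ^ 2 * X ^ 2 - a * k / q = -(a * k / q * (1 - k * q / a * X ^ 2)) by
      field_simp; ring,
    show a * k / q * X ^ 2 - a ^ 2 = -(a ^ 2 * (1 - k / (a * q) * X ^ 2)) by field_simp; ring,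
    show 1 - k ^ 2 * X ^ 2 = (1 - k * X) * (1 + k * X) by ring,
    show 1 - k ^ 2 * (X ^ 2) ^ 2 = (1 - k * X ^ 2) * (1 + k * X ^ 2) by ring,
    show 1 - k ^ 2 * q ^ 2 * (X ^ 2) ^ 2 = (1 - k * q * X ^ 2) * (1 + k * q * X ^ 2) by ring,
    show 1 - a ^ 2 * q ^ 2 * X ^ 2 = (1 - a * q * X) * (1 + a * q * X) by ring,
    show 1 - a ^ 2 * (q ^ 2) ^ 2 * (X ^ 2) ^ 2 = (1 - a * q ^ 2 * X ^ 2) * (1 + a * q ^ 2 * X ^ 2) by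
      ring,
    show 1 - a ^ 2 * q ^ 2 * (X ^ 2) ^ 2 = (1 - a * q * X ^ 2) * (1 + a * q * X ^ 2) by ring,
    show a * k / q * q ^ 2 * X ^ 2 = a * k * q * X ^ 2 by field_simp,
    show a * k / q * q ^ 2 * (X ^ 2) ^ 2 = a * k * q * (X ^ 2) ^ 2 by field_simp]
  generalize 1 - a * k / q * (X ^ 2) ^ 2 = d1 at *
  generalize 1 + a * X ^ 2 = d2 at *
  generalize 1 + a * q ^ 2 * X ^ 2 = d3 at *
  generalize 1 - q * X = d4 at *
  generalize 1 + q * X = d5 at *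
  generalize 1 + k * X = d6 at *
  generalize 1 + k * q * X ^ 2 = d7 at *
  generalize 1 + k * X ^ 2 = d8 at *
  generalize 1 - a * q * X = d9 at *
  generalize 1 + a * q * X = d10 at *
  generalize 1 - a * q ^ 2 * X ^ 2 = d11 at *
  generalize 1 - a * q * X ^ 2 = d12 at *
  generalize 1 + a * q * X ^ 2 = d13 at *
  generalize 1 - a * k / q * X ^ 2 = d14 at *
  generalize 1 - k * X = d15 at *
  generalize 1 - k / a * X = d16 at *
  generalize 1 - k * q / a * X ^ 2 = d17 at *
  generalize 1 - a * k / q * (q ^ 2) ^ 2 * (X ^ 2) ^ 2 = d18 at *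
  generalize 1 - a * k * q * X ^ 2 = d19 at *
  generalize 1 - a * k * q * (X ^ 2) ^ 2 = d20 at *
  generalize 1 - k / (a * q) * X ^ 2 = d21 at *
  generalize 1 - k * X ^ 2 = c1
  generalize 1 - k * q * X ^ 2 = c2
  field_simp

theorem QFree.one_add_ne {c q e : ℂ} (h : QFree (-c) q) (n : ℕ) (he : e = c * q ^ n) :
    1 + e ≠ 0 := by
  rw [← sub_neg_eq_add]
  exact h.one_sub_ne n (by rw [he, neg_mul])

/-- The factor relating the rows of the linear and quadratic Bailey matrices. -/
noncomputable def baseChangeFactor (a q : ℂ) (j : ℕ) : ℂ :=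
  (1 + a) / (1 + a * q ^ (2 * j)) * (q ^ j)⁻¹

theorem NotRootOfUnity.one_add_ne {q : ℂ} (h : NotRootOfUnity q) (n : ℕ) : 1 + q ^ (n + 1) ≠ 0 := by
  intro h0
  have h1 := h.one_sub_ne (2 * n + 1) (e := q ^ (2 * n + 2)) (by ring)
  apply h1
  linear_combination (1 - q ^ (n + 1)) * h0

/-- When $n=j$ the product of triangular matrices has a single term, so the formula is a product
identity, proved by comparing consecutive diagonal entries. It is the base of the induction in
`baseChange_column`. -/
theorem baseChange_diag {a k q : ℂ} (h : BaseChangeGeneric a k q) (j : ℕ) :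
    wpMatrix (a * k / q) (k ^ 2) (q ^ 2) j j * baseChangeWeight a k q j *
        wpMatrix (a ^ 2) (a * k / q) (q ^ 2) j j =
      wpPrefactor a k q j * wpMatrix a k q j j * baseChangeFactor a q j := by
  have g := h.wpGeneric_target
  have gs := h.wpGeneric_source
  have gl := h.wpGeneric_linear
  have hq := h.q_ne
  have ha := h.a_ne
  have hk := h.k_ne
  induction j with
  | zero =>
    have hA := g.A_free.one_sub_ne 0 (e := a * k / q) (by simp)
    have h1 := h.neg_a_free.one_add_ne 0 (e := a) (by simp)
    simp [wpMatrix_zero_right, baseChangeWeight, baseChangeFactor, qPoch_zero, div_self hA,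
      div_self h1, wpPrefactor_zero]
  | succ j ih =>
    have hy : (q ^ 2) ^ j = (q ^ j) ^ 2 := by ring
    have hak : ∀ (n : ℕ) (e : ℂ), e = a * k / q * q ^ n → 1 - e ≠ 0 := fun n e he =>
      h.ak_free.mul_zpow (e := a * k / q) hq (-1) (by rw [zpow_neg_one]; rfl) |>.one_sub_ne n he
    have hka : ∀ (n : ℕ) (e : ℂ), e = k / (a * q) * q ^ n → 1 - e ≠ 0 := fun n e he =>
      h.ka_free.mul_zpow (e := k / (a * q)) hq (-1) (by rw [zpow_neg_one]; field_simp)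
        |>.one_sub_ne n he
    have key := wpDiag_baseChange (X := q ^ j) ha hk hq
      (hak (4 * j) _ (by ring)) (h.neg_a_free.one_add_ne (2 * j) (by ring))
      (h.neg_a_free.one_add_ne (2 * j + 2) (by ring)) (h.q_free.one_sub_ne j (by ring))
      (by rw [← pow_succ']; exact h.q_free.one_add_ne j) (h.neg_k_free.one_add_ne j (by ring))
      (h.neg_k_free.one_add_ne (2 * j + 1) (by ring)) (h.neg_k_free.one_add_ne (2 * j) (by ring))
      (h.a_free.one_sub_ne (j + 1) (by ring)) (h.neg_a_free.one_add_ne (j + 1) (by ring))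
      (h.a_free.one_sub_ne (2 * j + 2) (by ring)) (h.a_free.one_sub_ne (2 * j + 1) (by ring))
      (h.neg_a_free.one_add_ne (2 * j + 1) (by ring))
      (hak (2 * j) _ (by ring)) (h.k_free.one_sub_ne j (by ring)) (h.ka_free.one_sub_ne j (by ring))
      (h.ka_free.one_sub_ne (2 * j + 1) (by ring)) (hak (4 * j + 4) _ (by ring))
      (h.ak_free.one_sub_ne (2 * j + 1) (by ring)) (h.ak_free.one_sub_ne (4 * j + 1) (by ring))
      (hka (2 * j) _ (by ring))
    have h2 := h.neg_a_free.one_add_ne (2 * j) (e := a * (q ^ j) ^ 2) (by ring)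
    have h3 := h.neg_a_free.one_add_ne (2 * j + 2) (e := a * q ^ 2 * (q ^ j) ^ 2) (by ring)
    have e1 : baseChangeFactor a q (j + 1) = baseChangeFactor a q j *
        ((1 + a * (q ^ j) ^ 2) / (1 + a * q ^ 2 * (q ^ j) ^ 2) * q⁻¹) := by
      rw [baseChangeFactor, baseChangeFactor,
        show a * q ^ (2 * (j + 1)) = a * q ^ 2 * (q ^ j) ^ 2 by ring,
        show a * q ^ (2 * j) = a * (q ^ j) ^ 2 by ring, pow_succ q j, mul_inv]
      field_simp
    rw [g.diag_succ, gs.diag_succ, gl.diag_succ, baseChangeWeight_succ g.A_free, wpPrefactor_succ,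
      e1, hy]
    linear_combination (wpDiag (a * k / q) (k ^ 2) (q ^ 2) ((q ^ j) ^ 2) *
      baseChangeRatio a k q ((q ^ j) ^ 2) * wpDiag (a ^ 2) (a * k / q) (q ^ 2) ((q ^ j) ^ 2)) * ih +
      wpPrefactor a k q j * wpMatrix a k q j j * baseChangeFactor a q j * key

theorem baseChange_column {a k q : ℂ} (h : BaseChangeGeneric a k q) (j m : ℕ) :
    wpMatrix (a * k / q) (k ^ 2) (q ^ 2) (j + m) j * baseChangeWeight a k q j *
        wpMatrix (a ^ 2) (a * k / q) (q ^ 2) j j *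
        wpPrefactor (a * (q ^ 2) ^ j) (k * (q ^ 2) ^ j) q m =
      wpPrefactor a k q (j + m) * wpMatrix a k q (j + m) j * baseChangeFactor a q j := by
  have g := h.wpGeneric_target
  have gl := h.wpGeneric_linear
  have hq := h.q_ne
  have ha := h.a_ne
  have hk := h.k_ne
  induction m with
  | zero => rw [wpPrefactor_zero, mul_one, add_zero, baseChange_diag h]
  | succ m ih =>
    have key := wpPrefactor_shift_ratio (v := q ^ j) (X := q ^ m) ha hk hq (pow_ne_zero _ hq)
      (h.neg_k_free.one_add_ne (2 * j + m) (by ring)) (h.a_free.one_sub_ne (2 * j + 1 + m) (by ring))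
      (h.ka_free.one_sub_ne (2 * m + 1) (by ring)) (h.neg_k_free.one_add_ne (j + m) (by ring))
      (h.a_free.one_sub_ne (j + m + 1) (by ring))
      (h.ka_free.one_sub_ne (2 * (j + m) + 1) (by ring))
      (h.k_free.one_sub_ne (2 * j + m) (by ring)) (h.q_free.one_sub_ne (j + m) (by ring))
      (h.ka_free.one_sub_ne m (by ring))
      (by rw [← pow_add, ← pow_succ']; exact h.q_free.one_add_ne _)
      (h.ak_free.one_sub_ne (2 * (j + m) + 1) (by ring))
    have t1 := g.wpLeft_ne_zero (show j ≤ j + m by omega)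
    have t2 := gl.wpLeft_ne_zero (show j ≤ j + m by omega)
    have s1 := g.succ_left (j + m) j
    have s2 := gl.succ_left (j + m) j
    rw [s1, s2] at ih
    rw [show (q ^ 2) ^ (j + m) = (q ^ j * q ^ m) ^ 2 by ring,
      show (q ^ 2) ^ j = (q ^ j) ^ 2 by ring] at ih t1
    rw [pow_add] at t2 ih
    rw [show j + (m + 1) = j + m + 1 by ring, wpPrefactor_succ, wpPrefactor_succ,
      show (q ^ 2) ^ j = (q ^ j) ^ 2 by ring, pow_add q j m]
    -- Row quotients lead from later to earlier rows, so the induction step multiplies through by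
    -- both of them and cancels them at the end.
    refine mul_left_cancel₀ (mul_ne_zero t1 t2) ?_
    rw [mul_comm (wpPrefactor a k q (j + m))]
    generalize (1 - k * (q ^ j) ^ 2 / (a * (q ^ j) ^ 2) * q ^ m) * (1 + q * q ^ m) *
      (1 - a * (q ^ j) ^ 2 * (k * (q ^ j) ^ 2) * q * (q ^ m) ^ 2) / ((1 + k * (q ^ j) ^ 2 * q ^ m) *
      (1 - a * (q ^ j) ^ 2 * q * q ^ m) *
        (1 - k * (q ^ j) ^ 2 * q / (a * (q ^ j) ^ 2) * (q ^ m) ^ 2)) = ρ' at *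
    generalize (1 - k / a * (q ^ j * q ^ m)) * (1 + q * (q ^ j * q ^ m)) *
      (1 - a * k * q * (q ^ j * q ^ m) ^ 2) / ((1 + k * (q ^ j * q ^ m)) *
      (1 - a * q * (q ^ j * q ^ m)) *
      (1 - k * q / a * (q ^ j * q ^ m) ^ 2)) = ρ at *
    generalize wpLeft a k q (q ^ j * q ^ m) (q ^ j) = T2 at *
    generalize wpLeft (a * k / q) (k ^ 2) (q ^ 2) ((q ^ j * q ^ m) ^ 2) ((q ^ j) ^ 2) = T1 at *
    generalize wpMatrix (a * k / q) (k ^ 2) (q ^ 2) (j + m + 1) j = w1 at *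
    generalize wpMatrix a k q (j + m + 1) j = w2 at *
    generalize wpMatrix (a ^ 2) (a * k / q) (q ^ 2) j j = w3 at *
    linear_combination T2 * ρ' * ih + wpPrefactor a k q (j + m) * w2 * T2 *
      baseChangeFactor a q j * key

/-- The heart of the argument: with the weights in between, two base $q^2$ Bailey matrices multiply
to a base $q$ Bailey matrix, up to diagonal factors. -/
theorem sum_baseChange {a k q : ℂ} (h : BaseChangeGeneric a k q) (n j : ℕ) :
    ∑ r ∈ Finset.range (n + 1), wpMatrix (a * k / q) (k ^ 2) (q ^ 2) n r * baseChangeWeight a k q r *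
        wpMatrix (a ^ 2) (a * k / q) (q ^ 2) r j =
      wpPrefactor a k q n * wpMatrix a k q n j * baseChangeFactor a q j := by
  have g := h.wpGeneric_source
  rcases lt_or_ge n j with hj | hj
  · rw [wpMatrix_eq_zero h.q_ne hj, mul_zero, zero_mul]
    refine Finset.sum_eq_zero fun r hr => ?_
    rw [wpMatrix_eq_zero (r := r) (j := j) g.p_ne (by have := Finset.mem_range.1 hr; omega),
      mul_zero]
  · obtain ⟨m, rfl⟩ := Nat.exists_eq_add_of_le hj
    -- Rows $r<j$ of the source matrix vanish in column $j$, so the sum starts at the diagonal.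
    rw [add_assoc, Finset.sum_range_add, Finset.sum_eq_zero, zero_add]
    · simp only [baseChange_row_shift h j m]
      rw [← Finset.mul_sum, sum_baseChangeWeight (h.shift j) m (m + 1) (Nat.lt_succ_self m),
        baseChange_column h j m]
    · intro r hr
      rw [wpMatrix_eq_zero g.p_ne (Finset.mem_range.1 hr), mul_zero]

/-- The quadratic base change of well-poised Bailey pairs. -/
theorem baseChange_transform {a k q : ℂ} (h : BaseChangeGeneric a k q) {α b : ℕ → ℂ}
    (hb : ∀ r N, r < N →
      ∑ j ∈ Finset.range N, wpMatrix (a ^ 2) (a * k / q) (q ^ 2) r j * α j = b r) (n : ℕ) :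
    ∑ r ∈ Finset.range (n + 1),
        wpMatrix (a * k / q) (k ^ 2) (q ^ 2) n r * baseChangeWeight a k q r * b r =
      wpPrefactor a k q n * ∑ j ∈ Finset.range (n + 1),
        wpMatrix a k q n j * baseChangeFactor a q j * α j := by
  calc _ = ∑ r ∈ Finset.range (n + 1), ∑ j ∈ Finset.range (n + 1),
        wpMatrix (a * k / q) (k ^ 2) (q ^ 2) n r * baseChangeWeight a k q r *
          wpMatrix (a ^ 2) (a * k / q) (q ^ 2) r j * α j := by
        refine Finset.sum_congr rfl fun r hr => ?_
        rw [← hb r (n + 1) (Finset.mem_range.1 hr), Finset.mul_sum]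
        exact Finset.sum_congr rfl fun j _ => by ring
    _ = _ := by
        rw [Finset.sum_comm, Finset.mul_sum]
        refine Finset.sum_congr rfl fun j _ => ?_
        rw [← Finset.sum_mul, sum_baseChange h n j]
        ring

section

open Filter Topology

/-! ### Parameters in general position -/

/-- The numbers `u, v, x, y, q` are multiplicatively independent. -/
def MulIndep (u v x y q : ℂ) : Prop :=
  ∀ i j m n l : ℤ, u ^ i * v ^ j * x ^ m * y ^ n * q ^ l = 1 →
    i = 0 ∧ j = 0 ∧ m = 0 ∧ n = 0 ∧ l = 0

/-- The hypothesis compares squares so that a monomial and its negative are covered together; a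
relation for `e` then gives a multiplicative relation with doubled exponents. -/
theorem MulIndep.qFree {u v x y q : ℂ} (h : MulIndep u v x y q) (hq : q ≠ 0) {e : ℂ}
    (i j m n l : ℤ) (hne : ¬(i = 0 ∧ j = 0 ∧ m = 0 ∧ n = 0))
    (he : e ^ 2 = (u ^ i * v ^ j * x ^ m * y ^ n * q ^ l) ^ 2) : QFree e q := by
  intro t ht
  have h1 : (u ^ i * v ^ j * x ^ m * y ^ n * q ^ (l + t)) ^ 2 = 1 := by
    rw [zpow_add₀ hq, ← mul_assoc, mul_pow, ← he, ← mul_pow, ht, one_pow]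
  have h2 : u ^ (i * 2) * v ^ (j * 2) * x ^ (m * 2) * y ^ (n * 2) * q ^ ((l + t) * 2) = 1 := by
    simp only [zpow_mul, zpow_ofNat]
    rw [← h1]
    ring
  have h3 := h _ _ _ _ _ h2
  omega

theorem MulIndep.notRootOfUnity {u v x y q : ℂ} (h : MulIndep u v x y q) : NotRootOfUnity q := by
  intro l hl
  have := h 0 0 0 0 (l + 1 : ℕ) (by rw [zpow_natCast, hl]; simp)
  omega

/-- Powers of a transcendental number, here a Liouville number, are linearly independent over the
integers. -/
theorem exists_int_linearIndep (m : ℕ) :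
    ∃ c : Fin m → ℝ, ∀ e : Fin m → ℤ, ∑ i, (e i : ℝ) * c i = 0 → e = 0 := by
  have ht : Transcendental ℤ (liouvilleNumber (2 : ℕ)) :=
    transcendental_liouvilleNumber (m := 2) le_rfl
  refine ⟨fun i => liouvilleNumber (2 : ℕ) ^ (i : ℕ), fun e he => ?_⟩
  by_contra hne
  apply ht
  refine ⟨∑ i : Fin m, Polynomial.monomial (i : ℕ) (e i), fun h0 => hne ?_, ?_⟩
  · funext i
    have := congrArg (fun f => Polynomial.coeff f (i : ℕ)) h0
    simpa [Polynomial.finsetSum_coeff, Polynomial.coeff_monomial, Fin.val_inj] using this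
  · simpa [Polynomial.aeval_monomial] using he

/-- Any nonzero parameters are limits, along a curve, of multiplicatively independent ones. -/
theorem exists_path_mulIndep {u v x y q : ℂ} (hu : u ≠ 0) (hv : v ≠ 0) (hx : x ≠ 0) (hy : y ≠ 0)
    (hq : q ≠ 0) :
    ∃ u' v' x' y' q' : ℝ → ℂ,
      (Continuous u' ∧ u' 0 = u ∧ ∀ t, u' t ≠ 0) ∧ (Continuous v' ∧ v' 0 = v ∧ ∀ t, v' t ≠ 0) ∧
      (Continuous x' ∧ x' 0 = x ∧ ∀ t, x' t ≠ 0) ∧ (Continuous y' ∧ y' 0 = y ∧ ∀ t, y' t ≠ 0) ∧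
      (Continuous q' ∧ q' 0 = q ∧ ∀ t, q' t ≠ 0) ∧
      ∃ᶠ t in 𝓝 (0 : ℝ), MulIndep (u' t) (v' t) (x' t) (y' t) (q' t) := by
  obtain ⟨c, hc⟩ := exists_int_linearIndep 5
  have hpath : ∀ (w : ℂ) (_ : w ≠ 0) (i : Fin 5),
      Continuous (fun t : ℝ => w * Complex.exp ((c i * t : ℝ) : ℂ)) ∧
      w * Complex.exp ((c i * (0 : ℝ) : ℝ) : ℂ) = w ∧
      ∀ t : ℝ, w * Complex.exp ((c i * t : ℝ) : ℂ) ≠ 0 := fun w hw i =>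
    ⟨by fun_prop, by simp, fun t => mul_ne_zero hw (Complex.exp_ne_zero _)⟩
  refine ⟨_, _, _, _, _, hpath u hu 0, hpath v hv 1, hpath x hx 2, hpath y hy 3, hpath q hq 4, ?_⟩
  -- A multiplicative relation with exponents `e` forces its modulus to be one. Along the curve this
  -- modulus is a positive constant times $\exp(t\sum_i e_ic_i)$ with nonzero slope, so each `e`
  -- excludes at most one value of $t$.
  set bad : (Fin 5 → ℤ) → Set ℝ := fun e => {t | e ≠ 0 ∧
    ‖u ^ e 0 * v ^ e 1 * x ^ e 2 * y ^ e 3 * q ^ e 4‖ *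
      Real.exp ((∑ i, (e i : ℝ) * c i) * t) = 1} with hbad
  have hcount : (⋃ e, bad e).Countable := by
    refine Set.countable_iUnion fun e => Set.Subsingleton.countable ?_
    rintro s ⟨he, hs⟩ t ⟨-, ht⟩
    have hS : ∑ i, (e i : ℝ) * c i ≠ 0 := fun h0 => he (hc e h0)
    have hn : ‖u ^ e 0 * v ^ e 1 * x ^ e 2 * y ^ e 3 * q ^ e 4‖ ≠ 0 := by
      intro h0
      rw [h0, zero_mul] at hs
      exact zero_ne_one hs
    exact mul_left_cancel₀ hS (Real.exp_injective (mul_left_cancel₀ hn (hs.trans ht.symm)))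
  -- Countably many values are excluded in total; the good ones are dense and so occur frequently
  -- near $0$.
  have hdense := hcount.dense_compl ℝ
  refine (mem_closure_iff_frequently.1 (hdense 0)).mono fun t ht => ?_
  intro i j m n l h1
  by_contra hne
  apply ht
  refine Set.mem_iUnion.2 ⟨![i, j, m, n, l], ?_, ?_⟩
  · intro h0
    apply hne
    exact ⟨congrFun h0 0, congrFun h0 1, congrFun h0 2, congrFun h0 3, congrFun h0 4⟩
  · have h2 := congrArg norm h1
    simp only [norm_mul, norm_zpow, norm_one, Complex.norm_exp, mul_zpow, Complex.ofReal_re]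
      at h2
    have hexp : ∀ (i : ℤ) (a : ℝ), Real.exp (i * a) = Real.exp a ^ i := fun i a => by
      rw [← Real.rpow_intCast, ← Real.exp_mul, mul_comm]
    have h3 : (∑ s : Fin 5, ((![i, j, m, n, l] s : ℤ) : ℝ) * c s) * t =
        i * (c 0 * t) + j * (c 1 * t) + m * (c 2 * t) + n * (c 3 * t) + l * (c 4 * t) := by
      simp only [Fin.sum_univ_five, Matrix.cons_val]
      ring
    rw [h3]
    simp only [Real.exp_add, hexp, norm_mul, norm_zpow, Matrix.cons_val]
    rw [← h2]
    ring

/-! ### Continuity -/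

@[fun_prop]
theorem ContinuousAt.qPoch {x q : ℝ → ℂ} {t : ℝ} (hx : ContinuousAt x t) (hq : ContinuousAt q t)
    (n : ℕ) : ContinuousAt (fun s => qPoch (x s) (q s) n) t := by
  simp only [_root_.qPoch]
  fun_prop

theorem qPochs_cons (x : ℂ) (L : List ℂ) (q : ℂ) (n : ℕ) :
    qPochs (x :: L) q n = qPoch x q n * qPochs L q n := by
  simp [qPochs]

theorem qPochs_nil (q : ℂ) (n : ℕ) : qPochs [] q n = 1 := by
  simp [qPochs]

theorem qPochs_ne_zero_of_le {L : List ℂ} {q : ℂ} {m n : ℕ} (hmn : m ≤ n) (h : qPochs L q n ≠ 0) :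
    qPochs L q m ≠ 0 := by
  induction L with
  | nil => simp [qPochs_nil]
  | cons x L ih =>
    rw [qPochs_cons] at h ⊢
    exact mul_ne_zero (qPoch_ne_zero_of_le hmn (left_ne_zero_of_mul h))
      (ih (right_ne_zero_of_mul h))

theorem qPochs_eq_zero {L : List ℂ} {q x : ℂ} {n : ℕ} (hx : x ∈ L) (h : qPoch x q n = 0) :
    qPochs L q n = 0 :=
  List.prod_eq_zero (List.mem_map.2 ⟨x, hx, h⟩)

/-! ### Terminating series -/

/-- The terms of `wSeries`. -/
noncomputable def wTerm (a₁ : ℂ) (L : List ℂ) (q z : ℂ) (j : ℕ) : ℂ :=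
  (1 - a₁ * q ^ (2 * j)) / (1 - a₁) *
    (qPochs (a₁ :: L) q j / qPochs (q :: L.map (fun x => q * a₁ / x)) q j) * z ^ j

/-- Beyond index $N$ the numerator is zero, and zero over any denominator, even a vanishing one, is
zero. Hence neither convergence nor nonvanishing of later denominators is an issue. -/
theorem wSeries_eq_sum {a₁ x q z : ℂ} {L : List ℂ} {N : ℕ} (hx : x ∈ L) (h : x * q ^ N = 1) :
    wSeries a₁ L q z = ∑ j ∈ Finset.range (N + 1), wTerm a₁ L q z j := by
  refine tsum_eq_sum fun j hj => ?_
  rw [qPochs_eq_zero (List.mem_cons_of_mem _ hx)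
    (qPoch_eq_zero (by have := Finset.mem_range.not.1 hj; omega) h)]
  simp

/-- The terms of `phiSeries`. -/
noncomputable def phiTerm (as bs : List ℂ) (q z : ℂ) (j : ℕ) : ℂ :=
  qPochs as q j / qPochs (q :: bs) q j * z ^ j

theorem phiSeries_eq_sum {x q z : ℂ} {as bs : List ℂ} {N : ℕ} (hx : x ∈ as) (h : x * q ^ N = 1) :
    phiSeries as bs q z = ∑ j ∈ Finset.range (N + 1), phiTerm as bs q z j := by
  refine tsum_eq_sum fun j hj => ?_
  rw [qPochs_eq_zero hx (qPoch_eq_zero (by have := Finset.mem_range.not.1 hj; omega) h)]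
  simp

/-- Continuity is asked of the finite products, not of the lists of parameters, and denominators
need to be nonzero only at the limit point. -/
theorem continuousAt_sum_wTerm {a₁ q z : ℝ → ℂ} {L : ℝ → List ℂ} {N : ℕ} {t : ℝ}
    (ha : ContinuousAt a₁ t) (hq : ContinuousAt q t) (hz : ContinuousAt z t)
    (hnum : ∀ j, ContinuousAt (fun s => qPochs (a₁ s :: L s) (q s) j) t)
    (hden : ∀ j, ContinuousAt
      (fun s => qPochs (q s :: (L s).map (fun x => q s * a₁ s / x)) (q s) j) t)
    (h : WDenNeZero (a₁ t) (L t) (q t) N) :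
    ContinuousAt (fun s => ∑ j ∈ Finset.range (N + 1), wTerm (a₁ s) (L s) (q s) (z s) j) t := by
  refine tendsto_finsetSum _ fun j hj => ?_
  have hd := qPochs_ne_zero_of_le (Nat.lt_succ_iff.1 (Finset.mem_range.1 hj)) h.2
  have h1 : ContinuousAt (fun s => 1 - a₁ s * q s ^ (2 * j)) t := by fun_prop
  have h2 : ContinuousAt (fun s => 1 - a₁ s) t := by fun_prop
  have h3 := (hnum j).div (hden j) hd
  exact ((h1.div h2 h.1).mul h3).mul (hz.pow j)

theorem continuousAt_sum_phiTerm {q z : ℝ → ℂ} {as bs : ℝ → List ℂ} {N : ℕ} {t : ℝ}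
    (hz : ContinuousAt z t) (hnum : ∀ j, ContinuousAt (fun s => qPochs (as s) (q s) j) t)
    (hden : ∀ j, ContinuousAt (fun s => qPochs (q s :: bs s) (q s) j) t)
    (h : PhiDenNeZero (bs t) (q t) N) :
    ContinuousAt (fun s => ∑ j ∈ Finset.range (N + 1), phiTerm (as s) (bs s) (q s) (z s) j) t := by
  refine tendsto_finsetSum _ fun j hj => ?_
  have hd := qPochs_ne_zero_of_le (Nat.lt_succ_iff.1 (Finset.mem_range.1 hj)) h
  exact ((hnum j).div (hden j) hd).mul (hz.pow j)

theorem continuousAt_wpPrefactor {a k q : ℝ → ℂ} {n : ℕ} {t : ℝ} (ha : ContinuousAt a t)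
    (hk : ContinuousAt k t) (hq : ContinuousAt q t) (h0 : a t ≠ 0)
    (h1 : qPochs [-k t, a t * q t] (q t) n ≠ 0) (h2 : qPoch (k t * q t / a t) (q t ^ 2) n ≠ 0) :
    ContinuousAt (fun s => wpPrefactor (a s) (k s) (q s) n) t := by
  simp only [wpPrefactor]
  refine ContinuousAt.mul (ContinuousAt.div ?_ ?_ h1) (ContinuousAt.div (by fun_prop) ?_ h2)
  · simp only [qPochs_cons, qPochs_nil]
    fun_prop (disch := assumption)
  · simp only [qPochs_cons, qPochs_nil]
    fun_prop
  · fun_prop (disch := assumption)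

theorem eq_of_frequently_eq {f g : ℝ → ℂ} (h : ∃ᶠ t in 𝓝 (0 : ℝ), f t = g t)
    (hf : ContinuousAt f 0) (hg : ContinuousAt g 0) : f 0 = g 0 :=
  tendsto_nhds_unique_of_frequently_eq hf hg h

theorem ContinuousAt.qPochs_cons {x q : ℝ → ℂ} {L : ℝ → List ℂ} {n : ℕ} {t : ℝ}
    (hx : ContinuousAt x t) (hq : ContinuousAt q t)
    (hL : ContinuousAt (fun s => qPochs (L s) (q s) n) t) :
    ContinuousAt (fun s => qPochs (x s :: L s) (q s) n) t := by
  simp only [_root_.qPochs_cons]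
  exact (hx.qPoch hq n).mul hL

theorem continuousAt_qPochs_nil {q : ℝ → ℂ} {n : ℕ} {t : ℝ} :
    ContinuousAt (fun s => qPochs [] (q s) n) t := by
  simp only [qPochs_nil]
  exact continuousAt_const

/-! ### Terms of the series and the Bailey matrix -/

theorem qPochs_append (L M : List ℂ) (q : ℂ) (n : ℕ) :
    qPochs (L ++ M) q n = qPochs L q n * qPochs M q n := by
  simp [qPochs]

/-- The parameters $Kp^n$ and $p^{-n}$ with their well-poised partners are exactly the row $n$ of
the Bailey matrix. -/
theorem wTerm_append (A K p z : ℂ) (L : List ℂ) (n r : ℕ) :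
    wTerm A (L ++ [K * p ^ n, (p ^ n)⁻¹]) p z r = wpMatrix A K p n r *
      ((1 - A * p ^ (2 * r)) / (1 - A) *
        (qPochs (A :: L) p r / qPochs (p :: L.map (fun x => p * A / x)) p r) * z ^ r) := by
  rw [wTerm, List.map_append, ← List.cons_append, ← List.cons_append, qPochs_append,
    qPochs_append, wpMatrix]
  simp only [List.map_cons, List.map_nil, qPochs_cons, qPochs_nil, div_inv_eq_mul, mul_comm p A]
  simp only [div_eq_mul_inv, mul_inv]
  ring

theorem phiTerm_append (A K p z : ℂ) (L M : List ℂ) (n r : ℕ) :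
    phiTerm (L ++ [K * p ^ n, (p ^ n)⁻¹]) (M ++ [A * p * p ^ n, A * p / (K * p ^ n)]) p z r =
      wpMatrix A K p n r * (qPochs L p r / qPochs (p :: M) p r * z ^ r) := by
  rw [phiTerm, ← List.cons_append, qPochs_append, qPochs_append, wpMatrix]
  simp only [qPochs_cons, qPochs_nil, div_eq_mul_inv, mul_inv]
  ring

theorem qPochs_div_eq_wpMatrix {a k q : ℂ} (hq : q ≠ 0) (n j : ℕ) :
    qPochs [k * q ^ n, q ^ (-(n : ℤ))] q j / qPochs [a * q ^ (1 - n : ℤ) / k, a * q ^ (1 + n)] q j =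
      wpMatrix a k q n j := by
  rw [wpMatrix, zpow_neg, zpow_natCast, zpow_sub₀ hq, zpow_one, zpow_natCast, pow_add, pow_one,
    show a * (q / q ^ n) / k = a * q / (k * q ^ n) by field_simp]
  simp only [qPochs_cons, qPochs_nil, mul_one, mul_assoc]

theorem zpow_neg_two_mul (q : ℂ) (n : ℕ) : q ^ (-(2 * n : ℤ)) = ((q ^ 2) ^ n)⁻¹ := by
  rw [zpow_neg, ← pow_mul, ← zpow_natCast]
  norm_num

/-- The column factor cancels $1+aq^{2j}$ from the very-well-poised factor of $a^2$; the remaining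
$(1-aq^{2j})/(1-a)$ is $(aq^2;q^2)_j/(a;q^2)_j$. -/
theorem vwp_mul_baseChangeFactor {a k q : ℂ} (h : BaseChangeGeneric a k q) (j : ℕ) :
    baseChangeFactor a q j * ((1 - a ^ 2 * (q ^ 2) ^ (2 * j)) / (1 - a ^ 2)) =
      qPoch (a * q ^ 2) (q ^ 2) j / qPoch a (q ^ 2) j * (q ^ j)⁻¹ := by
  have h1 := h.a_free.one_sub_ne 0 (e := a) (by simp)
  have h2 := h.neg_a_free.one_add_ne 0 (e := a) (by simp)
  have h3 := h.neg_a_free.one_add_ne (2 * j) (e := a * q ^ (2 * j)) rfl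
  have h4 := h.a_free.base_sq.qPoch_ne_zero 0 (pow_ne_zero 2 h.q_ne) (e := a) (by simp) j
  have e1 : 1 - a ^ 2 * (q ^ 2) ^ (2 * j) = (1 - a * q ^ (2 * j)) * (1 + a * q ^ (2 * j)) := by
    ring
  have e2 : 1 - a ^ 2 = (1 - a) * (1 + a) := by ring
  rw [mul_comm a, qPoch_mul_left_eq h1, baseChangeFactor, e1, e2, ← pow_mul q 2 j]
  generalize 1 + a * q ^ (2 * j) = d1 at *
  field_simp

theorem MulIndep.baseChangeGeneric {a k x y q : ℂ} (h : MulIndep a k x y q) (ha : a ≠ 0)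
    (hk : k ≠ 0) (hq : q ≠ 0) : BaseChangeGeneric a k q where
  q_ne := hq
  a_ne := ha
  k_ne := hk
  q_free := h.notRootOfUnity
  a_free := h.qFree hq 1 0 0 0 0 (by decide) (by simp)
  neg_a_free := h.qFree hq 1 0 0 0 0 (by decide) (by simp)
  k_free := h.qFree hq 0 1 0 0 0 (by decide) (by simp)
  neg_k_free := h.qFree hq 0 1 0 0 0 (by decide) (by simp)
  ak_free := h.qFree hq 1 1 0 0 0 (by decide) (by simp)
  ka_free := h.qFree hq (-1) 1 0 0 0 (by decide) (by simp; field_simp)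

theorem baseChangeFactor_mul_vwp {a k q : ℂ} (h : BaseChangeGeneric a k q) (S : ℂ) (j : ℕ) :
    baseChangeFactor a q j * ((1 - a ^ 2 * (q ^ 2) ^ (2 * j)) / (1 - a ^ 2) * S * (q ^ 2) ^ j) =
      qPoch (a * q ^ 2) (q ^ 2) j / qPoch a (q ^ 2) j * S * q ^ j := by
  have hqj : q ^ j ≠ 0 := pow_ne_zero _ h.q_ne
  rw [mul_assoc (_ / _), ← mul_assoc (baseChangeFactor _ _ _), vwp_mul_baseChangeFactor h,
    show (q ^ 2) ^ j = q ^ j * q ^ j by ring, mul_assoc (_ / _), ← mul_assoc S,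
    mul_comm (S * _), inv_mul_cancel_left₀ hqj]
  ring

/-- Inserts $cc^{-1}$ by hand, so that an identity with cancelling nonzero factors can be closed by
`ring`, which treats the inverses as atoms. -/
theorem eq_of_mul_inv_cancel {c x y : ℂ} (hc : c ≠ 0) (h : x * (c * c⁻¹) = y) : x = y := by
  rw [← h, mul_inv_cancel₀ hc, mul_one]

/-! ### The transformation of Jackson's sum -/

theorem sum_wTerm_jackson_of_mulIndep {a k q ρ₁ ρ₂ : ℂ} (h : MulIndep a k ρ₁ ρ₂ q) (ha : a ≠ 0)
    (hk : k ≠ 0) (hq : q ≠ 0) (h1 : ρ₁ ≠ 0) (h2 : ρ₂ ≠ 0) (n : ℕ) :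
    ∑ j ∈ Finset.range (n + 1), wTerm (a * k / q)
        [-a, -(a * q), k * ρ₁ / (a * q), k * ρ₂ / (a * q), a ^ 2 * q ^ 2 / (ρ₁ * ρ₂),
          k ^ 2 * q ^ (2 * n), q ^ (-(2 * n : ℤ))] (q ^ 2) (q ^ 2 * a / k) j =
      wpPrefactor a k q n * ∑ j ∈ Finset.range (n + 1),
          qPochs [k * q ^ n, q ^ (-(n : ℤ))] q j
            / qPochs [a * q ^ (1 - n : ℤ) / k, a * q ^ (1 + n)] q j
          * (qPochs [a ^ 2, a * q ^ 2, ρ₁, ρ₂, a ^ 3 * q ^ 3 / (k * ρ₁ * ρ₂)] (q ^ 2) j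
            / qPochs [a, a ^ 2 * q ^ 2 / ρ₁, a ^ 2 * q ^ 2 / ρ₂, k * ρ₁ * ρ₂ / (a * q), q ^ 2]
                (q ^ 2) j)
          * q ^ j := by
  have g := h.baseChangeGeneric ha hk hq
  have f1 : QFree (a ^ 2 / ρ₁) (q ^ 2) :=
    (h.qFree hq 2 0 (-1) 0 0 (by decide) (by simp; field_simp)).base_sq
  have f2 : QFree (a ^ 2 / ρ₂) (q ^ 2) :=
    (h.qFree hq 2 0 0 (-1) 0 (by decide) (by simp; field_simp)).base_sq
  have f3 : QFree (a * k / q * ρ₁ * ρ₂ / a ^ 2) (q ^ 2) :=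
    (h.qFree hq (-1) 1 1 1 (-1) (by decide) (by simp; field_simp)).base_sq
  have key := baseChange_transform g
    (wpMatrix_sum_jackson g.wpGeneric_source h1 h2 f1 f2 f3) n
  convert key using 2 with r hr
  · rw [show [-a, -(a * q), k * ρ₁ / (a * q), k * ρ₂ / (a * q), a ^ 2 * q ^ 2 / (ρ₁ * ρ₂),
          k ^ 2 * q ^ (2 * n), q ^ (-(2 * n : ℤ))] =
        [-a, -(a * q), k * ρ₁ / (a * q), k * ρ₂ / (a * q), a ^ 2 * q ^ 2 / (ρ₁ * ρ₂)] ++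
          [k ^ 2 * (q ^ 2) ^ n, ((q ^ 2) ^ n)⁻¹] by
        rw [zpow_neg_two_mul, pow_mul]; rfl, wTerm_append, mul_assoc (wpMatrix _ _ _ _ _)]
    congr 1
    have m1 := g.wpGeneric_source.KA_free.qPoch_ne_zero 0 (pow_ne_zero 2 hq)
      (e := k / (a * q)) (by rw [zpow_zero]; field_simp) r
    have m2 := g.wpGeneric_source.A_free.qPoch_ne_zero 1 (pow_ne_zero 2 hq)
      (e := a ^ 2 * q ^ 2) (by rw [zpow_one]) r
    simp only [List.map_cons, List.map_nil, qPochs_cons, qPochs_nil, baseChangeWeight]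
    rw [show q ^ 2 * (a * k / q) / -a = -(k * q) by field_simp,
      show q ^ 2 * (a * k / q) / -(a * q) = -k by field_simp,
      show q ^ 2 * (a * k / q) / (k * ρ₁ / (a * q)) = a ^ 2 * q ^ 2 / ρ₁ by field_simp,
      show q ^ 2 * (a * k / q) / (k * ρ₂ / (a * q)) = a ^ 2 * q ^ 2 / ρ₂ by field_simp,
      show q ^ 2 * (a * k / q) / (a ^ 2 * q ^ 2 / (ρ₁ * ρ₂)) = k * ρ₁ * ρ₂ / (a * q) by
        field_simp,
      show a * k / q * ρ₁ / a ^ 2 = k * ρ₁ / (a * q) by field_simp,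
      show a * k / q * ρ₂ / a ^ 2 = k * ρ₂ / (a * q) by field_simp,
      show a * k / q * ρ₁ * ρ₂ / a ^ 2 = k * ρ₁ * ρ₂ / (a * q) by field_simp,
      show a * k / q / a ^ 2 = k / (a * q) by field_simp]
    -- The factors $(k/(aq);q^2)_r$ and $(a^2q^2;q^2)_r$ of the weight cancel against the closed
    -- form of Jackson's sum.
    refine eq_of_mul_inv_cancel (mul_ne_zero m1 m2) ?_
    simp only [div_eq_mul_inv, mul_inv]
    ring
  · refine Finset.sum_congr rfl fun j _ => ?_
    rw [qPochs_div_eq_wpMatrix hq, mul_assoc, mul_assoc (wpMatrix _ _ _ _ _)]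
    congr 1
    rw [baseChangeFactor_mul_vwp g,
      show a * k / q * ρ₁ * ρ₂ / a ^ 2 = k * ρ₁ * ρ₂ / (a * q) by field_simp,
      show (a ^ 2) ^ 2 * q ^ 2 / (a * k / q * ρ₁ * ρ₂) = a ^ 3 * q ^ 3 / (k * ρ₁ * ρ₂) by
        field_simp]
    simp only [qPochs_cons, qPochs_nil, div_eq_mul_inv, mul_inv]
    ring

theorem zpow_neg_two_mul_mul_pow {q : ℂ} (hq : q ≠ 0) (n : ℕ) :
    q ^ (-(2 * n : ℤ)) * (q ^ 2) ^ n = 1 := by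
  rw [zpow_neg_two_mul, inv_mul_cancel₀ (pow_ne_zero _ (pow_ne_zero _ hq))]

theorem wSeries_jackson {a k q : ℂ} (ha : a ≠ 0) (hk : k ≠ 0) (hq : q ≠ 0) (n : ℕ)
    (hpre₁ : qPochs [-k, a * q] q n ≠ 0) (hpre₂ : qPoch (k * q / a) (q ^ 2) n ≠ 0)
    {ρ₁ ρ₂ : ℂ} (h1 : ρ₁ ≠ 0) (h2 : ρ₂ ≠ 0)
    (hW : WDenNeZero (a * k / q)
        [-a, -(a * q), k * ρ₁ / (a * q), k * ρ₂ / (a * q), a ^ 2 * q ^ 2 / (ρ₁ * ρ₂),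
          k ^ 2 * q ^ (2 * n), q ^ (-(2 * n : ℤ))] (q ^ 2) n)
    (hC : qPochs [a * q ^ (1 - n : ℤ) / k, a * q ^ (1 + n)] q n ≠ 0)
    (hD : qPochs [a, a ^ 2 * q ^ 2 / ρ₁, a ^ 2 * q ^ 2 / ρ₂, k * ρ₁ * ρ₂ / (a * q), q ^ 2]
        (q ^ 2) n ≠ 0) :
    wSeries (a * k / q)
        [-a, -(a * q), k * ρ₁ / (a * q), k * ρ₂ / (a * q), a ^ 2 * q ^ 2 / (ρ₁ * ρ₂),
          k ^ 2 * q ^ (2 * n), q ^ (-(2 * n : ℤ))] (q ^ 2) (q ^ 2 * a / k)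
      = wpPrefactor a k q n * ∑ j ∈ Finset.range (n + 1),
          qPochs [k * q ^ n, q ^ (-(n : ℤ))] q j
            / qPochs [a * q ^ (1 - n : ℤ) / k, a * q ^ (1 + n)] q j
          * (qPochs [a ^ 2, a * q ^ 2, ρ₁, ρ₂, a ^ 3 * q ^ 3 / (k * ρ₁ * ρ₂)] (q ^ 2) j
            / qPochs [a, a ^ 2 * q ^ 2 / ρ₁, a ^ 2 * q ^ 2 / ρ₂, k * ρ₁ * ρ₂ / (a * q), q ^ 2]
                (q ^ 2) j)
          * q ^ j := by
  rw [wSeries_eq_sum (x := q ^ (-(2 * n : ℤ))) (N := n) (by simp) (zpow_neg_two_mul_mul_pow hq n)]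
  obtain ⟨a', k', x', y', q', ⟨ca, rfl, na⟩, ⟨ck, rfl, nk⟩, ⟨cx, rfl, nx⟩, ⟨cy, rfl, ny⟩,
    ⟨cq, rfl, nq⟩, hfreq⟩ := exists_path_mulIndep ha hk h1 h2 hq
  replace ca := ca.continuousAt (x := 0)
  replace ck := ck.continuousAt (x := 0)
  replace cx := cx.continuousAt (x := 0)
  replace cy := cy.continuousAt (x := 0)
  replace cq := cq.continuousAt (x := 0)
  -- The parameters move along the curve. The identity holds for $t$ arbitrarily close to $0$, and
  -- continuity of both sides at $0$ carries it to the given parameters.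
  refine eq_of_frequently_eq (hfreq.mono fun t ht =>
    sum_wTerm_jackson_of_mulIndep ht (na t) (nk t) (nq t) (nx t) (ny t) n) ?_ ?_
  · refine continuousAt_sum_wTerm ?_ ?_ ?_ (fun j => ?_) (fun j => ?_) hW <;>
    try simp only [List.map_cons, List.map_nil]
    all_goals repeat' with_reducible first
      | exact continuousAt_qPochs_nil
      | apply ContinuousAt.qPochs_cons
    all_goals fun_prop (disch := simp [ha, hk, hq, h1, h2, zpow_ne_zero _ hq])
  · refine (continuousAt_wpPrefactor ca ck cq ha hpre₁ hpre₂).mul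
      (tendsto_finsetSum _ fun j hj => ?_)
    have hj := Nat.lt_succ_iff.1 (Finset.mem_range.1 hj)
    refine ContinuousAt.mul (ContinuousAt.mul
      (ContinuousAt.div ?_ ?_ (qPochs_ne_zero_of_le hj hC))
      (ContinuousAt.div ?_ ?_ (qPochs_ne_zero_of_le hj hD))) (cq.pow j)
    all_goals repeat' with_reducible first
      | exact continuousAt_qPochs_nil
      | apply ContinuousAt.qPochs_cons
    all_goals fun_prop (disch := simp [ha, hk, hq, h1, h2])

/-! ### The transformations with a square root of `a k / q` -/

theorem MulIndep.baseChangeGeneric_sqrt {a k s x y q : ℂ} (h : MulIndep a s x y q) (ha : a ≠ 0)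
    (hk : k ≠ 0) (hq : q ≠ 0) (hs : s ^ 2 = a * k / q) : BaseChangeGeneric a k q := by
  have hk' : k = s ^ 2 * q / a := by rw [hs]; field_simp
  have hs0 : s ≠ 0 := by
    rintro rfl
    simp [hk] at hk'
  exact {
    q_ne := hq
    a_ne := ha
    k_ne := hk
    q_free := h.notRootOfUnity
    a_free := h.qFree hq 1 0 0 0 0 (by decide) (by simp)
    neg_a_free := h.qFree hq 1 0 0 0 0 (by decide) (by simp)
    k_free := h.qFree hq (-1) 2 0 0 1 (by decide) (by rw [hk']; simp; field_simp)
    neg_k_free := h.qFree hq (-1) 2 0 0 1 (by decide) (by rw [hk']; simp; field_simp)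
    ak_free := h.qFree hq 0 2 0 0 1 (by decide) (by rw [hk']; simp; field_simp)
    ka_free := h.qFree hq (-2) 2 0 0 1 (by decide) (by rw [hk']; simp; field_simp) }

/-- The $\phi$ series list $\pm q^2s$ over $\pm s$ explicitly, so the very-well-poised factor is
needed in this form. -/
theorem vwp_eq_qPoch_div {s p : ℂ} (f1 : QFree s p) (f2 : QFree (-s) p) (r : ℕ) :
    (1 - s ^ 2 * p ^ (2 * r)) / (1 - s ^ 2) =
      qPoch (p * s) p r / qPoch s p r * (qPoch (-(p * s)) p r / qPoch (-s) p r) := by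
  have n1 := f1.one_sub_ne 0 (e := s) (by simp)
  have n2 := f2.one_sub_ne 0 (e := -s) (by simp)
  have n3 : qPoch s p r ≠ 0 := by
    simp only [qPoch, Finset.prod_ne_zero_iff]
    exact fun i _ => f1.one_sub_ne i rfl
  have n4 : qPoch (-s) p r ≠ 0 := by
    simp only [qPoch, Finset.prod_ne_zero_iff]
    exact fun i _ => f2.one_sub_ne i rfl
  rw [← mul_neg, qPoch_mul_left_eq n1, qPoch_mul_left_eq n2, mul_div_cancel_left₀ _ n3,
    mul_div_cancel_left₀ _ n4, div_mul_div_comm]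
  congr 1 <;> ring

theorem sum_phiTerm_quad_of_mulIndep {a k q s x y : ℂ} (h : MulIndep a s x y q) (ha : a ≠ 0)
    (hk : k ≠ 0) (hq : q ≠ 0) (hs : s ^ 2 = a * k / q) (n : ℕ) :
    ∑ j ∈ Finset.range (n + 1), phiTerm
        [q ^ 2 * s, -(q ^ 2 * s), -a, -(a * q), k ^ 2 / (a ^ 2 * q ^ 4),
          k ^ 2 * q ^ (2 * n), q ^ (-(2 * n : ℤ))]
        [s, -s, -k, -(k * q), a * k * q ^ (2 * n + 1), a * q ^ (1 - 2 * n : ℤ) / k]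
        (q ^ 2) (q ^ 2 * a / k) j =
      wpPrefactor a k q n * ∑ j ∈ Finset.range (n + 1),
          qPochs [k * q ^ n, q ^ (-(n : ℤ))] q j
            / qPochs [a * q ^ (1 - n : ℤ) / k, a * q ^ (1 + n)] q j
          * (qPochs [a ^ 2, a * q ^ 2, k / (a * q ^ 3)] (q ^ 2) j
            / qPochs [a, a ^ 3 * q ^ 5 / k, q ^ 2] (q ^ 2) j)
          * (qPochs [q ^ 3 * a ^ 3 / k, q ^ 5 * a ^ 3 / k] (q ^ 4) j
            / qPochs [a * k / q, a * k * q] (q ^ 4) j)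
          * q ^ j := by
  have g := h.baseChangeGeneric_sqrt ha hk hq hs
  have hk' : k = s ^ 2 * q / a := by rw [hs]; field_simp
  have hs0 : s ≠ 0 := by
    rintro rfl
    simp [hk] at hk'
  have f1 : QFree s (q ^ 2) := (h.qFree hq 0 1 0 0 0 (by decide) (by simp)).base_sq
  have f4 : QFree (-s) (q ^ 2) := (h.qFree hq 0 1 0 0 0 (by decide) (by simp)).base_sq
  have f2 : QFree ((a ^ 2) ^ 2 / (a * k / q)) (q ^ 2) :=
    (h.qFree hq 4 (-2) 0 0 0 (by decide) (by rw [hk']; simp; field_simp)).base_sq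
  have f3 : QFree ((a * k / q) ^ 2 / (a ^ 2) ^ 2) (q ^ 2) :=
    (h.qFree hq (-4) 4 0 0 0 (by decide) (by rw [hk']; simp; field_simp)).base_sq
  have key := baseChange_transform g (wpMatrix_sum_quad g.wpGeneric_source f2 f3) n
  convert key using 2 with r hr
  · rw [show [q ^ 2 * s, -(q ^ 2 * s), -a, -(a * q), k ^ 2 / (a ^ 2 * q ^ 4),
          k ^ 2 * q ^ (2 * n), q ^ (-(2 * n : ℤ))] =
        [q ^ 2 * s, -(q ^ 2 * s), -a, -(a * q), k ^ 2 / (a ^ 2 * q ^ 4)] ++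
          [k ^ 2 * (q ^ 2) ^ n, ((q ^ 2) ^ n)⁻¹] by
        rw [zpow_neg_two_mul, pow_mul]; rfl,
      show [s, -s, -k, -(k * q), a * k * q ^ (2 * n + 1), a * q ^ (1 - 2 * n : ℤ) / k] =
        [s, -s, -k, -(k * q)] ++ [a * k / q * q ^ 2 * (q ^ 2) ^ n,
          a * k / q * q ^ 2 / (k ^ 2 * (q ^ 2) ^ n)] by
        have e : a * q ^ (1 - 2 * n : ℤ) / k = a * k / q * q ^ 2 / (k ^ 2 * (q ^ 2) ^ n) := by
          rw [sub_eq_add_neg, zpow_add₀ hq, zpow_one, zpow_neg_two_mul]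
          field_simp
        rw [e, show a * k * q ^ (2 * n + 1) = a * k / q * q ^ 2 * (q ^ 2) ^ n by
          rw [← pow_mul, pow_succ]; field_simp]
        rfl,
      phiTerm_append, mul_assoc (wpMatrix _ _ _ _ _)]
    congr 1
    have m1 := g.wpGeneric_source.KA_free.qPoch_ne_zero 0 (pow_ne_zero 2 hq)
      (e := k / (a * q)) (by rw [zpow_zero]; field_simp) r
    have m2 := g.wpGeneric_source.A_free.qPoch_ne_zero 1 (pow_ne_zero 2 hq)
      (e := a ^ 2 * q ^ 2) (by rw [zpow_one]) r
    have m3 := g.wpGeneric_source.K_free.qPoch_ne_zero 0 (pow_ne_zero 2 hq)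
      (e := a * k / q) (by rw [zpow_zero, mul_one]) r
    have e1 := vwp_eq_qPoch_div f1 f4 r
    rw [hs] at e1
    simp only [qPochs_cons, qPochs_nil, baseChangeWeight]
    rw [e1, show (a * k / q) ^ 2 / ((a ^ 2) ^ 2 * q ^ 2) = k ^ 2 / (a ^ 2 * q ^ 4) by field_simp,
      show a * k / q / a ^ 2 = k / (a * q) by field_simp]
    refine eq_of_mul_inv_cancel (mul_ne_zero (mul_ne_zero m1 m2) m3) ?_
    simp only [div_eq_mul_inv, mul_inv]
    ring
  · refine Finset.sum_congr rfl fun j _ => ?_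
    rw [qPochs_div_eq_wpMatrix hq, mul_assoc, mul_assoc, mul_assoc (wpMatrix _ _ _ _ _)]
    congr 1
    rw [baseChangeFactor_mul_vwp g,
      show a * k / q / (a ^ 2 * q ^ 2) = k / (a * q ^ 3) by field_simp,
      show (a ^ 2) ^ 2 * q ^ 2 / (a * k / q) = q ^ 3 * a ^ 3 / k by field_simp,
      show (a ^ 2) ^ 2 * (q ^ 2) ^ 2 / (a * k / q) = q ^ 5 * a ^ 3 / k by field_simp,
      show a * k / q * q ^ 2 = a * k * q by field_simp,
      show (q ^ 2) ^ 2 = q ^ 4 by ring, mul_comm (q ^ 5)]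
    simp only [qPochs_cons, qPochs_nil, div_eq_mul_inv, mul_inv]
    ring

theorem phiSeries_quad {a k q s : ℂ} (ha : a ≠ 0) (hk : k ≠ 0) (hq : q ≠ 0) (n : ℕ)
    (hpre₁ : qPochs [-k, a * q] q n ≠ 0) (hpre₂ : qPoch (k * q / a) (q ^ 2) n ≠ 0)
    (hs : s ^ 2 = a * k / q)
    (hP : PhiDenNeZero
        [s, -s, -k, -(k * q), a * k * q ^ (2 * n + 1), a * q ^ (1 - 2 * n : ℤ) / k] (q ^ 2) n)
    (hC : qPochs [a * q ^ (1 - n : ℤ) / k, a * q ^ (1 + n)] q n ≠ 0)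
    (hD : qPochs [a, a ^ 3 * q ^ 5 / k, q ^ 2] (q ^ 2) n ≠ 0)
    (hE : qPochs [a * k / q, a * k * q] (q ^ 4) n ≠ 0) :
    phiSeries
        [q ^ 2 * s, -(q ^ 2 * s), -a, -(a * q), k ^ 2 / (a ^ 2 * q ^ 4),
          k ^ 2 * q ^ (2 * n), q ^ (-(2 * n : ℤ))]
        [s, -s, -k, -(k * q), a * k * q ^ (2 * n + 1), a * q ^ (1 - 2 * n : ℤ) / k]
        (q ^ 2) (q ^ 2 * a / k)
      = wpPrefactor a k q n * ∑ j ∈ Finset.range (n + 1),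
          qPochs [k * q ^ n, q ^ (-(n : ℤ))] q j
            / qPochs [a * q ^ (1 - n : ℤ) / k, a * q ^ (1 + n)] q j
          * (qPochs [a ^ 2, a * q ^ 2, k / (a * q ^ 3)] (q ^ 2) j
            / qPochs [a, a ^ 3 * q ^ 5 / k, q ^ 2] (q ^ 2) j)
          * (qPochs [q ^ 3 * a ^ 3 / k, q ^ 5 * a ^ 3 / k] (q ^ 4) j
            / qPochs [a * k / q, a * k * q] (q ^ 4) j)
          * q ^ j := by
  rw [phiSeries_eq_sum (x := q ^ (-(2 * n : ℤ))) (N := n) (by simp)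
    (zpow_neg_two_mul_mul_pow hq n)]
  have hs0 : s ≠ 0 := by
    rintro rfl
    rw [zero_pow two_ne_zero] at hs
    exact div_ne_zero (mul_ne_zero ha hk) hq hs.symm
  -- The free parameters are $a,s,q$: with $k$ expressed through $s$, the chosen square root moves
  -- continuously along the curve.
  obtain rfl : k = s ^ 2 * q / a := by rw [hs]; field_simp
  obtain ⟨a', s', x', y', q', ⟨ca, rfl, na⟩, ⟨cs, rfl, ns⟩, -, -, ⟨cq, rfl, nq⟩, hfreq⟩ :=
    exists_path_mulIndep ha hs0 one_ne_zero one_ne_zero hq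
  replace ca := ca.continuousAt (x := 0)
  replace cs := cs.continuousAt (x := 0)
  replace cq := cq.continuousAt (x := 0)
  have nk : ∀ t, s' t ^ 2 * q' t / a' t ≠ 0 := fun t =>
    div_ne_zero (mul_ne_zero (pow_ne_zero _ (ns t)) (nq t)) (na t)
  have ck : ContinuousAt (fun t => s' t ^ 2 * q' t / a' t) 0 := by
    fun_prop (disch := assumption)
  refine eq_of_frequently_eq (hfreq.mono fun t ht => by
    have := na t
    have := nq t
    exact sum_phiTerm_quad_of_mulIndep (k := s' t ^ 2 * q' t / a' t) ht (na t) (nk t) (nq t)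
      (by field_simp) n) ?_ ?_
  · refine continuousAt_sum_phiTerm ?_ (fun j => ?_) (fun j => ?_) hP
    all_goals repeat' with_reducible first
      | exact continuousAt_qPochs_nil
      | apply ContinuousAt.qPochs_cons
    all_goals fun_prop (disch := simp [ha, hq])
  · refine (continuousAt_wpPrefactor ca ck cq ha hpre₁ hpre₂).mul
      (tendsto_finsetSum _ fun j hj => ?_)
    have hj := Nat.lt_succ_iff.1 (Finset.mem_range.1 hj)
    refine ContinuousAt.mul (ContinuousAt.mul (ContinuousAt.mul
      (ContinuousAt.div ?_ ?_ (qPochs_ne_zero_of_le hj hC))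
      (ContinuousAt.div ?_ ?_ (qPochs_ne_zero_of_le hj hD)))
      (ContinuousAt.div ?_ ?_ (qPochs_ne_zero_of_le hj hE))) (cq.pow j)
    all_goals repeat' with_reducible first
      | exact continuousAt_qPochs_nil
      | apply ContinuousAt.qPochs_cons
    all_goals fun_prop (disch := simp [ha, hq])

theorem sum_phiTerm_sqrt_of_mulIndep {a k q s t x y : ℂ} (h : MulIndep a s x y q) (ha : a ≠ 0)
    (hk : k ≠ 0) (hq : q ≠ 0) (hs : s ^ 2 = a * k / q) (ht : s * t = a ^ 2) (n : ℕ) :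
    ∑ j ∈ Finset.range (n + 1), phiTerm
        [-(q ^ 2 * s), -a, -(a * q), k ^ 2 / (a ^ 2 * q ^ 2),
          k ^ 2 * q ^ (2 * n), q ^ (-(2 * n : ℤ))]
        [-s, -k, -(k * q), a * k * q ^ (2 * n + 1), a * q ^ (1 - 2 * n : ℤ) / k]
        (q ^ 2) (q ^ 2 * a / k) j =
      wpPrefactor a k q n * ∑ j ∈ Finset.range (n + 1),
          qPochs [k * q ^ n, q ^ (-(n : ℤ))] q j
            / qPochs [a * q ^ (1 - n : ℤ) / k, a * q ^ (1 + n)] q j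
          * (qPochs [a ^ 2, a * q ^ 2, k / (a * q), t, -(q ^ 2 * t)] (q ^ 2) j
            / qPochs [a, a ^ 3 * q ^ 3 / k, q ^ 2 * s, -s, q ^ 2] (q ^ 2) j)
          * (qPoch (q ^ 3 * a ^ 3 / k) (q ^ 4) j / qPoch (a * k * q) (q ^ 4) j)
          * q ^ j := by
  have g := h.baseChangeGeneric_sqrt ha hk hq hs
  have hk' : k = s ^ 2 * q / a := by rw [hs]; field_simp
  have hs0 : s ≠ 0 := by
    rintro rfl
    simp [hk] at hk'
  have f1 : QFree s (q ^ 2) := (h.qFree hq 0 1 0 0 0 (by decide) (by simp)).base_sq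
  have f4 : QFree (-s) (q ^ 2) := (h.qFree hq 0 1 0 0 0 (by decide) (by simp)).base_sq
  have f2 : QFree ((a ^ 2) ^ 2 / s ^ 2) (q ^ 2) :=
    (h.qFree hq 4 (-2) 0 0 0 (by decide) (by simp; field_simp)).base_sq
  have f3 : QFree (s ^ 4 / (a ^ 2) ^ 2) (q ^ 2) :=
    (h.qFree hq (-4) 4 0 0 0 (by decide) (by simp; field_simp)).base_sq
  have hb := wpMatrix_sum_sqrt (by rw [hs]; exact g.wpGeneric_source) hs0 f1 f2 f3 f4
  have hs4 : s ^ 4 / (a ^ 2) ^ 2 = k ^ 2 / (a ^ 2 * q ^ 2) := by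
    rw [show s ^ 4 = (s ^ 2) ^ 2 by ring, hs]
    field_simp
  have ht' : a ^ 2 / s = t := by rw [← ht]; field_simp
  simp only [hs4, ht', hs] at hb
  have key := baseChange_transform g hb n
  convert key using 2 with r hr
  · rw [show [-(q ^ 2 * s), -a, -(a * q), k ^ 2 / (a ^ 2 * q ^ 2),
          k ^ 2 * q ^ (2 * n), q ^ (-(2 * n : ℤ))] =
        [-(q ^ 2 * s), -a, -(a * q), k ^ 2 / (a ^ 2 * q ^ 2)] ++
          [k ^ 2 * (q ^ 2) ^ n, ((q ^ 2) ^ n)⁻¹] by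
        rw [zpow_neg_two_mul, pow_mul]; rfl,
      show [-s, -k, -(k * q), a * k * q ^ (2 * n + 1), a * q ^ (1 - 2 * n : ℤ) / k] =
        [-s, -k, -(k * q)] ++ [a * k / q * q ^ 2 * (q ^ 2) ^ n,
          a * k / q * q ^ 2 / (k ^ 2 * (q ^ 2) ^ n)] by
        have e : a * q ^ (1 - 2 * n : ℤ) / k = a * k / q * q ^ 2 / (k ^ 2 * (q ^ 2) ^ n) := by
          rw [sub_eq_add_neg, zpow_add₀ hq, zpow_one, zpow_neg_two_mul]
          field_simp
        rw [e, show a * k * q ^ (2 * n + 1) = a * k / q * q ^ 2 * (q ^ 2) ^ n by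
          rw [← pow_mul, pow_succ]; field_simp]
        rfl,
      phiTerm_append, mul_assoc (wpMatrix _ _ _ _ _)]
    congr 1
    have m1 := g.wpGeneric_source.KA_free.qPoch_ne_zero 0 (pow_ne_zero 2 hq)
      (e := k / (a * q)) (by rw [zpow_zero]; field_simp) r
    have m2 := g.wpGeneric_source.A_free.qPoch_ne_zero 1 (pow_ne_zero 2 hq)
      (e := a ^ 2 * q ^ 2) (by rw [zpow_one]) r
    have m3 := g.wpGeneric_source.K_free.qPoch_ne_zero 0 (pow_ne_zero 2 hq)
      (e := a * k / q) (by rw [zpow_zero, mul_one]) r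
    have m4 := f1.qPoch_ne_zero 0 (pow_ne_zero 2 hq) (e := s) (by rw [zpow_zero, mul_one]) r
    have m5 := f1.qPoch_ne_zero 1 (pow_ne_zero 2 hq) (e := q ^ 2 * s)
      (by rw [zpow_one, mul_comm]) r
    -- The part $(q^2s;q^2)_r/(s;q^2)_r$ of this factor cancels against the closed form of the
    -- square root sum, which leaves only $-q^2s$ over $-s$.
    have e1 := vwp_eq_qPoch_div f1 f4 r
    rw [hs] at e1
    simp only [qPochs_cons, qPochs_nil, baseChangeWeight]
    rw [e1, show a * k / q / a ^ 2 = k / (a * q) by field_simp]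
    refine eq_of_mul_inv_cancel
      (mul_ne_zero (mul_ne_zero (mul_ne_zero (mul_ne_zero m1 m2) m3) m4) m5) ?_
    simp only [div_eq_mul_inv, mul_inv]
    ring
  · refine Finset.sum_congr rfl fun j _ => ?_
    rw [qPochs_div_eq_wpMatrix hq, mul_assoc, mul_assoc, mul_assoc (wpMatrix _ _ _ _ _)]
    congr 1
    rw [baseChangeFactor_mul_vwp g,
      show a * k / q / a ^ 2 = k / (a * q) by field_simp,
      show (a ^ 2) ^ 2 * q ^ 2 / (a * k / q) = a ^ 3 * q ^ 3 / k by field_simp,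
      show a * k / q * q ^ 2 = a * k * q by field_simp,
      show (q ^ 2) ^ 2 = q ^ 4 by ring, mul_comm (q ^ 3)]
    simp only [qPochs_cons, qPochs_nil, div_eq_mul_inv, mul_inv]
    ring

theorem phiSeries_sqrt {a k q s t : ℂ} (ha : a ≠ 0) (hk : k ≠ 0) (hq : q ≠ 0) (n : ℕ)
    (hpre₁ : qPochs [-k, a * q] q n ≠ 0) (hpre₂ : qPoch (k * q / a) (q ^ 2) n ≠ 0)
    (hs : s ^ 2 = a * k / q) (ht : s * t = a ^ 2)
    (hP : PhiDenNeZero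
        [-s, -k, -(k * q), a * k * q ^ (2 * n + 1), a * q ^ (1 - 2 * n : ℤ) / k] (q ^ 2) n)
    (hC : qPochs [a * q ^ (1 - n : ℤ) / k, a * q ^ (1 + n)] q n ≠ 0)
    (hD : qPochs [a, a ^ 3 * q ^ 3 / k, q ^ 2 * s, -s, q ^ 2] (q ^ 2) n ≠ 0)
    (hE : qPoch (a * k * q) (q ^ 4) n ≠ 0) :
    phiSeries
        [-(q ^ 2 * s), -a, -(a * q), k ^ 2 / (a ^ 2 * q ^ 2),
          k ^ 2 * q ^ (2 * n), q ^ (-(2 * n : ℤ))]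
        [-s, -k, -(k * q), a * k * q ^ (2 * n + 1), a * q ^ (1 - 2 * n : ℤ) / k]
        (q ^ 2) (q ^ 2 * a / k)
      = wpPrefactor a k q n * ∑ j ∈ Finset.range (n + 1),
          qPochs [k * q ^ n, q ^ (-(n : ℤ))] q j
            / qPochs [a * q ^ (1 - n : ℤ) / k, a * q ^ (1 + n)] q j
          * (qPochs [a ^ 2, a * q ^ 2, k / (a * q), t, -(q ^ 2 * t)] (q ^ 2) j
            / qPochs [a, a ^ 3 * q ^ 3 / k, q ^ 2 * s, -s, q ^ 2] (q ^ 2) j)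
          * (qPoch (q ^ 3 * a ^ 3 / k) (q ^ 4) j / qPoch (a * k * q) (q ^ 4) j)
          * q ^ j := by
  rw [phiSeries_eq_sum (x := q ^ (-(2 * n : ℤ))) (N := n) (by simp)
    (zpow_neg_two_mul_mul_pow hq n)]
  have hs0 : s ≠ 0 := by
    rintro rfl
    rw [zero_pow two_ne_zero] at hs
    exact div_ne_zero (mul_ne_zero ha hk) hq hs.symm
  obtain rfl : k = s ^ 2 * q / a := by rw [hs]; field_simp
  -- The relation $st=a^2$ ties the second root to the first, so both are continuous in $a,s,q$.
  obtain rfl : t = a ^ 2 / s := by rw [← ht]; field_simp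
  obtain ⟨a', s', x', y', q', ⟨ca, rfl, na⟩, ⟨cs, rfl, ns⟩, -, -, ⟨cq, rfl, nq⟩, hfreq⟩ :=
    exists_path_mulIndep ha hs0 one_ne_zero one_ne_zero hq
  replace ca := ca.continuousAt (x := 0)
  replace cs := cs.continuousAt (x := 0)
  replace cq := cq.continuousAt (x := 0)
  have nk : ∀ t, s' t ^ 2 * q' t / a' t ≠ 0 := fun t =>
    div_ne_zero (mul_ne_zero (pow_ne_zero _ (ns t)) (nq t)) (na t)
  have ck : ContinuousAt (fun t => s' t ^ 2 * q' t / a' t) 0 := by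
    fun_prop (disch := assumption)
  refine eq_of_frequently_eq (hfreq.mono fun t ht => by
    have := na t
    have := nq t
    have := ns t
    exact sum_phiTerm_sqrt_of_mulIndep (k := s' t ^ 2 * q' t / a' t) (t := a' t ^ 2 / s' t) ht
      (na t) (nk t) (nq t) (by field_simp) (by field_simp) n) ?_ ?_
  · refine continuousAt_sum_phiTerm ?_ (fun j => ?_) (fun j => ?_) hP
    all_goals repeat' with_reducible first
      | exact continuousAt_qPochs_nil
      | apply ContinuousAt.qPochs_cons
    all_goals fun_prop (disch := simp [ha, hq])
  · refine (continuousAt_wpPrefactor ca ck cq ha hpre₁ hpre₂).mul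
      (tendsto_finsetSum _ fun j hj => ?_)
    have hj := Nat.lt_succ_iff.1 (Finset.mem_range.1 hj)
    refine ContinuousAt.mul (ContinuousAt.mul (ContinuousAt.mul
      (ContinuousAt.div ?_ ?_ (qPochs_ne_zero_of_le hj hC))
      (ContinuousAt.div ?_ ?_ (qPochs_ne_zero_of_le hj hD)))
      (ContinuousAt.div ?_ ?_ (qPoch_ne_zero_of_le hj hE))) (cq.pow j)
    all_goals repeat' with_reducible first
      | exact continuousAt_qPochs_nil
      | apply ContinuousAt.qPochs_cons
    all_goals fun_prop (disch := simp [ha, hq])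

/-! ### The transformations with even columns or even rows -/

/-- By $(z;p)_{2i}=(z;p^2)_i(zp;p^2)_i$, the four parameters form the base $p$ matrix in column
$2i$. -/
theorem wTerm_append_sq {p : ℂ} (hp : p ≠ 0) (A K z : ℂ) (L : List ℂ) (n i : ℕ) :
    wTerm A (L ++ [K * p ^ n, K * p ^ n * p, (p ^ n)⁻¹ * p, (p ^ n)⁻¹]) (p ^ 2) z i =
      wpMatrix A K p n (2 * i) * ((1 - A * (p ^ 2) ^ (2 * i)) / (1 - A) *
        (qPochs (A :: L) (p ^ 2) i / qPochs (p ^ 2 :: L.map (fun x => p ^ 2 * A / x)) (p ^ 2) i) *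
          z ^ i) := by
  rw [wTerm, List.map_append, ← List.cons_append, ← List.cons_append, qPochs_append,
    qPochs_append, wpMatrix]
  simp only [List.map_cons, List.map_nil, qPochs_cons, qPochs_nil, qPoch_two_mul]
  have hn : p ^ n ≠ 0 := pow_ne_zero _ hp
  rw [show p ^ 2 * A / (K * p ^ n) = A * p / (K * p ^ n) * p by ring,
    show p ^ 2 * A / (K * p ^ n * p) = A * p / (K * p ^ n) by
      rw [← mul_div_mul_right (A * p) _ hp]; ring,
    show p ^ 2 * A / ((p ^ n)⁻¹ * p) = A * p * p ^ n by field_simp,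
    show p ^ 2 * A / (p ^ n)⁻¹ = A * p * p ^ n * p by field_simp]
  simp only [div_eq_mul_inv, mul_inv]
  ring

theorem sum_range_eq_of_lt {f : ℕ → ℂ} {m N : ℕ} (hN : m < N) (hf : ∀ j, m < j → f j = 0) :
    ∑ j ∈ Finset.range N, f j = ∑ j ∈ Finset.range (m + 1), f j :=
  Finset.eventually_constant_sum (fun j hj => hf j hj) hN

/-- The parity of $n$ decides which of the two parameters terminates the series, in either case at
index $\lfloor n/2\rfloor$. -/
theorem exists_mem_mul_sq_pow_eq_one {q : ℂ} (hq : q ≠ 0) (n : ℕ) :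
    q ^ (1 - n : ℤ) * (q ^ 2) ^ (n / 2) = 1 ∨ q ^ (-(n : ℤ)) * (q ^ 2) ^ (n / 2) = 1 := by
  rw [← pow_mul, ← zpow_natCast, ← zpow_add₀ hq, ← zpow_add₀ hq]
  rcases Nat.even_or_odd' n with ⟨m, rfl | rfl⟩
  · right
    rw [show (-((2 * m : ℕ) : ℤ) + ((2 * (2 * m / 2) : ℕ) : ℤ)) = 0 by omega, zpow_zero]
  · left
    rw [show (1 - ((2 * m + 1 : ℕ) : ℤ) + ((2 * ((2 * m + 1) / 2) : ℕ) : ℤ)) = 0 by omega,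
      zpow_zero]

/-- Serves both cases of parity support: an $\alpha$ living on even columns and a closed form $b$
living on even rows. -/
theorem sum_wpMatrix_evenExtend {A K p : ℂ} (hp : p ≠ 0) (w g : ℕ → ℂ) {r N : ℕ} (hN : r < N) :
    ∑ j ∈ Finset.range N, wpMatrix A K p r j * w j * evenExtend g j =
      ∑ i ∈ Finset.range (r / 2 + 1), wpMatrix A K p r (2 * i) * w (2 * i) * g i := by
  have hz : ∀ j, r < j → wpMatrix A K p r j * w j * evenExtend g j = 0 := fun j hj => by
    rw [wpMatrix_eq_zero hp hj, zero_mul, zero_mul]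
  rw [sum_range_eq_of_lt hN hz, ← sum_range_eq_of_lt (N := 2 * (r / 2 + 1)) (by omega) hz,
    sum_range_evenExtend g fun j => wpMatrix A K p r j * w j]

theorem sum_wTerm_evenCol_of_mulIndep {a k q x y : ℂ} (h : MulIndep a k x y q) (ha : a ≠ 0)
    (hk : k ≠ 0) (hq : q ≠ 0) (n : ℕ) :
    ∑ j ∈ Finset.range (n + 1), wTerm (a * k / q)
        [-a, k, a * q / k, k ^ 2 * q ^ (2 * n), q ^ (-(2 * n : ℤ))] (q ^ 2) (-q) j =
      wpPrefactor a k q n * ∑ j ∈ Finset.range (n / 2 + 1), wTerm a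
          [-a, a * q / k, -(a * q / k), k * q ^ n, k * q ^ (1 + n), q ^ (1 - n : ℤ),
            q ^ (-(n : ℤ))] (q ^ 2) (q ^ 2) j := by
  have g := h.baseChangeGeneric ha hk hq
  have f2 : QFree ((a * k / q) ^ 2 / a ^ 2) (q ^ 2) :=
    (h.qFree hq 0 2 0 0 (-2) (by decide) (by simp; field_simp)).base_sq
  have hb : ∀ r N, r < N → ∑ j ∈ Finset.range N, wpMatrix (a ^ 2) (a * k / q) (q ^ 2) r j *
      evenExtend (fun i => (1 - a ^ 2 * ((q ^ 2) ^ 2) ^ (2 * i)) / (1 - a ^ 2) *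
        (qPoch (a ^ 2) ((q ^ 2) ^ 2) i * qPoch ((a ^ 2) ^ 2 / (a * k / q) ^ 2) ((q ^ 2) ^ 2) i /
        (qPoch ((q ^ 2) ^ 2) ((q ^ 2) ^ 2) i *
          qPoch ((a * k / q) ^ 2 * (q ^ 2) ^ 2 / a ^ 2) ((q ^ 2) ^ 2) i)) *
          ((q ^ 2) ^ 2) ^ i) j = _ := fun r N hN => by
    have e := sum_wpMatrix_evenExtend (A := a ^ 2) (K := a * k / q) g.wpGeneric_source.p_ne
      (fun _ => 1) (fun i => (1 - a ^ 2 * ((q ^ 2) ^ 2) ^ (2 * i)) / (1 - a ^ 2) *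
        (qPoch (a ^ 2) ((q ^ 2) ^ 2) i * qPoch ((a ^ 2) ^ 2 / (a * k / q) ^ 2) ((q ^ 2) ^ 2) i /
        (qPoch ((q ^ 2) ^ 2) ((q ^ 2) ^ 2) i *
          qPoch ((a * k / q) ^ 2 * (q ^ 2) ^ 2 / a ^ 2) ((q ^ 2) ^ 2) i)) *
          ((q ^ 2) ^ 2) ^ i) hN
    simp only [mul_one] at e
    -- The bound $\lfloor r/2\rfloor+1$ is the least $N$ with $r<2N$.
    exact e.trans (wpMatrix_sum_evenCol g.wpGeneric_source f2 r (r / 2 + 1) (by omega))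
  have key := baseChange_transform g hb n
  rw [sum_wpMatrix_evenExtend hq _ _ (Nat.lt_succ_self n)] at key
  convert key using 2 with r hr
  · rw [show [-a, k, a * q / k, k ^ 2 * q ^ (2 * n), q ^ (-(2 * n : ℤ))] =
        [-a, k, a * q / k] ++ [k ^ 2 * (q ^ 2) ^ n, ((q ^ 2) ^ n)⁻¹] by
        rw [zpow_neg_two_mul, pow_mul]; rfl,
      wTerm_append, mul_assoc (wpMatrix _ _ _ _ _)]
    congr 1
    have m1 := g.wpGeneric_source.KA_free.qPoch_ne_zero 0 (pow_ne_zero 2 hq)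
      (e := k / (a * q)) (by rw [zpow_zero]; field_simp) r
    have m2 := g.wpGeneric_source.A_free.qPoch_ne_zero 1 (pow_ne_zero 2 hq)
      (e := a ^ 2 * q ^ 2) (by rw [zpow_one]) r
    have m3 := g.neg_k_free.base_sq.qPoch_ne_zero 0 (pow_ne_zero 2 hq) (e := -k)
      (by rw [zpow_zero, mul_one]) r
    have m4 := (g.neg_a_free.mul_zpow hq 1 (e := -(a * q)) (by
      rw [zpow_one]; ring)).base_sq.qPoch_ne_zero 0 (pow_ne_zero 2 hq) (e := -(a * q))
      (by rw [zpow_zero, mul_one]) r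
    simp only [List.map_cons, List.map_nil, qPochs_cons, qPochs_nil, baseChangeWeight]
    -- The argument $-q$ arises as the argument $q^2a/k$ of the weight times the power base
    -- $-k/(aq)$ in the closed form.
    rw [show q ^ 2 * (a * k / q) / -a = -(k * q) by field_simp,
      show q ^ 2 * (a * k / q) / k = a * q by field_simp,
      show q ^ 2 * (a * k / q) / (a * q / k) = k ^ 2 by field_simp,
      show (a * k / q) ^ 2 * q ^ 2 / a ^ 2 = k ^ 2 by field_simp,
      show a ^ 2 / (a * k / q) = a * q / k by field_simp,
      show a * k / q / a ^ 2 = k / (a * q) by field_simp, qPoch_sq k (q ^ 2),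
      show qPoch (a ^ 2 * q ^ 2) ((q ^ 2) ^ 2) r =
        qPoch (a * q) (q ^ 2) r * qPoch (-(a * q)) (q ^ 2) r by rw [← mul_pow, qPoch_sq],
      show -q = q ^ 2 * a / k * -(k / (a * q)) by field_simp, mul_pow (q ^ 2 * a / k)]
    refine eq_of_mul_inv_cancel (mul_ne_zero (mul_ne_zero (mul_ne_zero m1 m2) m3) m4) ?_
    simp only [div_eq_mul_inv, mul_inv]
    ring
  · refine Finset.sum_congr rfl fun i _ => ?_
    rw [show [-a, a * q / k, -(a * q / k), k * q ^ n, k * q ^ (1 + n), q ^ (1 - n : ℤ),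
            q ^ (-(n : ℤ))] =
        [-a, a * q / k, -(a * q / k)] ++ [k * q ^ n, k * q ^ n * q, (q ^ n)⁻¹ * q, (q ^ n)⁻¹] by
        rw [sub_eq_add_neg, zpow_add₀ hq, zpow_one, zpow_neg, zpow_natCast, pow_add, pow_one,
          mul_comm q, mul_comm q, ← mul_assoc]
        rfl,
      wTerm_append_sq hq, mul_assoc (wpMatrix _ _ _ _ _)]
    congr 1
    have m1 := g.a_free.one_sub_ne 0 (e := a) (by simp)
    have m2 := g.neg_a_free.one_add_ne 0 (e := a) (by simp)
    have m3 := g.neg_a_free.one_add_ne (4 * i) (e := a * q ^ (2 * (2 * i))) (by ring)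
    have hqi : q ^ (2 * i) ≠ 0 := pow_ne_zero _ hq
    have e0 : baseChangeFactor a q (2 * i) *
        ((1 - a ^ 2 * ((q ^ 2) ^ 2) ^ (2 * i)) / (1 - a ^ 2)) * ((q ^ 2) ^ 2) ^ i =
        (1 - a * (q ^ 2) ^ (2 * i)) / (1 - a) * (q ^ 2) ^ i := by
      rw [baseChangeFactor, show 1 - a ^ 2 * ((q ^ 2) ^ 2) ^ (2 * i) =
          (1 - a * (q ^ 2) ^ (2 * i)) * (1 + a * q ^ (2 * (2 * i))) by ring,
        show 1 - a ^ 2 = (1 - a) * (1 + a) by ring, show (q ^ 2) ^ i = q ^ (2 * i) by ring,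
        show ((q ^ 2) ^ 2) ^ i = q ^ (2 * i) * q ^ (2 * i) by ring]
      generalize 1 + a * q ^ (2 * (2 * i)) = d at *
      generalize 1 - a * (q ^ 2) ^ (2 * i) = c
      field_simp
    rw [← mul_assoc (baseChangeFactor _ _ _), ← mul_assoc (baseChangeFactor _ _ _),
      mul_right_comm (baseChangeFactor _ _ _ * _), e0,
      show (a ^ 2) ^ 2 / (a * k / q) ^ 2 = (a * q / k) ^ 2 by field_simp,
      show (a * k / q) ^ 2 * (q ^ 2) ^ 2 / a ^ 2 = (k * q) ^ 2 by field_simp,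
      qPoch_sq a, qPoch_sq (a * q / k), qPoch_sq (q ^ 2), qPoch_sq (k * q)]
    simp only [List.map_cons, List.map_nil, qPochs_cons, qPochs_nil]
    rw [show q ^ 2 * a / -a = -q ^ 2 by field_simp,
      show q ^ 2 * a / (a * q / k) = k * q by field_simp,
      show q ^ 2 * a / -(a * q / k) = -(k * q) by field_simp]
    simp only [div_eq_mul_inv, mul_inv]
    ring

theorem wSeries_evenCol {a k q : ℂ} (ha : a ≠ 0) (hk : k ≠ 0) (hq : q ≠ 0) (n : ℕ)
    (hpre₁ : qPochs [-k, a * q] q n ≠ 0) (hpre₂ : qPoch (k * q / a) (q ^ 2) n ≠ 0)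
    (hW : WDenNeZero (a * k / q)
        [-a, k, a * q / k, k ^ 2 * q ^ (2 * n), q ^ (-(2 * n : ℤ))] (q ^ 2) n)
    (hV : WDenNeZero a
        [-a, a * q / k, -(a * q / k), k * q ^ n, k * q ^ (1 + n), q ^ (1 - n : ℤ),
          q ^ (-(n : ℤ))] (q ^ 2) (n / 2)) :
    wSeries (a * k / q)
        [-a, k, a * q / k, k ^ 2 * q ^ (2 * n), q ^ (-(2 * n : ℤ))] (q ^ 2) (-q)
      = wpPrefactor a k q n *
        wSeries a
          [-a, a * q / k, -(a * q / k), k * q ^ n, k * q ^ (1 + n), q ^ (1 - n : ℤ),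
            q ^ (-(n : ℤ))] (q ^ 2) (q ^ 2) := by
  have hs : wSeries a
          [-a, a * q / k, -(a * q / k), k * q ^ n, k * q ^ (1 + n), q ^ (1 - n : ℤ),
            q ^ (-(n : ℤ))] (q ^ 2) (q ^ 2) = ∑ j ∈ Finset.range (n / 2 + 1), wTerm a
          [-a, a * q / k, -(a * q / k), k * q ^ n, k * q ^ (1 + n), q ^ (1 - n : ℤ),
            q ^ (-(n : ℤ))] (q ^ 2) (q ^ 2) j := by
    rcases exists_mem_mul_sq_pow_eq_one hq n with h | h <;>
    exact wSeries_eq_sum (by simp) h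
  rw [wSeries_eq_sum (x := q ^ (-(2 * n : ℤ))) (N := n) (by simp) (zpow_neg_two_mul_mul_pow hq n),
    hs]
  clear hs
  obtain ⟨a', k', x', y', q', ⟨ca, rfl, na⟩, ⟨ck, rfl, nk⟩, -, -, ⟨cq, rfl, nq⟩, hfreq⟩ :=
    exists_path_mulIndep ha hk one_ne_zero one_ne_zero hq
  replace ca := ca.continuousAt (x := 0)
  replace ck := ck.continuousAt (x := 0)
  replace cq := cq.continuousAt (x := 0)
  refine eq_of_frequently_eq (hfreq.mono fun t ht =>
    sum_wTerm_evenCol_of_mulIndep ht (na t) (nk t) (nq t) n) ?_ ?_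
  · refine continuousAt_sum_wTerm ?_ ?_ ?_ (fun j => ?_) (fun j => ?_) hW <;>
    try simp only [List.map_cons, List.map_nil]
    all_goals repeat' with_reducible first
      | exact continuousAt_qPochs_nil
      | apply ContinuousAt.qPochs_cons
    all_goals fun_prop (disch := simp [ha, hk, hq, zpow_ne_zero _ hq])
  · refine (continuousAt_wpPrefactor ca ck cq ha hpre₁ hpre₂).mul
      (continuousAt_sum_wTerm ?_ ?_ ?_ (fun j => ?_) (fun j => ?_) hV) <;>
    try simp only [List.map_cons, List.map_nil]
    all_goals repeat' with_reducible first
      | exact continuousAt_qPochs_nil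
      | apply ContinuousAt.qPochs_cons
    all_goals fun_prop (disch := simp [ha, hk, hq, zpow_ne_zero _ hq])

theorem sum_wTerm_even_of_mulIndep {a k q x y : ℂ} (h : MulIndep a k x y q) (ha : a ≠ 0)
    (hk : k ≠ 0) (hq : q ≠ 0) (n : ℕ) :
    ∑ j ∈ Finset.range (n / 2 + 1), wTerm (a * k / q)
        [-a, -(a * q), -(a * q ^ 2), -(a * q ^ 3), k ^ 2 / (a ^ 2 * q ^ 2),
          k ^ 2 * q ^ (2 * n), k ^ 2 * q ^ (2 + 2 * n), q ^ (2 - 2 * n : ℤ),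
          q ^ (-(2 * n : ℤ))] (q ^ 4) (q ^ 4 * a ^ 2 / k ^ 2) j =
      wpPrefactor a k q n * ∑ j ∈ Finset.range (n + 1),
          qPochs [k * q ^ n, q ^ (-(n : ℤ))] q j
            / qPochs [a * q ^ (1 - n : ℤ) / k, a * q ^ (1 + n)] q j
          * (qPochs [a ^ 2, a * q ^ 2, k / (a * q)] (q ^ 2) j
            / qPochs [a, a ^ 3 * q ^ 3 / k, q ^ 2] (q ^ 2) j)
          * (qPoch (a ^ 3 * q ^ 3 / k) (q ^ 4) j / qPoch (a * k * q) (q ^ 4) j)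
          * (-(q ^ 2 * a / k)) ^ j := by
  have g := h.baseChangeGeneric ha hk hq
  have hp := g.wpGeneric_source.p_ne
  have f2 : QFree ((a ^ 2) ^ 2 / (a * k / q)) (q ^ 2) :=
    (h.qFree hq 3 (-1) 0 0 1 (by decide) (by simp; field_simp)).base_sq
  have key := baseChange_transform g (wpMatrix_sum_even g.wpGeneric_source f2) n
  rw [sum_wpMatrix_evenExtend hp _ _ (Nat.lt_succ_self n)] at key
  convert key using 2 with i hi
  · rw [show [-a, -(a * q), -(a * q ^ 2), -(a * q ^ 3), k ^ 2 / (a ^ 2 * q ^ 2),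
          k ^ 2 * q ^ (2 * n), k ^ 2 * q ^ (2 + 2 * n), q ^ (2 - 2 * n : ℤ),
          q ^ (-(2 * n : ℤ))] =
        [-a, -(a * q), -(a * q ^ 2), -(a * q ^ 3), k ^ 2 / (a ^ 2 * q ^ 2)] ++
          [k ^ 2 * (q ^ 2) ^ n, k ^ 2 * (q ^ 2) ^ n * q ^ 2, ((q ^ 2) ^ n)⁻¹ * q ^ 2,
            ((q ^ 2) ^ n)⁻¹] by
        rw [sub_eq_add_neg, zpow_add₀ hq, zpow_neg_two_mul, pow_add, pow_mul q 2 n,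
          show q ^ (2 : ℤ) = q ^ 2 from zpow_natCast q 2, mul_comm (q ^ 2) ((q ^ 2) ^ n),
          mul_comm (q ^ 2) ((q ^ 2) ^ n)⁻¹, ← mul_assoc]
        rfl,
      show q ^ 4 = (q ^ 2) ^ 2 by ring,
      wTerm_append_sq hp, mul_assoc (wpMatrix _ _ _ _ _)]
    congr 1
    have hp2 : (q ^ 2) ^ 2 ≠ 0 := pow_ne_zero _ hp
    have m1 := g.wpGeneric_source.KA_free.base_sq.qPoch_ne_zero 0 hp2
      (e := k / (a * q)) (by rw [zpow_zero]; field_simp) i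
    have m2 := (g.ka_free.mul_zpow hq 1 (e := k * q / a) (by
      rw [zpow_one]; ring)).base_sq.base_sq.qPoch_ne_zero 0 hp2 (e := k * q / a)
      (by rw [zpow_zero, mul_one]) i
    have m3 := (g.wpGeneric_source.A_free.mul_zpow hp 1 (e := a ^ 2 * q ^ 2) (by
      rw [zpow_one])).base_sq.qPoch_ne_zero 0 hp2 (e := a ^ 2 * q ^ 2)
      (by rw [zpow_zero, mul_one]) i
    have m4 := (g.wpGeneric_source.A_free.mul_zpow hp 2 (e := a ^ 2 * (q ^ 2) ^ 2) (by
      rw [zpow_ofNat])).base_sq.qPoch_ne_zero 0 hp2 (e := a ^ 2 * (q ^ 2) ^ 2)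
      (by rw [zpow_zero, mul_one]) i
    have m5 : qPoch (q ^ 2) ((q ^ 2) ^ 2) i ≠ 0 := by
      simp only [qPoch, Finset.prod_ne_zero_iff]
      exact fun l _ => g.q_free.sq.one_sub_ne (2 * l) (by ring)
    have m6 := (g.ak_free.mul_zpow hq 1 (e := a * k * q) (by
      rw [zpow_one])).base_sq.base_sq.qPoch_ne_zero 0 hp2 (e := a * k * q)
      (by rw [zpow_zero, mul_one]) i
    simp only [List.map_cons, List.map_nil, qPochs_cons, qPochs_nil, baseChangeWeight,
      qPoch_two_mul _ (q ^ 2)]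
    -- Only even rows contribute, so the weight is taken at index $2i$: its base $q^2$ factors split
    -- into base $q^4$ and its argument is squared.
    rw [show (q ^ 2) ^ 2 * (a * k / q) / -a = -(k * q) * q ^ 2 by field_simp,
      show (q ^ 2) ^ 2 * (a * k / q) / -(a * q) = -k * q ^ 2 by field_simp,
      show (q ^ 2) ^ 2 * (a * k / q) / -(a * q ^ 2) = -(k * q) by field_simp,
      show (q ^ 2) ^ 2 * (a * k / q) / -(a * q ^ 3) = -k by field_simp,
      show (q ^ 2) ^ 2 * (a * k / q) / (k ^ 2 / (a ^ 2 * q ^ 2)) = a ^ 3 * q ^ 5 / k by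
        field_simp,
      show (a ^ 2) ^ 2 * (q ^ 2) ^ 2 / (a * k / q) = a ^ 3 * q ^ 5 / k by field_simp,
      show (a * k / q) ^ 2 / (a ^ 2) ^ 2 = k ^ 2 / (a ^ 2 * q ^ 2) by field_simp,
      show a * k / q / a ^ 2 = k / (a * q) by field_simp,
      show k / (a * q) * q ^ 2 = k * q / a by field_simp,
      show a * k / q * q ^ 2 / a ^ 2 = k * q / a by field_simp,
      show a * k / q * q ^ 2 = a * k * q by field_simp,
      show -(a * q ^ 2) = -a * q ^ 2 by ring, show -(a * q ^ 3) = -(a * q) * q ^ 2 by ring,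
      show q ^ 2 * q ^ 2 = (q ^ 2) ^ 2 by ring,
      show a ^ 2 * q ^ 2 * q ^ 2 = a ^ 2 * (q ^ 2) ^ 2 by ring,
      show ((q ^ 2) ^ 2) ^ (2 * i) = (q ^ 2) ^ (2 * (2 * i)) by ring,
      show (q ^ 2 * a / k) ^ (2 * i) = ((q ^ 2) ^ 2 * a ^ 2 / k ^ 2) ^ i by
        rw [pow_mul, div_pow, mul_pow]]
    refine eq_of_mul_inv_cancel (mul_ne_zero (mul_ne_zero (mul_ne_zero (mul_ne_zero
      (mul_ne_zero m1 m2) m3) m4) m5) m6) ?_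
    simp only [div_eq_mul_inv, mul_inv]
    ring
  · refine Finset.sum_congr rfl fun j _ => ?_
    rw [qPochs_div_eq_wpMatrix hq, mul_assoc, mul_assoc, mul_assoc (wpMatrix _ _ _ _ _)]
    congr 1
    rw [mul_assoc (_ / _) _ ((-(q ^ 2 * a ^ 2 / (a * k / q))) ^ j),
      ← mul_assoc (baseChangeFactor _ _ _), vwp_mul_baseChangeFactor g,
      show a * k / q / a ^ 2 = k / (a * q) by field_simp,
      show (a ^ 2) ^ 2 * q ^ 2 / (a * k / q) = a ^ 3 * q ^ 3 / k by field_simp,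
      show a * k / q * q ^ 2 = a * k * q by field_simp,
      show (q ^ 2) ^ 2 = q ^ 4 by ring,
      show -(q ^ 2 * a ^ 2 / (a * k / q)) = -(q ^ 2 * a / k) * q by field_simp,
      mul_pow _ q]
    have hqj : q ^ j ≠ 0 := pow_ne_zero _ hq
    refine eq_of_mul_inv_cancel hqj ?_
    simp only [qPochs_cons, qPochs_nil, div_eq_mul_inv, mul_inv]
    ring

theorem wSeries_even {a k q : ℂ} (ha : a ≠ 0) (hk : k ≠ 0) (hq : q ≠ 0) (n : ℕ)
    (hpre₁ : qPochs [-k, a * q] q n ≠ 0) (hpre₂ : qPoch (k * q / a) (q ^ 2) n ≠ 0)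
    (hW : WDenNeZero (a * k / q)
        [-a, -(a * q), -(a * q ^ 2), -(a * q ^ 3), k ^ 2 / (a ^ 2 * q ^ 2),
          k ^ 2 * q ^ (2 * n), k ^ 2 * q ^ (2 + 2 * n), q ^ (2 - 2 * n : ℤ),
          q ^ (-(2 * n : ℤ))] (q ^ 4) (n / 2))
    (hC : qPochs [a * q ^ (1 - n : ℤ) / k, a * q ^ (1 + n)] q n ≠ 0)
    (hD : qPochs [a, a ^ 3 * q ^ 3 / k, q ^ 2] (q ^ 2) n ≠ 0)
    (hE : qPoch (a * k * q) (q ^ 4) n ≠ 0) :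
    wSeries (a * k / q)
        [-a, -(a * q), -(a * q ^ 2), -(a * q ^ 3), k ^ 2 / (a ^ 2 * q ^ 2),
          k ^ 2 * q ^ (2 * n), k ^ 2 * q ^ (2 + 2 * n), q ^ (2 - 2 * n : ℤ),
          q ^ (-(2 * n : ℤ))] (q ^ 4) (q ^ 4 * a ^ 2 / k ^ 2)
      = wpPrefactor a k q n * ∑ j ∈ Finset.range (n + 1),
          qPochs [k * q ^ n, q ^ (-(n : ℤ))] q j
            / qPochs [a * q ^ (1 - n : ℤ) / k, a * q ^ (1 + n)] q j
          * (qPochs [a ^ 2, a * q ^ 2, k / (a * q)] (q ^ 2) j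
            / qPochs [a, a ^ 3 * q ^ 3 / k, q ^ 2] (q ^ 2) j)
          * (qPoch (a ^ 3 * q ^ 3 / k) (q ^ 4) j / qPoch (a * k * q) (q ^ 4) j)
          * (-(q ^ 2 * a / k)) ^ j := by
  have hs : wSeries (a * k / q)
        [-a, -(a * q), -(a * q ^ 2), -(a * q ^ 3), k ^ 2 / (a ^ 2 * q ^ 2),
          k ^ 2 * q ^ (2 * n), k ^ 2 * q ^ (2 + 2 * n), q ^ (2 - 2 * n : ℤ),
          q ^ (-(2 * n : ℤ))] (q ^ 4) (q ^ 4 * a ^ 2 / k ^ 2) =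
      ∑ j ∈ Finset.range (n / 2 + 1), wTerm (a * k / q)
        [-a, -(a * q), -(a * q ^ 2), -(a * q ^ 3), k ^ 2 / (a ^ 2 * q ^ 2),
          k ^ 2 * q ^ (2 * n), k ^ 2 * q ^ (2 + 2 * n), q ^ (2 - 2 * n : ℤ),
          q ^ (-(2 * n : ℤ))] (q ^ 4) (q ^ 4 * a ^ 2 / k ^ 2) j := by
    -- Termination is as in base $q^2$, with $q^2$ in place of $q$.
    rcases exists_mem_mul_sq_pow_eq_one (pow_ne_zero 2 hq) n with h | h
    · refine wSeries_eq_sum (x := q ^ (2 - 2 * n : ℤ)) (by simp) ?_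
      rw [← h, show q ^ (2 - 2 * n : ℤ) = (q ^ 2) ^ (1 - n : ℤ) by
        rw [← zpow_natCast q 2, ← zpow_mul]
        congr 1
        push_cast
        ring, show q ^ 4 = (q ^ 2) ^ 2 by ring]
    · refine wSeries_eq_sum (x := q ^ (-(2 * n : ℤ))) (by simp) ?_
      rw [← h, show q ^ (-(2 * n : ℤ)) = (q ^ 2) ^ (-n : ℤ) by
        rw [← zpow_natCast q 2, ← zpow_mul]
        congr 1
        push_cast
        ring, show q ^ 4 = (q ^ 2) ^ 2 by ring]
  rw [hs]
  clear hs
  obtain ⟨a', k', x', y', q', ⟨ca, rfl, na⟩, ⟨ck, rfl, nk⟩, -, -, ⟨cq, rfl, nq⟩, hfreq⟩ :=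
    exists_path_mulIndep ha hk one_ne_zero one_ne_zero hq
  replace ca := ca.continuousAt (x := 0)
  replace ck := ck.continuousAt (x := 0)
  replace cq := cq.continuousAt (x := 0)
  refine eq_of_frequently_eq (hfreq.mono fun t ht =>
    sum_wTerm_even_of_mulIndep ht (na t) (nk t) (nq t) n) ?_ ?_
  · refine continuousAt_sum_wTerm ?_ ?_ ?_ (fun j => ?_) (fun j => ?_) hW <;>
    try simp only [List.map_cons, List.map_nil]
    all_goals repeat' with_reducible first
      | exact continuousAt_qPochs_nil
      | apply ContinuousAt.qPochs_cons
    all_goals fun_prop (disch := simp [ha, hk, hq, zpow_ne_zero _ hq])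
  · refine (continuousAt_wpPrefactor ca ck cq ha hpre₁ hpre₂).mul
      (tendsto_finsetSum _ fun j hj => ?_)
    have hj := Nat.lt_succ_iff.1 (Finset.mem_range.1 hj)
    refine ContinuousAt.mul (ContinuousAt.mul (ContinuousAt.mul
      (ContinuousAt.div ?_ ?_ (qPochs_ne_zero_of_le hj hC))
      (ContinuousAt.div ?_ ?_ (qPochs_ne_zero_of_le hj hD)))
      (ContinuousAt.div ?_ ?_ (qPoch_ne_zero_of_le hj hE))) (ContinuousAt.pow ?_ j)
    all_goals repeat' with_reducible first
      | exact continuousAt_qPochs_nil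
      | apply ContinuousAt.qPochs_cons
    all_goals fun_prop (disch := simp [ha, hq])

/-! ### The transformations from base `q ^ 2` to base `q` -/

theorem sum_wTerm_quart_of_mulIndep {a k q x y : ℂ} (h : MulIndep a k x y q) (ha : a ≠ 0)
    (hk : k ≠ 0) (hq : q ≠ 0) (n : ℕ) :
    ∑ j ∈ Finset.range (n + 1), wTerm (a * k / q)
        [a * q / k, k ^ 2 * q ^ (2 * n), q ^ (-(2 * n : ℤ))] (q ^ 2) 1 j =
      wpPrefactor a k q n * ∑ j ∈ Finset.range (n + 1),
        wTerm a [a * q / k, k * q ^ n, q ^ (-(n : ℤ))] q 1 j := by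
  have g := h.baseChangeGeneric ha hk hq
  have f3 : QFree (k ^ 2) (q ^ 2) :=
    (h.qFree hq 0 2 0 0 0 (by decide) (by simp)).base_sq
  have key := baseChange_transform g (wpMatrix_sum_quart ha hk hq g.wpGeneric_source g.neg_a_free
    g.ka_free f3 g.k_free g.q_free) n
  convert key using 2 with r hr
  · rw [show [a * q / k, k ^ 2 * q ^ (2 * n), q ^ (-(2 * n : ℤ))] =
        [a * q / k] ++ [k ^ 2 * (q ^ 2) ^ n, ((q ^ 2) ^ n)⁻¹] by
        rw [zpow_neg_two_mul, pow_mul]; rfl,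
      wTerm_append, mul_assoc (wpMatrix _ _ _ _ _)]
    congr 1
    have hp := g.wpGeneric_source.p_ne
    have m1 := g.wpGeneric_source.KA_free.qPoch_ne_zero 0 hp
      (e := k / (a * q)) (by rw [zpow_zero]; field_simp) r
    have m2 := g.wpGeneric_source.A_free.qPoch_ne_zero 1 hp
      (e := a ^ 2 * q ^ 2) (by rw [zpow_one]) r
    have m3 := g.neg_k_free.base_sq.qPoch_ne_zero 0 hp (e := -k)
      (by rw [zpow_zero, mul_one]) r
    have m4 := (g.neg_k_free.mul_zpow hq 1 (e := -(k * q)) (by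
      rw [zpow_one]; ring)).base_sq.qPoch_ne_zero 0 hp (e := -(k * q))
      (by rw [zpow_zero, mul_one]) r
    have m5 := g.neg_a_free.base_sq.qPoch_ne_zero 0 hp (e := -a)
      (by rw [zpow_zero, mul_one]) r
    have m6 := (g.neg_a_free.mul_zpow hq 1 (e := -(a * q)) (by
      rw [zpow_one]; ring)).base_sq.qPoch_ne_zero 0 hp (e := -(a * q))
      (by rw [zpow_zero, mul_one]) r
    have m7 : (q ^ 2 * a / k) ^ r ≠ 0 := pow_ne_zero _ (div_ne_zero (mul_ne_zero hp ha) hk)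
    simp only [List.map_cons, List.map_nil, qPochs_cons, qPochs_nil, baseChangeWeight, one_pow]
    -- The power in the closed form is inverse to the argument of the weight, hence the resulting
    -- argument $1$.
    rw [show q ^ 2 * (a * k / q) / (a * q / k) = k ^ 2 by field_simp,
      show k / (q ^ 2 * a) = (q ^ 2 * a / k)⁻¹ by rw [inv_div], inv_pow]
    generalize (q ^ 2 * a / k) ^ r = z at *
    refine eq_of_mul_inv_cancel (mul_ne_zero (mul_ne_zero (mul_ne_zero (mul_ne_zero
      (mul_ne_zero (mul_ne_zero m1 m2) m3) m4) m5) m6) m7) ?_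
    simp only [div_eq_mul_inv, mul_inv]
    ring
  · refine Finset.sum_congr rfl fun j _ => ?_
    rw [show [a * q / k, k * q ^ n, q ^ (-(n : ℤ))] = [a * q / k] ++ [k * q ^ n, (q ^ n)⁻¹] by
        rw [zpow_neg, zpow_natCast]; rfl,
      wTerm_append, mul_assoc (wpMatrix _ _ _ _ _)]
    congr 1
    have m1 := g.a_free.one_sub_ne 0 (e := a) (by simp)
    have m2 := g.neg_a_free.one_add_ne 0 (e := a) (by simp)
    have m3 := g.neg_a_free.one_add_ne (2 * j) (e := a * q ^ (2 * j)) rfl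
    have hqj : q ^ j ≠ 0 := pow_ne_zero _ hq
    have e0 : baseChangeFactor a q j *
        ((1 - a ^ 2 * (q ^ 2) ^ (2 * j)) / (1 - a ^ 2)) * q ^ j =
        (1 - a * q ^ (2 * j)) / (1 - a) := by
      rw [baseChangeFactor, show 1 - a ^ 2 * (q ^ 2) ^ (2 * j) =
          (1 - a * q ^ (2 * j)) * (1 + a * q ^ (2 * j)) by ring,
        show 1 - a ^ 2 = (1 - a) * (1 + a) by ring]
      generalize 1 + a * q ^ (2 * j) = d at *
      generalize 1 - a * q ^ (2 * j) = c
      field_simp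
    rw [← mul_assoc (baseChangeFactor _ _ _), ← mul_assoc (baseChangeFactor _ _ _),
      mul_right_comm (baseChangeFactor _ _ _ * _), e0]
    simp only [List.map_cons, List.map_nil, qPochs_cons, qPochs_nil, one_pow]
    rw [show q * a / (a * q / k) = k by field_simp]
    simp only [mul_one]

theorem wSeries_quart {a k q : ℂ} (ha : a ≠ 0) (hk : k ≠ 0) (hq : q ≠ 0) (n : ℕ)
    (hpre₁ : qPochs [-k, a * q] q n ≠ 0) (hpre₂ : qPoch (k * q / a) (q ^ 2) n ≠ 0)
    (hW : WDenNeZero (a * k / q)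
        [a * q / k, k ^ 2 * q ^ (2 * n), q ^ (-(2 * n : ℤ))] (q ^ 2) n)
    (hV : WDenNeZero a [a * q / k, k * q ^ n, q ^ (-(n : ℤ))] q n) :
    wSeries (a * k / q)
        [a * q / k, k ^ 2 * q ^ (2 * n), q ^ (-(2 * n : ℤ))] (q ^ 2) 1
      = wpPrefactor a k q n * wSeries a [a * q / k, k * q ^ n, q ^ (-(n : ℤ))] q 1 := by
  rw [wSeries_eq_sum (x := q ^ (-(2 * n : ℤ))) (N := n) (by simp) (zpow_neg_two_mul_mul_pow hq n),
    wSeries_eq_sum (x := q ^ (-(n : ℤ))) (N := n) (by simp) (by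
      rw [zpow_neg, zpow_natCast, inv_mul_cancel₀ (pow_ne_zero _ hq)])]
  obtain ⟨a', k', x', y', q', ⟨ca, rfl, na⟩, ⟨ck, rfl, nk⟩, -, -, ⟨cq, rfl, nq⟩, hfreq⟩ :=
    exists_path_mulIndep ha hk one_ne_zero one_ne_zero hq
  replace ca := ca.continuousAt (x := 0)
  replace ck := ck.continuousAt (x := 0)
  replace cq := cq.continuousAt (x := 0)
  refine eq_of_frequently_eq (hfreq.mono fun t ht =>
    sum_wTerm_quart_of_mulIndep ht (na t) (nk t) (nq t) n) ?_ ?_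
  · refine continuousAt_sum_wTerm ?_ ?_ ?_ (fun j => ?_) (fun j => ?_) hW <;>
    try simp only [List.map_cons, List.map_nil]
    all_goals repeat' with_reducible first
      | exact continuousAt_qPochs_nil
      | apply ContinuousAt.qPochs_cons
    all_goals fun_prop (disch := simp [ha, hk, hq, zpow_ne_zero _ hq])
  · refine (continuousAt_wpPrefactor ca ck cq ha hpre₁ hpre₂).mul
      (continuousAt_sum_wTerm ?_ ?_ ?_ (fun j => ?_) (fun j => ?_) hV) <;>
    try simp only [List.map_cons, List.map_nil]
    all_goals repeat' with_reducible first
      | exact continuousAt_qPochs_nil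
      | apply ContinuousAt.qPochs_cons
    all_goals fun_prop (disch := simp [ha, hk, hq])

/-- Both sides are $(x^2;q^2)_{2r}$. This handles the Saalschütz closed form, whose factors have a
base point depending on $r$. -/
theorem qPoch_sq_mul_qPoch_sq_mul_pow (x q : ℂ) (r : ℕ) :
    qPoch (x ^ 2) (q ^ 2) r * qPoch (x ^ 2 * (q ^ 2) ^ r) (q ^ 2) r =
      qPoch x (q ^ 2) r * qPoch (x * q) (q ^ 2) r *
        (qPoch (-x) (q ^ 2) r * qPoch (-(x * q)) (q ^ 2) r) := by
  rw [← qPoch_add, ← two_mul, qPoch_sq, qPoch_two_mul, qPoch_two_mul, neg_mul]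

theorem sum_wTerm_saalschuetz_of_mulIndep {a k q x y : ℂ} (h : MulIndep a k x y q) (ha : a ≠ 0)
    (hk : k ≠ 0) (hq : q ≠ 0) (n : ℕ) :
    ∑ j ∈ Finset.range (n + 1), wTerm (a * k / q)
        [-a, k, k / q, -(k / q), a * q ^ 3 / k, k ^ 2 * q ^ (2 * n), q ^ (-(2 * n : ℤ))]
        (q ^ 2) (q ^ 2 * a / k) j =
      wpPrefactor a k q n * ∑ j ∈ Finset.range (n + 1),
          (1 + a) * qPochs [a * q ^ 2 / k, -(a * q ^ 2 / k), k * q ^ n, q ^ (-(n : ℤ))] q j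
            / ((1 + a * q ^ (2 * j))
              * qPochs [a * q ^ (1 - n : ℤ) / k, a * q ^ (1 + n), -q, q] q j)
          * q ^ j := by
  have g := h.baseChangeGeneric ha hk hq
  have hp := g.wpGeneric_source.p_ne
  have f3 : QFree (k ^ 2 / q ^ 2) (q ^ 2) :=
    (h.qFree hq 0 2 0 0 (-2) (by decide) (by simp; field_simp)).base_sq
  have key := baseChange_transform g (wpMatrix_sum_saalschuetz g.wpGeneric_source) n
  convert key using 2 with r hr
  · rw [show [-a, k, k / q, -(k / q), a * q ^ 3 / k, k ^ 2 * q ^ (2 * n), q ^ (-(2 * n : ℤ))] =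
        [-a, k, k / q, -(k / q), a * q ^ 3 / k] ++ [k ^ 2 * (q ^ 2) ^ n, ((q ^ 2) ^ n)⁻¹] by
        rw [zpow_neg_two_mul, pow_mul]; rfl,
      wTerm_append, mul_assoc (wpMatrix _ _ _ _ _)]
    congr 1
    have m1 := g.wpGeneric_source.KA_free.qPoch_ne_zero 0 hp
      (e := k / (a * q)) (by rw [zpow_zero]; field_simp) r
    have m2 := g.wpGeneric_source.A_free.qPoch_ne_zero 1 hp
      (e := a ^ 2 * q ^ 2) (by rw [zpow_one]) r
    have m3 := g.neg_k_free.base_sq.qPoch_ne_zero 0 hp (e := -k)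
      (by rw [zpow_zero, mul_one]) r
    have m4 := (g.neg_a_free.mul_zpow hq 1 (e := -(a * q)) (by
      rw [zpow_one]; ring)).base_sq.qPoch_ne_zero 0 hp (e := -(a * q))
      (by rw [zpow_zero, mul_one]) r
    have m5 := f3.qPoch_ne_zero 0 hp (e := k ^ 2 / q ^ 2) (by rw [zpow_zero, mul_one]) r
    -- Solving for the second factor with $x=k/q$, and below with $x=aq$, rewrites the $r$-dependent
    -- factors of the closed form through ordinary ones.
    have e1 := qPoch_sq_mul_qPoch_sq_mul_pow (k / q) q r
    rw [div_pow, mul_comm (qPoch (k ^ 2 / q ^ 2) _ _), ← eq_div_iff m5,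
      div_mul_cancel₀ k hq] at e1
    have e2 := qPoch_sq_mul_qPoch_sq_mul_pow (a * q) q r
    rw [mul_pow a q 2, mul_comm (qPoch (a ^ 2 * q ^ 2) _ _), ← eq_div_iff m2,
      mul_assoc a q q, ← pow_two q] at e2
    simp only [List.map_cons, List.map_nil, qPochs_cons, qPochs_nil, baseChangeWeight]
    rw [show q ^ 2 * (a * k / q) / -a = -(k * q) by field_simp,
      show q ^ 2 * (a * k / q) / k = a * q by field_simp,
      show q ^ 2 * (a * k / q) / (k / q) = a * q ^ 2 by field_simp,
      show q ^ 2 * (a * k / q) / -(k / q) = -(a * q ^ 2) by field_simp,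
      show q ^ 2 * (a * k / q) / (a * q ^ 3 / k) = k ^ 2 / q ^ 2 by field_simp,
      show a ^ 2 * q ^ 2 / (a * k / q) = a * q ^ 3 / k by field_simp,
      show (a * k / q) ^ 2 / a ^ 2 = k ^ 2 / q ^ 2 by field_simp,
      show a * k / q / a ^ 2 = k / (a * q) by field_simp, e1, e2]
    refine eq_of_mul_inv_cancel (mul_ne_zero (mul_ne_zero (mul_ne_zero m1 m2) m3) m4) ?_
    simp only [div_eq_mul_inv, mul_inv, inv_inv]
    ring
  · refine Finset.sum_congr rfl fun j _ => ?_
    have hqj : q ^ j ≠ 0 := pow_ne_zero _ hq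
    rw [← qPochs_div_eq_wpMatrix hq, baseChangeFactor,
      show (a ^ 2) ^ 2 * q ^ 2 / (a * k / q) ^ 2 = (a * q ^ 2 / k) ^ 2 by field_simp,
      qPoch_sq, show qPoch (q ^ 2) (q ^ 2) j = qPoch q q j * qPoch (-q) q j from qPoch_sq q q j,
      show (q ^ 2) ^ j = q ^ j * q ^ j by ring]
    simp only [qPochs_cons, qPochs_nil]
    generalize 1 + a * q ^ (2 * j) = d
    refine eq_of_mul_inv_cancel hqj ?_
    simp only [div_eq_mul_inv, mul_inv]
    ring

theorem wSeries_saalschuetz {a k q : ℂ} (ha : a ≠ 0) (hk : k ≠ 0) (hq : q ≠ 0) (n : ℕ)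
    (hpre₁ : qPochs [-k, a * q] q n ≠ 0) (hpre₂ : qPoch (k * q / a) (q ^ 2) n ≠ 0)
    (hW : WDenNeZero (a * k / q)
        [-a, k, k / q, -(k / q), a * q ^ 3 / k, k ^ 2 * q ^ (2 * n), q ^ (-(2 * n : ℤ))]
        (q ^ 2) n)
    (hB : ∀ j ≤ n, 1 + a * q ^ (2 * j) ≠ 0)
    (hC : qPochs [a * q ^ (1 - n : ℤ) / k, a * q ^ (1 + n), -q, q] q n ≠ 0) :
    wSeries (a * k / q)
        [-a, k, k / q, -(k / q), a * q ^ 3 / k, k ^ 2 * q ^ (2 * n), q ^ (-(2 * n : ℤ))]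
        (q ^ 2) (q ^ 2 * a / k)
      = wpPrefactor a k q n * ∑ j ∈ Finset.range (n + 1),
          (1 + a) * qPochs [a * q ^ 2 / k, -(a * q ^ 2 / k), k * q ^ n, q ^ (-(n : ℤ))] q j
            / ((1 + a * q ^ (2 * j))
              * qPochs [a * q ^ (1 - n : ℤ) / k, a * q ^ (1 + n), -q, q] q j)
          * q ^ j := by
  rw [wSeries_eq_sum (x := q ^ (-(2 * n : ℤ))) (N := n) (by simp) (zpow_neg_two_mul_mul_pow hq n)]
  obtain ⟨a', k', x', y', q', ⟨ca, rfl, na⟩, ⟨ck, rfl, nk⟩, -, -, ⟨cq, rfl, nq⟩, hfreq⟩ :=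
    exists_path_mulIndep ha hk one_ne_zero one_ne_zero hq
  replace ca := ca.continuousAt (x := 0)
  replace ck := ck.continuousAt (x := 0)
  replace cq := cq.continuousAt (x := 0)
  refine eq_of_frequently_eq (hfreq.mono fun t ht =>
    sum_wTerm_saalschuetz_of_mulIndep ht (na t) (nk t) (nq t) n) ?_ ?_
  · refine continuousAt_sum_wTerm ?_ ?_ ?_ (fun j => ?_) (fun j => ?_) hW <;>
    try simp only [List.map_cons, List.map_nil]
    all_goals repeat' with_reducible first
      | exact continuousAt_qPochs_nil
      | apply ContinuousAt.qPochs_cons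
    all_goals fun_prop (disch := simp [ha, hk, hq, zpow_ne_zero _ hq])
  · refine (continuousAt_wpPrefactor ca ck cq ha hpre₁ hpre₂).mul
      (tendsto_finsetSum _ fun j hj => ?_)
    have hj := Nat.lt_succ_iff.1 (Finset.mem_range.1 hj)
    refine ContinuousAt.mul (ContinuousAt.div (ContinuousAt.mul ?_ ?_) (ContinuousAt.mul ?_ ?_)
      (mul_ne_zero (hB j hj) (qPochs_ne_zero_of_le hj hC))) (cq.pow j)
    all_goals repeat' with_reducible first
      | exact continuousAt_qPochs_nil
      | apply ContinuousAt.qPochs_cons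
    all_goals fun_prop (disch := simp [hq])

theorem MulIndep.baseChangeGeneric_sq {a k r x y q : ℂ} (h : MulIndep r k x y q) (hr : r ^ 2 = a)
    (hr0 : r ≠ 0) (hk : k ≠ 0) (hq : q ≠ 0) : BaseChangeGeneric a k q where
  q_ne := hq
  a_ne := hr ▸ pow_ne_zero 2 hr0
  k_ne := hk
  q_free := h.notRootOfUnity
  a_free := h.qFree hq 2 0 0 0 0 (by decide) (by rw [← hr]; simp)
  neg_a_free := h.qFree hq 2 0 0 0 0 (by decide) (by rw [← hr]; simp)
  k_free := h.qFree hq 0 1 0 0 0 (by decide) (by simp)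
  neg_k_free := h.qFree hq 0 1 0 0 0 (by decide) (by simp)
  ak_free := h.qFree hq 2 1 0 0 0 (by decide) (by rw [← hr]; simp)
  ka_free := h.qFree hq (-2) 1 0 0 0 (by decide) (by rw [← hr]; simp; field_simp)

theorem sum_wTerm_lin_of_mulIndep {a k q r x y : ℂ} (h : MulIndep r k x y q) (hr : r ^ 2 = a)
    (hr0 : r ≠ 0) (hk : k ≠ 0) (hq : q ≠ 0) (n : ℕ) :
    ∑ j ∈ Finset.range (n + 1), wTerm (a * k / q)
        [-a, -(k / q), a * q ^ 3 / k, k ^ 2 * q ^ (2 * n), q ^ (-(2 * n : ℤ))] (q ^ 2) 1 j =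
      wpPrefactor a k q n * ∑ j ∈ Finset.range (n + 1), wTerm a
          [Complex.I * r, -(Complex.I * r), a * q ^ 2 / k, k * q ^ n, q ^ (-(n : ℤ))] q 1 j := by
  have g := h.baseChangeGeneric_sq hr hr0 hk hq
  have hp := g.wpGeneric_source.p_ne
  have ha := g.a_ne
  have f3 : QFree (k ^ 2 / q ^ 2) (q ^ 2) :=
    (h.qFree hq 0 2 0 0 (-2) (by decide) (by simp; field_simp)).base_sq
  have f4 : QFree (k / q) q := h.qFree hq 0 1 0 0 (-1) (by decide) (by simp; field_simp)
  have key := baseChange_transform g (wpMatrix_sum_lin ha hk hq g.wpGeneric_source g.neg_a_free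
    g.a_free f3 f4 g.q_free) n
  convert key using 2 with i hi
  · rw [show [-a, -(k / q), a * q ^ 3 / k, k ^ 2 * q ^ (2 * n), q ^ (-(2 * n : ℤ))] =
        [-a, -(k / q), a * q ^ 3 / k] ++ [k ^ 2 * (q ^ 2) ^ n, ((q ^ 2) ^ n)⁻¹] by
        rw [zpow_neg_two_mul, pow_mul]; rfl,
      wTerm_append, mul_assoc (wpMatrix _ _ _ _ _)]
    congr 1
    have m1 := g.wpGeneric_source.KA_free.qPoch_ne_zero 0 hp
      (e := k / (a * q)) (by rw [zpow_zero]; field_simp) i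
    have m2 := g.wpGeneric_source.A_free.qPoch_ne_zero 1 hp
      (e := a ^ 2 * q ^ 2) (by rw [zpow_one]) i
    have m3 := g.neg_k_free.base_sq.qPoch_ne_zero 0 hp (e := -k)
      (by rw [zpow_zero, mul_one]) i
    have m4 := (g.neg_a_free.mul_zpow hq 1 (e := -(a * q)) (by
      rw [zpow_one]; ring)).base_sq.qPoch_ne_zero 0 hp (e := -(a * q))
      (by rw [zpow_zero, mul_one]) i
    have m5 : (q ^ 2 * a / k) ^ i ≠ 0 := pow_ne_zero _ (div_ne_zero (mul_ne_zero hp ha) hk)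
    simp only [List.map_cons, List.map_nil, qPochs_cons, qPochs_nil, baseChangeWeight, one_pow]
    rw [show q ^ 2 * (a * k / q) / -a = -(k * q) by field_simp,
      show q ^ 2 * (a * k / q) / -(k / q) = -(a * q ^ 2) by field_simp,
      show q ^ 2 * (a * k / q) / (a * q ^ 3 / k) = k ^ 2 / q ^ 2 by field_simp,
      show k / (q ^ 2 * a) = (q ^ 2 * a / k)⁻¹ by rw [inv_div], inv_pow]
    generalize (q ^ 2 * a / k) ^ i = z at *
    refine eq_of_mul_inv_cancel (mul_ne_zero (mul_ne_zero (mul_ne_zero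
      (mul_ne_zero m1 m2) m3) m4) m5) ?_
    simp only [div_eq_mul_inv, mul_inv]
    ring
  · refine Finset.sum_congr rfl fun j _ => ?_
    rw [show [Complex.I * r, -(Complex.I * r), a * q ^ 2 / k, k * q ^ n, q ^ (-(n : ℤ))] =
        [Complex.I * r, -(Complex.I * r), a * q ^ 2 / k] ++ [k * q ^ n, (q ^ n)⁻¹] by
        rw [zpow_neg, zpow_natCast]; rfl,
      wTerm_append, mul_assoc (wpMatrix _ _ _ _ _)]
    congr 1
    have m2 := g.neg_a_free.one_sub_ne 0 (e := -a) (by simp)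
    have m5 := g.neg_a_free.base_sq.qPoch_ne_zero 0 hp (e := -a) (by rw [zpow_zero, mul_one]) j
    have hqj : q ^ j ≠ 0 := pow_ne_zero _ hq
    have hI := Complex.I_ne_zero
    -- The parameters $\pm ir$ combine to $(-a;q^2)_j$ and their partners $\mp iqr$ to
    -- $(-aq^2;q^2)_j$. The quotient is $(1+a)/(1+aq^{2j})$, which is the column factor up to
    -- $q^{-j}$.
    have e1 : qPoch (Complex.I * r) q j * qPoch (-(Complex.I * r)) q j = qPoch (-a) (q ^ 2) j := by
      rw [← qPoch_sq, mul_pow, Complex.I_sq, hr, neg_one_mul]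
    have e2 : qPoch (-(q * (Complex.I * r))) q j * qPoch (q * (Complex.I * r)) q j =
        qPoch (-a) (q ^ 2) j * ((1 - -a * (q ^ 2) ^ j) / (1 - -a)) := by
      rw [mul_comm, ← qPoch_sq, ← qPoch_mul_left_eq m2, mul_pow, mul_pow, Complex.I_sq, hr,
        neg_one_mul]
    simp only [List.map_cons, List.map_nil, qPochs_cons, qPochs_nil, one_pow, mul_one]
    rw [show q * a / (Complex.I * r) = -(q * (Complex.I * r)) by
        rw [← hr]; field_simp; rw [Complex.I_sq]; ring,
      show q * a / -(Complex.I * r) = q * (Complex.I * r) by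
        rw [← hr]; field_simp; rw [Complex.I_sq],
      show q * a / (a * q ^ 2 / k) = k / q by field_simp,
      ← mul_assoc (qPoch (Complex.I * r) q j), e1,
      ← mul_assoc (qPoch (-(q * (Complex.I * r))) q j), e2, baseChangeFactor, ← pow_mul q 2 j]
    simp only [sub_neg_eq_add, neg_mul] at *
    generalize 1 + a * q ^ (2 * j) = d
    refine eq_of_mul_inv_cancel hqj (eq_of_mul_inv_cancel m5 ?_).symm
    simp only [div_eq_mul_inv, mul_inv, inv_inv]
    ring

theorem wSeries_lin {a k q r : ℂ} (ha : a ≠ 0) (hk : k ≠ 0) (hq : q ≠ 0) (n : ℕ)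
    (hpre₁ : qPochs [-k, a * q] q n ≠ 0) (hpre₂ : qPoch (k * q / a) (q ^ 2) n ≠ 0)
    (hr : r ^ 2 = a)
    (hW : WDenNeZero (a * k / q)
        [-a, -(k / q), a * q ^ 3 / k, k ^ 2 * q ^ (2 * n), q ^ (-(2 * n : ℤ))] (q ^ 2) n)
    (hV : WDenNeZero a
        [Complex.I * r, -(Complex.I * r), a * q ^ 2 / k, k * q ^ n, q ^ (-(n : ℤ))] q n) :
    wSeries (a * k / q)
        [-a, -(k / q), a * q ^ 3 / k, k ^ 2 * q ^ (2 * n), q ^ (-(2 * n : ℤ))] (q ^ 2) 1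
      = wpPrefactor a k q n *
        wSeries a
          [Complex.I * r, -(Complex.I * r), a * q ^ 2 / k, k * q ^ n, q ^ (-(n : ℤ))] q 1 := by
  rw [wSeries_eq_sum (x := q ^ (-(2 * n : ℤ))) (N := n) (by simp) (zpow_neg_two_mul_mul_pow hq n),
    wSeries_eq_sum (x := q ^ (-(n : ℤ))) (N := n) (by simp) (by
      rw [zpow_neg, zpow_natCast, inv_mul_cancel₀ (pow_ne_zero _ hq)])]
  -- Now $r$ rather than $a$ is the free parameter, so that the square root moves continuously.
  subst hr
  have hr0 : r ≠ 0 := ne_zero_pow two_ne_zero ha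
  obtain ⟨r', k', x', y', q', ⟨cr, rfl, nr⟩, ⟨ck, rfl, nk⟩, -, -, ⟨cq, rfl, nq⟩, hfreq⟩ :=
    exists_path_mulIndep hr0 hk one_ne_zero one_ne_zero hq
  replace cr := cr.continuousAt (x := 0)
  replace ck := ck.continuousAt (x := 0)
  replace cq := cq.continuousAt (x := 0)
  have hI := Complex.I_ne_zero
  refine eq_of_frequently_eq (hfreq.mono fun t ht =>
    sum_wTerm_lin_of_mulIndep ht rfl (nr t) (nk t) (nq t) n) ?_ ?_
  · refine continuousAt_sum_wTerm ?_ ?_ ?_ (fun j => ?_) (fun j => ?_) hW <;>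
    try simp only [List.map_cons, List.map_nil]
    all_goals repeat' with_reducible first
      | exact continuousAt_qPochs_nil
      | apply ContinuousAt.qPochs_cons
    all_goals fun_prop (disch := simp [hr0, hk, hq, zpow_ne_zero _ hq])
  · refine (continuousAt_wpPrefactor (cr.pow 2) ck cq ha hpre₁ hpre₂).mul
      (continuousAt_sum_wTerm ?_ ?_ ?_ (fun j => ?_) (fun j => ?_) hV) <;>
    try simp only [List.map_cons, List.map_nil]
    all_goals repeat' with_reducible first
      | exact continuousAt_qPochs_nil
      | apply ContinuousAt.qPochs_cons
    all_goals fun_prop (disch := simp [hr0, hk, hq])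

end

/-! ### The eight transformations together -/

theorem mainTheorem11 (a k q : ℂ) (ha : a ≠ 0) (hk : k ≠ 0) (hq : q ≠ 0) (n : ℕ)
    (hpre₁ : qPochs [-k, a * q] q n ≠ 0) (hpre₂ : qPoch (k * q / a) (q ^ 2) n ≠ 0) :
    -- first transformation: `₁₀W₉`, two free parameters
    (∀ ρ₁ ρ₂ : ℂ, ρ₁ ≠ 0 → ρ₂ ≠ 0 →
      WDenNeZero (a * k / q)
        [-a, -(a * q), k * ρ₁ / (a * q), k * ρ₂ / (a * q), a ^ 2 * q ^ 2 / (ρ₁ * ρ₂),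
          k ^ 2 * q ^ (2 * n), q ^ (-(2 * n : ℤ))] (q ^ 2) n →
      qPochs [a * q ^ (1 - n : ℤ) / k, a * q ^ (1 + n)] q n ≠ 0 →
      qPochs [a, a ^ 2 * q ^ 2 / ρ₁, a ^ 2 * q ^ 2 / ρ₂, k * ρ₁ * ρ₂ / (a * q), q ^ 2]
        (q ^ 2) n ≠ 0 →
      wSeries (a * k / q)
        [-a, -(a * q), k * ρ₁ / (a * q), k * ρ₂ / (a * q), a ^ 2 * q ^ 2 / (ρ₁ * ρ₂),
          k ^ 2 * q ^ (2 * n), q ^ (-(2 * n : ℤ))] (q ^ 2) (q ^ 2 * a / k)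
      = wpPrefactor a k q n * ∑ j ∈ Finset.range (n + 1),
          qPochs [k * q ^ n, q ^ (-(n : ℤ))] q j
            / qPochs [a * q ^ (1 - n : ℤ) / k, a * q ^ (1 + n)] q j
          * (qPochs [a ^ 2, a * q ^ 2, ρ₁, ρ₂, a ^ 3 * q ^ 3 / (k * ρ₁ * ρ₂)] (q ^ 2) j
            / qPochs [a, a ^ 2 * q ^ 2 / ρ₁, a ^ 2 * q ^ 2 / ρ₂, k * ρ₁ * ρ₂ / (a * q), q ^ 2]
                (q ^ 2) j)
          * q ^ j) ∧
    -- second transformation: `₇φ₆`; here `s` is a square root of `ak/q`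
    (∀ s : ℂ, s ^ 2 = a * k / q →
      PhiDenNeZero
        [s, -s, -k, -(k * q), a * k * q ^ (2 * n + 1), a * q ^ (1 - 2 * n : ℤ) / k] (q ^ 2) n →
      qPochs [a * q ^ (1 - n : ℤ) / k, a * q ^ (1 + n)] q n ≠ 0 →
      qPochs [a, a ^ 3 * q ^ 5 / k, q ^ 2] (q ^ 2) n ≠ 0 →
      qPochs [a * k / q, a * k * q] (q ^ 4) n ≠ 0 →
      phiSeries
        [q ^ 2 * s, -(q ^ 2 * s), -a, -(a * q), k ^ 2 / (a ^ 2 * q ^ 4),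
          k ^ 2 * q ^ (2 * n), q ^ (-(2 * n : ℤ))]
        [s, -s, -k, -(k * q), a * k * q ^ (2 * n + 1), a * q ^ (1 - 2 * n : ℤ) / k]
        (q ^ 2) (q ^ 2 * a / k)
      = wpPrefactor a k q n * ∑ j ∈ Finset.range (n + 1),
          qPochs [k * q ^ n, q ^ (-(n : ℤ))] q j
            / qPochs [a * q ^ (1 - n : ℤ) / k, a * q ^ (1 + n)] q j
          * (qPochs [a ^ 2, a * q ^ 2, k / (a * q ^ 3)] (q ^ 2) j
            / qPochs [a, a ^ 3 * q ^ 5 / k, q ^ 2] (q ^ 2) j)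
          * (qPochs [q ^ 3 * a ^ 3 / k, q ^ 5 * a ^ 3 / k] (q ^ 4) j
            / qPochs [a * k / q, a * k * q] (q ^ 4) j)
          * q ^ j) ∧
    -- third transformation: `₆φ₅`; here `s = √(ak/q)` and `t = √(a³q/k)` with `s t = a²`, so that
    -- `√(akq³) = q² s` and `√(a³q⁵/k) = q² t`
    (∀ s t : ℂ, s ^ 2 = a * k / q → t ^ 2 = a ^ 3 * q / k → s * t = a ^ 2 →
      PhiDenNeZero
        [-s, -k, -(k * q), a * k * q ^ (2 * n + 1), a * q ^ (1 - 2 * n : ℤ) / k] (q ^ 2) n →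
      qPochs [a * q ^ (1 - n : ℤ) / k, a * q ^ (1 + n)] q n ≠ 0 →
      qPochs [a, a ^ 3 * q ^ 3 / k, q ^ 2 * s, -s, q ^ 2] (q ^ 2) n ≠ 0 →
      qPoch (a * k * q) (q ^ 4) n ≠ 0 →
      phiSeries
        [-(q ^ 2 * s), -a, -(a * q), k ^ 2 / (a ^ 2 * q ^ 2),
          k ^ 2 * q ^ (2 * n), q ^ (-(2 * n : ℤ))]
        [-s, -k, -(k * q), a * k * q ^ (2 * n + 1), a * q ^ (1 - 2 * n : ℤ) / k]
        (q ^ 2) (q ^ 2 * a / k)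
      = wpPrefactor a k q n * ∑ j ∈ Finset.range (n + 1),
          qPochs [k * q ^ n, q ^ (-(n : ℤ))] q j
            / qPochs [a * q ^ (1 - n : ℤ) / k, a * q ^ (1 + n)] q j
          * (qPochs [a ^ 2, a * q ^ 2, k / (a * q), t, -(q ^ 2 * t)] (q ^ 2) j
            / qPochs [a, a ^ 3 * q ^ 3 / k, q ^ 2 * s, -s, q ^ 2] (q ^ 2) j)
          * (qPoch (q ^ 3 * a ^ 3 / k) (q ^ 4) j / qPoch (a * k * q) (q ^ 4) j)
          * q ^ j) ∧
    -- fourth transformation: `₈W₇` to `₁₀W₉`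
    (WDenNeZero (a * k / q)
        [-a, k, a * q / k, k ^ 2 * q ^ (2 * n), q ^ (-(2 * n : ℤ))] (q ^ 2) n →
      WDenNeZero a
        [-a, a * q / k, -(a * q / k), k * q ^ n, k * q ^ (1 + n), q ^ (1 - n : ℤ),
          q ^ (-(n : ℤ))] (q ^ 2) (n / 2) →
      wSeries (a * k / q)
        [-a, k, a * q / k, k ^ 2 * q ^ (2 * n), q ^ (-(2 * n : ℤ))] (q ^ 2) (-q)
      = wpPrefactor a k q n *
        wSeries a
          [-a, a * q / k, -(a * q / k), k * q ^ n, k * q ^ (1 + n), q ^ (1 - n : ℤ),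
            q ^ (-(n : ℤ))] (q ^ 2) (q ^ 2)) ∧
    -- fifth transformation: `₈W₇` to `₈W₇`; here `r` is a square root of `a`
    (∀ r : ℂ, r ^ 2 = a →
      WDenNeZero (a * k / q)
        [-a, -(k / q), a * q ^ 3 / k, k ^ 2 * q ^ (2 * n), q ^ (-(2 * n : ℤ))] (q ^ 2) n →
      WDenNeZero a
        [Complex.I * r, -(Complex.I * r), a * q ^ 2 / k, k * q ^ n, q ^ (-(n : ℤ))] q n →
      wSeries (a * k / q)
        [-a, -(k / q), a * q ^ 3 / k, k ^ 2 * q ^ (2 * n), q ^ (-(2 * n : ℤ))] (q ^ 2) 1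
      = wpPrefactor a k q n *
        wSeries a
          [Complex.I * r, -(Complex.I * r), a * q ^ 2 / k, k * q ^ n, q ^ (-(n : ℤ))] q 1) ∧
    -- sixth transformation: `₆W₅` to `₆W₅`
    (WDenNeZero (a * k / q)
        [a * q / k, k ^ 2 * q ^ (2 * n), q ^ (-(2 * n : ℤ))] (q ^ 2) n →
      WDenNeZero a [a * q / k, k * q ^ n, q ^ (-(n : ℤ))] q n →
      wSeries (a * k / q)
        [a * q / k, k ^ 2 * q ^ (2 * n), q ^ (-(2 * n : ℤ))] (q ^ 2) 1
      = wpPrefactor a k q n * wSeries a [a * q / k, k * q ^ n, q ^ (-(n : ℤ))] q 1) ∧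
    -- seventh transformation: `₁₀W₉`
    (WDenNeZero (a * k / q)
        [-a, k, k / q, -(k / q), a * q ^ 3 / k, k ^ 2 * q ^ (2 * n), q ^ (-(2 * n : ℤ))]
        (q ^ 2) n →
      (∀ j ≤ n, 1 + a * q ^ (2 * j) ≠ 0) →
      qPochs [a * q ^ (1 - n : ℤ) / k, a * q ^ (1 + n), -q, q] q n ≠ 0 →
      wSeries (a * k / q)
        [-a, k, k / q, -(k / q), a * q ^ 3 / k, k ^ 2 * q ^ (2 * n), q ^ (-(2 * n : ℤ))]
        (q ^ 2) (q ^ 2 * a / k)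
      = wpPrefactor a k q n * ∑ j ∈ Finset.range (n + 1),
          (1 + a) * qPochs [a * q ^ 2 / k, -(a * q ^ 2 / k), k * q ^ n, q ^ (-(n : ℤ))] q j
            / ((1 + a * q ^ (2 * j))
              * qPochs [a * q ^ (1 - n : ℤ) / k, a * q ^ (1 + n), -q, q] q j)
          * q ^ j) ∧
    -- eighth transformation: `₁₂W₁₁` in base `q⁴`
    (WDenNeZero (a * k / q)
        [-a, -(a * q), -(a * q ^ 2), -(a * q ^ 3), k ^ 2 / (a ^ 2 * q ^ 2),
          k ^ 2 * q ^ (2 * n), k ^ 2 * q ^ (2 + 2 * n), q ^ (2 - 2 * n : ℤ),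
          q ^ (-(2 * n : ℤ))] (q ^ 4) (n / 2) →
      qPochs [a * q ^ (1 - n : ℤ) / k, a * q ^ (1 + n)] q n ≠ 0 →
      qPochs [a, a ^ 3 * q ^ 3 / k, q ^ 2] (q ^ 2) n ≠ 0 →
      qPoch (a * k * q) (q ^ 4) n ≠ 0 →
      wSeries (a * k / q)
        [-a, -(a * q), -(a * q ^ 2), -(a * q ^ 3), k ^ 2 / (a ^ 2 * q ^ 2),
          k ^ 2 * q ^ (2 * n), k ^ 2 * q ^ (2 + 2 * n), q ^ (2 - 2 * n : ℤ),
          q ^ (-(2 * n : ℤ))] (q ^ 4) (q ^ 4 * a ^ 2 / k ^ 2)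
      = wpPrefactor a k q n * ∑ j ∈ Finset.range (n + 1),
          qPochs [k * q ^ n, q ^ (-(n : ℤ))] q j
            / qPochs [a * q ^ (1 - n : ℤ) / k, a * q ^ (1 + n)] q j
          * (qPochs [a ^ 2, a * q ^ 2, k / (a * q)] (q ^ 2) j
            / qPochs [a, a ^ 3 * q ^ 3 / k, q ^ 2] (q ^ 2) j)
          * (qPoch (a ^ 3 * q ^ 3 / k) (q ^ 4) j / qPoch (a * k * q) (q ^ 4) j)
          * (-(q ^ 2 * a / k)) ^ j) := by
  exact ⟨fun _ _ h1 h2 hW hC hD => wSeries_jackson ha hk hq n hpre₁ hpre₂ h1 h2 hW hC hD,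
    fun _ hs hP hC hD hE => phiSeries_quad ha hk hq n hpre₁ hpre₂ hs hP hC hD hE,
    fun _ _ hs _ ht hP hC hD hE => phiSeries_sqrt ha hk hq n hpre₁ hpre₂ hs ht hP hC hD hE,
    fun hW hV => wSeries_evenCol ha hk hq n hpre₁ hpre₂ hW hV,
    fun _ hr hW hV => wSeries_lin ha hk hq n hpre₁ hpre₂ hr hW hV,
    fun hW hV => wSeries_quart ha hk hq n hpre₁ hpre₂ hW hV,
    fun hW hB hC => wSeries_saalschuetz ha hk hq n hpre₁ hpre₂ hW hB hC,
    fun hW hC hD hE => wSeries_even ha hk hq n hpre₁ hpre₂ hW hC hD hE⟩
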